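/- Let $(\Omega,g)$ be a smooth, compact, connected Riemannian manifold of dimension $d\ge 3$ with smooth, connected (in particular nonempty) boundary $\partial\Omega$ and outward unit normal field $N$. Let $|\Omega|$ and $|\partial\Omega|$ denote the $d$-dimensional volume of $\Omega$ and the $(d-1)$-dimensional Hausdorff measure (area) of $\partial\Omega$, and let $\lambda_\Omega$ and $\lambda_{\partial\Omega}$ be the volume measure on $\Omega$ and the $(d-1)$-dimensional Hausdorff measure on $\partial\Omega$, each normalised to total mass $1$. Write $|\cdot|_\infty$ for the norm of $L^\infty(\Omega,\lambda_\Omega)$, $u^-=\max(-u,0)$ for the negative part, and $C^1(\Omega)$ for the functions that are continuously differentiable up to the boundary. For real $r\ge 1$, call $C\ge 0$ an admissible constant $C_{r,2}$ if the Sobolev–Poincaré inequality $$\left(\int_\Omega\Big|h-\int_\Omega h\,d\lambda_\Omega\Big|^r d\lambda_\Omega\right)^{1/r}\le C\left(\int_\Omega|\nabla h|^2\,d\lambda_\Omega\right)^{1/2}$$ holds for all $h\in C^1(\Omega)$. Let $\rho\in C^1(\Omega)$ be such that $\frac{\partial\rho}{\partial N}=-1$ on $\partial\Omega$ and $\nabla\rho$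 is Lipschitz continuous on $\Omega$ (so that $\Delta\rho$ is defined almost everywhere). Then for every $f\in C^1(\Omega)$ with $\int_\Omega f\,d\lambda_\Omega=0$, every real $p\in\left[2,\frac{2d-2}{d-2}\right]$, and all admissible constants $C_{2(p-1),2}$ and $C_{p,2}$, $$\left(\int_{\partial\Omega}|f|^p\,d\lambda_{\partial\Omega}\right)^{2/p}\le\left(\left(\frac{|\Omega|}{|\partial\Omega|}\,|\nabla\rho|_\infty\,p\right)^{2/p}C_{2(p-1),2}^{\,2(p-1)/p}+\left(\frac{|\Omega|}{|\partial\Omega|}\,|(\Delta\rho)^-|_\infty\right)^{2/p}C_{p,2}^{\,2}\right)\int_\Omega|\nabla f|^2\,d\lambda_\Omega .$$ -/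

import Mathlib

open Set Filter Topology MeasureTheory Bundle Manifold
open scoped ENNReal NNReal ContDiff

noncomputable section

namespace RiemBoundary

variable {d : ℕ} [NeZero d] {M : Type*} [EMetricSpace M]
  [ChartedSpace (EuclideanHalfSpace d) M]
  [RiemannianBundle (fun x : M ↦ TangentSpace (𝓡∂ d) x)]

/-- The Riemannian gradient of `f` at `x`: the tangent vector `∇f(x)` with
`⟪∇f(x), v⟫ = df_x(v)` for all `v ∈ T_xM`. -/
def grad (f : M → ℝ) (x : M) : TangentSpace (𝓡∂ d) x :=
  haveI : FiniteDimensional ℝ (TangentSpace (𝓡∂ d) x) :=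
    inferInstanceAs (FiniteDimensional ℝ (EuclideanSpace ℝ (Fin d)))
  haveI : CompleteSpace (TangentSpace (𝓡∂ d) x) := FiniteDimensional.complete ℝ _
  (InnerProductSpace.toDual ℝ (TangentSpace (𝓡∂ d) x)).symm (mfderiv (𝓡∂ d) 𝓘(ℝ, ℝ) f x)

/-- The outward pointing unit normal vector at a boundary point `x`. The coordinate `x₀` of the
chart at `x` is nonnegative and vanishes exactly on the boundary, so the outward unit normal is
`-∇x₀ / |∇x₀|`. -/
def outwardNormal (x : M) : TangentSpace (𝓡∂ d) x :=
  -(‖grad (d := d) (fun y : M ↦ extChartAt (𝓡∂ d) x y 0) x‖⁻¹ •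
    grad (d := d) (fun y : M ↦ extChartAt (𝓡∂ d) x y 0) x)

/-- The outer normal derivative `∂f/∂N` at a boundary point `x`. -/
def normalDeriv (f : M → ℝ) (x : M) : ℝ :=
  mfderiv (𝓡∂ d) 𝓘(ℝ, ℝ) f x (outwardNormal (d := d) x)

/-- The components of a vector field `X` in the chart at `x₀`, as a function of the coordinates. -/
def chartField (X : ∀ x : M, TangentSpace (𝓡∂ d) x) (x₀ : M) (y : EuclideanSpace ℝ (Fin d)) :
    EuclideanSpace ℝ (Fin d) :=
  mfderiv (𝓡∂ d) 𝓘(ℝ, EuclideanSpace ℝ (Fin d)) (extChartAt (𝓡∂ d) x₀)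
    ((extChartAt (𝓡∂ d) x₀).symm y) (X ((extChartAt (𝓡∂ d) x₀).symm y))

/-- Lipschitz continuity of a vector field: near every point its components in a chart are
Lipschitz functions of the coordinates. On a compact manifold this is Lipschitz continuity. -/
def IsLipschitzField (X : ∀ x : M, TangentSpace (𝓡∂ d) x) : Prop :=
  ∀ x₀ : M, ∃ K : ℝ≥0, ∃ U ∈ 𝓝[range (𝓡∂ d)] (extChartAt (𝓡∂ d) x₀ x₀),
    LipschitzOnWith K (chartField X x₀) U

/-- The coordinate vector field `∂_i` of the chart at `x₀`, at the point with coordinates `y`. -/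
def coordVec (x₀ : M) (y : EuclideanSpace ℝ (Fin d)) (i : Fin d) :
    TangentSpace (𝓡∂ d) ((extChartAt (𝓡∂ d) x₀).symm y) :=
  mfderivWithin 𝓘(ℝ, EuclideanSpace ℝ (Fin d)) (𝓡∂ d) (extChartAt (𝓡∂ d) x₀).symm
    (range (𝓡∂ d)) y (EuclideanSpace.single i (1 : ℝ))

/-- `√(det (g_ij))` in the chart at `x₀`, as a function of the coordinates. -/
def sqrtDetMetric (x₀ : M) (y : EuclideanSpace ℝ (Fin d)) : ℝ :=
  √(Matrix.det (Matrix.of fun i j : Fin d ↦ inner ℝ (coordVec x₀ y i) (coordVec x₀ y j)))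

/-- The Riemannian divergence `(1/√g) ∑ ∂_i (√g X^i)` of a vector field `X` at `x`, in the chart
at `x`. For Lipschitz `X` it is defined at almost every point. -/
def divergence (X : ∀ x : M, TangentSpace (𝓡∂ d) x) (x : M) : ℝ :=
  (sqrtDetMetric (d := d) x (extChartAt (𝓡∂ d) x x))⁻¹ *
    ∑ i : Fin d, fderivWithin ℝ (fun y ↦ sqrtDetMetric x y * chartField X x y i)
      (range (𝓡∂ d)) (extChartAt (𝓡∂ d) x x) (EuclideanSpace.single i (1 : ℝ))

/-- The Laplace–Beltrami operator `Δf = div ∇f`. -/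
def laplacian (f : M → ℝ) (x : M) : ℝ :=
  divergence (d := d) (grad (d := d) f) x

/-- The normalised Riemannian volume measure `λ_Ω`. The measure `μHE[d]` is the `d`-dimensional
Hausdorff measure of the Riemannian distance, scaled to agree with Lebesgue measure on `ℝ^d`. -/
def lamInterior (d : ℕ) (M : Type*) [EMetricSpace M] [MeasurableSpace M] [BorelSpace M] :
    Measure M :=
  (μHE[d] (univ : Set M))⁻¹ • μHE[d]

/-- The normalised `(d-1)`-dimensional Hausdorff measure `λ_∂Ω` on the boundary, as a measure on
the whole manifold. -/
def lamBoundary (d : ℕ) [NeZero d] (M : Type*) [EMetricSpace M] [MeasurableSpace M] [BorelSpace M]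
    [ChartedSpace (EuclideanHalfSpace d) M] : Measure M :=
  (μHE[d - 1] ((𝓡∂ d).boundary M))⁻¹ • (μHE[d - 1]).restrict ((𝓡∂ d).boundary M)

/-- The ratio `|Ω| / |∂Ω|` of the volume of the manifold and the area of its boundary. -/
def volumeRatio (d : ℕ) [NeZero d] (M : Type*) [EMetricSpace M] [MeasurableSpace M] [BorelSpace M]
    [ChartedSpace (EuclideanHalfSpace d) M] : ℝ :=
  (μHE[d] (univ : Set M)).toReal / (μHE[d - 1] ((𝓡∂ d).boundary M)).toReal

/-- The `L^∞`-norm of a real function with respect to `λ_Ω`. -/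
def supNorm (d : ℕ) {M : Type*} [EMetricSpace M] [MeasurableSpace M] [BorelSpace M]
    (u : M → ℝ) : ℝ :=
  (eLpNorm u ∞ (lamInterior d M)).toReal

/-- `C` is an admissible constant in the `(p, q)` Sobolev–Poincaré inequality
`(∫ |f - f̄|^p dλ_Ω)^(1/p) ≤ C (∫ |∇f|^q dλ_Ω)^(1/q)`, where `f̄ = ∫ f dλ_Ω`. -/
def IsSobolevPoincareConst (d : ℕ) [NeZero d] (M : Type*) [EMetricSpace M] [MeasurableSpace M]
    [BorelSpace M] [ChartedSpace (EuclideanHalfSpace d) M]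
    [RiemannianBundle (fun x : M ↦ TangentSpace (𝓡∂ d) x)] (p q C : ℝ) : Prop :=
  0 ≤ C ∧ ∀ f : M → ℝ, ContMDiff (𝓡∂ d) 𝓘(ℝ, ℝ) 1 f →
    (∫ x, |f x - ∫ z, f z ∂lamInterior d M| ^ p ∂lamInterior d M) ^ (1 / p) ≤
      C * (∫ x, ‖grad (d := d) f x‖ ^ q ∂lamInterior d M) ^ (1 / q)

end RiemBoundary

end

/-! Because ∂ρ/∂N = -1, the divergence theorem for the field |f|^p ∇ρ turns the boundary integral of
|f|^p into -∫ (p |f|^(p-2) f ⟨∇f, ∇ρ⟩ + |f|^p Δρ) over Ω. This is at most p |∇ρ|_∞ ∫ |f|^(p-1) |∇f|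
+ |(Δρ)⁻|_∞ ∫ |f|^p (`setIntegral_boundary_rpow_le`). Write D = ∫ |∇f|² for the normalised volume.
As f has mean zero, Cauchy–Schwarz and the inequality with exponent 2(p-1) bound the normalised
first integral by A^(p-1) D^(p/2), and the inequality with exponent p bounds the second by B^p
D^(p/2). Since 2/p ≤ 1, the power t ↦ t^(2/p) is subadditive, which splits the sum into the two
terms of the claim (`rpow_two_div_le`).

Most of the work is the divergence theorem itself (`divergence_theorem`), for a field that is only
Lipschitz and for volume and area given as Hausdorff measures of the Riemannian distance. A
partition of unity reduces it to functions supported in a coordinate ball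
(`local_divergence_theorem`), where four facts meet.

(1) On a Euclidean half space the theorem for Lipschitz functions is Fubini plus the fundamental
theorem of calculus for absolutely continuous functions (`setIntegral_fderiv_halfSpace`).

(2) Near each point the chart, followed by a suitable linear map, is bi-Lipschitz with constants
close to 1. Hence on a coordinate subspace the Hausdorff measure has the Jacobian of the inverse
chart as its density (`euclideanHausdorffMeasure_eq_coordMeasure`). The density is √g for the volume
and √g |∇x₀| for the boundary area (`coordJac_boundaryIncl`).

(3) `divergence` at x is computed in the chart at x, whereas integration uses one fixed chart. The
coefficients √g X form a vector density, so the Piola identity (`trace_fderiv_of_vectorDensity`)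
makes the two computations agree (`sqrtDetMetric_mul_divergence`).

(4) The condition ∂ρ/∂N = -1 forces the first component of ∇ρ in any chart to equal |∇x₀| on the
boundary (`toCoord_grad_zero_of_normalDeriv`). So the flux density √g (∇ρ)₀ is exactly the area
density. -/

noncomputable section

namespace RiemBoundary

/-! ### Jacobi's formula and the Piola identity -/

section Piola

variable {d : ℕ}

lemma trace_eq_sum_apply_single (L : EuclideanSpace ℝ (Fin d) →ₗ[ℝ] EuclideanSpace ℝ (Fin d)) :
    LinearMap.trace ℝ _ L = ∑ i, L (EuclideanSpace.single i (1 : ℝ)) i := by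
  rw [LinearMap.trace_eq_sum_inner L (EuclideanSpace.basisFun (Fin d) ℝ)]
  simp [EuclideanSpace.inner_single_left]

variable {E : Type*} [NormedAddCommGroup E] [NormedSpace ℝ E] [FiniteDimensional ℝ E]

lemma differentiable_linearMap_det :
    Differentiable ℝ (fun B : E →L[ℝ] E ↦
      LinearMap.det (B : E →ₗ[ℝ] E)) := by
  set b := Module.finBasis ℝ E
  have h : ∀ B : E →L[ℝ] E, LinearMap.det (B : E →ₗ[ℝ] E) =
      ∑ σ : Equiv.Perm (Fin (Module.finrank ℝ E)), ((Equiv.Perm.sign σ : ℤ) : ℝ) *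
        ∏ i, (b.coord (σ i)).toContinuousLinearMap (B (b i)) := by
    intro B
    rw [← LinearMap.det_toMatrix b, Matrix.det_apply']
    simp [LinearMap.toMatrix_apply]
  simp_rw [h]
  fun_prop

/-- As a polynomial in t the determinant is 1 + t tr B + t² q(t), and the last term has derivative
zero at 0. -/
lemma hasDerivAt_linearMap_det_one_add_smul (B : E →ₗ[ℝ] E) :
    HasDerivAt (fun t : ℝ ↦ LinearMap.det (1 + t • B)) (LinearMap.trace ℝ _ B) 0 := by
  set b := Module.finBasis ℝ E
  have h : ∀ t : ℝ, LinearMap.det (1 + t • B) = (1 + (LinearMap.toMatrix b b B).trace * t +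
      (Matrix.det (1 + (Polynomial.X : Polynomial ℝ) •
        (LinearMap.toMatrix b b B).map Polynomial.C)).divX.divX.eval t * t ^ 2) := by
    intro t
    rw [← Matrix.det_one_add_smul, ← LinearMap.det_toMatrix b]
    simp
  simp_rw [h, LinearMap.trace_eq_matrix_trace ℝ b]
  set p := (Matrix.det (1 + (Polynomial.X : Polynomial ℝ) •
        (LinearMap.toMatrix b b B).map Polynomial.C)).divX.divX
  have h1 : HasDerivAt (fun t : ℝ ↦ 1 + (LinearMap.toMatrix b b B).trace * t)
      (LinearMap.toMatrix b b B).trace 0 := by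
    simpa using ((hasDerivAt_id (0 : ℝ)).const_mul (LinearMap.toMatrix b b B).trace).const_add 1
  have h2 : HasDerivAt (fun t : ℝ ↦ p.eval t * t ^ 2) 0 0 := by
    simpa using (p.hasDerivAt 0).fun_mul (hasDerivAt_pow 2 (0 : ℝ))
  simpa using h1.fun_add h2

/-- Jacobi's formula: factor A + tB = A (1 + t A⁻¹B) and use multiplicativity of the determinant. -/
lemma fderiv_linearMap_det (A : E ≃L[ℝ] E)
    (B : E →L[ℝ] E) :
    fderiv ℝ (fun B : E →L[ℝ] E ↦
      LinearMap.det (B : E →ₗ[ℝ] E)) A B =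
    LinearMap.det (A : E →ₗ[ℝ] E) *
      LinearMap.trace ℝ _ ((A.symm : E →L[ℝ] E) ∘L B :
        E →L[ℝ] E).toLinearMap := by
  set f := (fun B : E →L[ℝ] E ↦
      LinearMap.det (B : E →ₗ[ℝ] E))
  have h1 : HasDerivAt (fun t : ℝ ↦ f (A + t • B)) (fderiv ℝ f A B) 0 := by
    have h0 : HasFDerivAt f (fderiv ℝ f A)
        ((A : E →L[ℝ] E) + (0 : ℝ) • B) := by
      rw [zero_smul, add_zero]
      exact differentiable_linearMap_det.differentiableAt.hasFDerivAt
    have h2 : HasDerivAt (fun t : ℝ ↦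
        (A : E →L[ℝ] E) + t • B) B 0 := by
      simpa using ((hasDerivAt_id (0 : ℝ)).smul_const B).const_add
        (A : E →L[ℝ] E)
    exact h0.comp_hasDerivAt (0 : ℝ) h2
  have h3 := (hasDerivAt_linearMap_det_one_add_smul
    ((A.symm : E →L[ℝ] E) ∘L B :
        E →L[ℝ] E).toLinearMap).const_mul
    (LinearMap.det (A : E →ₗ[ℝ] E))
  refine h1.unique (h3.congr_of_eventuallyEq (Eventually.of_forall fun t ↦ ?_))
  simp only [f]
  rw [← LinearMap.det_comp]
  congr 1
  ext v : 1
  simp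

/-- The trace form of the Piola identity: if `V'` is the pull back of `V` by a `C²` map `ψ` with
invertible derivative, as vector densities, then the divergence of `V'` is the pull back of the
divergence of `V`. -/
theorem trace_fderiv_of_vectorDensity {ψ V V' : E → E}
    {a : E} (hψ : ContDiffAt ℝ 2 ψ a)
    (A : E ≃L[ℝ] E)
    (hA : fderiv ℝ ψ a = A) (hV : DifferentiableAt ℝ V (ψ a))
    (h : ∀ᶠ z in 𝓝 a, fderiv ℝ ψ z (V' z) =
      |LinearMap.det (fderiv ℝ ψ z : E →ₗ[ℝ] E)| •
        V (ψ z)) :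
    DifferentiableAt ℝ V' a ∧ LinearMap.trace ℝ _ (fderiv ℝ V' a).toLinearMap =
      |LinearMap.det (A : E →ₗ[ℝ] E)| *
        LinearMap.trace ℝ _ (fderiv ℝ V (ψ a)).toLinearMap := by
  have hψd : DifferentiableAt ℝ (fderiv ℝ ψ) a :=
    (hψ.fderiv_right (m := 1) (by norm_num)).differentiableAt (by simp)
  have hψ1 : DifferentiableAt ℝ ψ a := hψ.differentiableAt (by simp)
  have hdet0 : LinearMap.det (A : E →ₗ[ℝ] E) ≠ 0 := by
    exact (LinearEquiv.isUnit_det' A.toLinearEquiv).ne_zero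
  set J : E → ℝ := fun z ↦ |LinearMap.det (fderiv ℝ ψ z : E →ₗ[ℝ] E)| with hJ
  set D2 := fderiv ℝ (fderiv ℝ ψ) a with hD2
  have hsymm : ∀ v w, D2 v w = D2 w v := fun v w ↦
    (hψ.isSymmSndFDerivAt (by simp)) v w
  have hJd : HasFDerivAt J (|LinearMap.det (A : E →ₗ[ℝ] E)| •
      ((LinearMap.trace ℝ E ∘ₗ ContinuousLinearMap.coeLM ℝ).toContinuousLinearMap ∘L
        (ContinuousLinearMap.compL ℝ E E E (A.symm : E →L[ℝ] E)) ∘L D2)) a := by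
    have h1 : HasFDerivAt (fun z ↦ LinearMap.det (fderiv ℝ ψ z : E →ₗ[ℝ] E))
      ((fderiv ℝ (fun B : E →L[ℝ] E ↦ LinearMap.det (B : E →ₗ[ℝ] E)) (fderiv ℝ ψ a)) ∘L D2) a :=
      HasFDerivAt.comp (g := fun B : E →L[ℝ] E ↦ LinearMap.det (B : E →ₗ[ℝ] E)) a
        differentiable_linearMap_det.differentiableAt.hasFDerivAt hψd.hasFDerivAt
    have h2 : HasDerivAt (fun x : ℝ ↦ |x|) (SignType.sign (LinearMap.det (A : E →ₗ[ℝ] E)) : ℝ)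
        (LinearMap.det (fderiv ℝ ψ a : E →ₗ[ℝ] E)) := by
      rw [hA]; exact hasDerivAt_abs hdet0
    refine (h2.comp_hasFDerivAt a h1).congr_fderiv ?_
    ext v
    rw [hA]
    simp only [smul_apply, ContinuousLinearMap.comp_apply,
      fderiv_linearMap_det, smul_eq_mul]
    rw [← mul_assoc, sign_mul_self]
    rfl
  have hinv : ∀ᶠ z in 𝓝 a, (fderiv ℝ ψ z).IsInvertible := by
    have : ∀ᶠ B in 𝓝 (fderiv ℝ ψ a), B.IsInvertible := by
      rw [hA]
      have := ContinuousLinearEquiv.nhds A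
      filter_upwards [this] with B hB
      exact hB
    exact hψd.continuousAt.eventually this
  -- Solving the relation for `V'` near `a` exhibits it as a composition of differentiable maps, so
  -- its differentiability need not be assumed.
  have hV'eq : V' =ᶠ[𝓝 a] fun z ↦ (fderiv ℝ ψ z).inverse (J z • V (ψ z)) := by
    filter_upwards [h, hinv] with z hz hzi
    rw [← hz]
    obtain ⟨e, he⟩ := hzi
    rw [← he]
    simp
  have hV' : DifferentiableAt ℝ V' a := by
    refine DifferentiableAt.congr_of_eventuallyEq ?_ hV'eq
    refine DifferentiableAt.clm_apply ?_ (hJd.differentiableAt.smul (hV.comp a hψ1))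
    have : DifferentiableAt ℝ (ContinuousLinearMap.inverse : (E →L[ℝ] E) → _) (fderiv ℝ ψ a) := by
      rw [hA]
      exact (contDiffAt_map_inverse (n := 1) A).differentiableAt (by simp)
    exact this.comp a hψd
  refine ⟨hV', ?_⟩
  have hL : HasFDerivAt (fun z ↦ fderiv ℝ ψ z (V' z)) _ a :=
    hψd.hasFDerivAt.clm_apply hV'.hasFDerivAt
  have hR : HasFDerivAt (fun z ↦ J z • V (ψ z)) _ a :=
    hJd.fun_smul (hV.hasFDerivAt.comp a hψ1.hasFDerivAt)
  have hEq := (hL.congr_of_eventuallyEq (h.mono fun z hz ↦ hz.symm)).unique hR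
  set w := V' a with hw
  have hJa : J a = |LinearMap.det (A : E →ₗ[ℝ] E)| := by simp [hJ, hA]
  have hAw : A w = J a • V (ψ a) := by
    have := h.self_of_nhds
    rw [hA] at this
    rw [hJa]; simpa [hA] using this
  -- Differentiate Dψ(V') = J · (V ∘ ψ) in direction v, apply A⁻¹, and use A w = J V(ψ a). Symmetry
  -- of D²ψ puts w into the first slot of the last term.
  have key : ∀ v, fderiv ℝ V' a v = LinearMap.trace ℝ E (((A.symm : E →L[ℝ] E) ∘L D2 v :
      E →L[ℝ] E).toLinearMap) • w
      + J a • A.symm (fderiv ℝ V (ψ a) (A v)) - A.symm (D2 w v) := by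
    intro v
    have := congrArg (fun L : E →L[ℝ] E ↦ A.symm (L v)) hEq
    simp only [add_apply, ContinuousLinearMap.comp_apply,
      ContinuousLinearMap.flip_apply, map_add, smul_apply,
      ContinuousLinearMap.smulRight_apply, map_smul, hA, ContinuousLinearEquiv.coe_coe,
      ContinuousLinearEquiv.symm_apply_apply] at this
    have hwV : A.symm (V (ψ a)) = (J a)⁻¹ • w := by
      have hJ0 : J a ≠ 0 := by rw [hJa]; exact abs_ne_zero.2 hdet0
      rw [eq_inv_smul_iff₀ hJ0, ← map_smul, ← hAw]; simp
    rw [hwV, ← hJa, smul_eq_mul, smul_smul] at this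
    rw [eq_sub_iff_add_eq, hsymm w v]
    refine this.trans ?_
    rw [add_comm]
    congr 2
    have hJ0 : J a ≠ 0 := by rw [hJa]; exact abs_ne_zero.2 hdet0
    field_simp
    rfl
  have hsplit : (fderiv ℝ V' a).toLinearMap =
      (dualTensorHom ℝ E E (((LinearMap.trace ℝ E ∘ₗ ContinuousLinearMap.coeLM ℝ) ∘ₗ
        ((ContinuousLinearMap.compL ℝ E E E (A.symm : E →L[ℝ] E)) ∘L D2).toLinearMap) ⊗ₜ[ℝ] w))
      + J a • (A.toLinearEquiv.symm.conj (fderiv ℝ V (ψ a)).toLinearMap)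
      - ((A.symm : E →L[ℝ] E) ∘L D2 w : E →L[ℝ] E).toLinearMap := by
    ext v : 1
    simp only [ContinuousLinearMap.coe_coe, key v]
    simp [LinearEquiv.conj_apply]
  rw [hsplit, map_sub, map_add, map_smul, LinearMap.trace_conj']
  -- The rank-one map v ↦ tr(A⁻¹ D²ψ(v)) w has trace tr(A⁻¹ D²ψ(w)), so it cancels the second-order
  -- term. Only the conjugate of DV, multiplied by J, survives.
  have ht : LinearMap.trace ℝ E (dualTensorHom ℝ E E
      (((LinearMap.trace ℝ E ∘ₗ ContinuousLinearMap.coeLM ℝ) ∘ₗ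
        ((ContinuousLinearMap.compL ℝ E E E (A.symm : E →L[ℝ] E)) ∘L D2).toLinearMap) ⊗ₜ[ℝ] w)) =
      LinearMap.trace ℝ E ((A.symm : E →L[ℝ] E) ∘L D2 w : E →L[ℝ] E).toLinearMap := by
    rw [LinearMap.trace_eq_contract_apply, contractLeft_apply]
    rfl
  rw [ht, hJa, smul_eq_mul]
  ring

end Piola

/-! ### The divergence theorem for Lipschitz functions on a half space -/

section HalfSpace

/-- Lipschitz functions are absolutely continuous, so the fundamental theorem of calculus applies on
a bounded interval that reaches beyond the support. -/
lemma integral_deriv_of_lipschitzWith_of_eq_zero {g : ℝ → ℝ} {K : ℝ≥0} {R : ℝ} (hR : 0 ≤ R)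
    (hg : LipschitzWith K g) (hg0 : ∀ t, R ≤ |t| → g t = 0) :
    ∫ t, deriv g t = 0 ∧ ∫ t in Ici 0, deriv g t = -g 0 := by
  have hac : ∀ a b, AbsolutelyContinuousOnInterval g a b := fun a b ↦
    (hg.lipschitzOnWith (s := uIcc a b)).absolutelyContinuousOnInterval
  have hd : ∀ t, R < |t| → deriv g t = 0 := by
    intro t ht
    have : g =ᶠ[𝓝 t] fun _ ↦ 0 := by
      have : ∀ᶠ s in 𝓝 t, R < |s| := continuous_abs.continuousAt.eventually (lt_mem_nhds ht)
      exact this.mono fun s hs ↦ hg0 s hs.le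
    rw [this.deriv_eq]; simp
  constructor
  -- The end points are ±(R + 1) and not ±R because the derivative is known to vanish only where R <
  -- |t|.
  · have h := (hac (-(R + 1)) (R + 1)).integral_deriv_eq_sub
    rw [hg0 _ (by rw [abs_of_nonneg] <;> linarith), hg0 _ (by rw [abs_neg, abs_of_nonneg] <;> linarith),
      intervalIntegral.integral_of_le (by linarith),
      setIntegral_eq_integral_of_forall_compl_eq_zero] at h
    · simpa using h
    · intro t ht
      refine hd t ?_
      by_contra! hc
      rw [abs_le] at hc
      exact ht ⟨by linarith [hc.1], by linarith [hc.2]⟩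
  · have h := (hac 0 (R + 1)).integral_deriv_eq_sub
    rw [hg0 (R + 1) (by rw [abs_of_nonneg] <;> linarith),
      intervalIntegral.integral_of_le (by linarith)] at h
    rw [integral_Ici_eq_integral_Ioi, ← zero_sub, ← h]
    refine (setIntegral_eq_of_subset_of_forall_sdiff_eq_zero measurableSet_Ioi
      Ioc_subset_Ioi_self fun t ht ↦ ?_)
    refine hd t ?_
    have h0 : 0 < t := ht.1
    rw [abs_of_pos h0]
    by_contra! hc
    exact ht.2 ⟨h0, by linarith⟩

variable {n : ℕ}

/-- The vector with `i`-th coordinate `t` and remaining coordinates `y`. -/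
def insertCoord (i : Fin (n + 1)) (t : ℝ) (y : EuclideanSpace ℝ (Fin n)) :
    EuclideanSpace ℝ (Fin (n + 1)) :=
  WithLp.toLp 2 (i.insertNth t y.ofLp)

lemma insertCoord_apply_same (i : Fin (n + 1)) (t : ℝ) (y : EuclideanSpace ℝ (Fin n)) :
    insertCoord i t y i = t := by simp [insertCoord]

lemma insertCoord_apply_succAbove (i : Fin (n + 1)) (t : ℝ) (y : EuclideanSpace ℝ (Fin n))
    (j : Fin n) : insertCoord i t y (i.succAbove j) = y j := by simp [insertCoord]

lemma insertCoord_add_smul_single (i : Fin (n + 1)) (t s : ℝ) (y : EuclideanSpace ℝ (Fin n)) :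
    insertCoord i t y + s • EuclideanSpace.single i (1 : ℝ) = insertCoord i (t + s) y := by
  ext j
  rcases Fin.eq_self_or_eq_succAbove i j with rfl | ⟨k, rfl⟩
  · simp [insertCoord_apply_same]
  · simp [insertCoord_apply_succAbove]

lemma measurePreserving_insertCoord (i : Fin (n + 1)) :
    MeasurePreserving (fun p : ℝ × EuclideanSpace ℝ (Fin n) ↦ insertCoord i p.1 p.2) := by
  have h1 : MeasurePreserving (Prod.map id WithLp.ofLp :
      ℝ × EuclideanSpace ℝ (Fin n) → ℝ × (Fin n → ℝ)) (volume.prod volume) (volume.prod volume) :=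
    (MeasurePreserving.id volume).prod (PiLp.volume_preserving_ofLp (Fin n))
  have h2 := (volume_preserving_piFinSuccAbove (fun _ : Fin (n + 1) => ℝ) i).symm
  have h3 := PiLp.volume_preserving_toLp (Fin (n + 1))
  exact h3.comp (h2.comp h1)

lemma measurableEmbedding_insertCoord (i : Fin (n + 1)) :
    MeasurableEmbedding (fun p : ℝ × EuclideanSpace ℝ (Fin n) ↦ insertCoord i p.1 p.2) := by
  have h1 : MeasurableEmbedding (Prod.map id WithLp.ofLp :
      ℝ × EuclideanSpace ℝ (Fin n) → ℝ × (Fin n → ℝ)) :=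
    MeasurableEmbedding.id.prodMap (MeasurableEquiv.toLp 2 (Fin n → ℝ)).symm.measurableEmbedding
  have h2 := (MeasurableEquiv.piFinSuccAbove (fun _ : Fin (n + 1) => ℝ) i).symm.measurableEmbedding
  have h3 := (MeasurableEquiv.toLp 2 (Fin (n + 1) → ℝ)).measurableEmbedding
  exact h3.comp (h2.comp h1)

lemma integral_eq_integral_insertCoord (i : Fin (n + 1)) {F : EuclideanSpace ℝ (Fin (n + 1)) → ℝ}
    (hF : Integrable F) : ∫ y, F y = ∫ y', ∫ t, F (insertCoord i t y') := by
  have h := measurePreserving_insertCoord (n := n) i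
  rw [← h.integral_comp (measurableEmbedding_insertCoord i), Measure.volume_eq_prod,
    integral_prod_symm (fun p : ℝ × EuclideanSpace ℝ (Fin n) ↦ F (insertCoord i p.1 p.2))
      ((h.integrable_comp_emb (measurableEmbedding_insertCoord i)).2 hF)]

/-- Line derivatives restrict to one-dimensional derivatives at every point. Fubini can therefore be
applied without asking on which slices the function is differentiable. -/
lemma lineDeriv_insertCoord (i : Fin (n + 1)) (W : EuclideanSpace ℝ (Fin (n + 1)) → ℝ)
    (t : ℝ) (y : EuclideanSpace ℝ (Fin n)) :
    lineDeriv ℝ W (insertCoord i t y) (EuclideanSpace.single i 1) =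
      deriv (fun s ↦ W (insertCoord i s y)) t := by
  simp only [lineDeriv, insertCoord_add_smul_single]
  rw [deriv_comp_const_add (fun s ↦ W (insertCoord i s y))]
  simp

lemma lipschitzWith_insertCoord (i : Fin (n + 1)) (y : EuclideanSpace ℝ (Fin n)) :
    LipschitzWith 1 (fun t : ℝ ↦ insertCoord i t y) := by
  refine LipschitzWith.of_dist_le_mul fun s t ↦ ?_
  have : insertCoord i s y = insertCoord i t y + (s - t) • EuclideanSpace.single i (1 : ℝ) := by
    rw [insertCoord_add_smul_single]; simp
  rw [this, dist_eq_norm]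
  simp [norm_smul, Real.dist_eq]

lemma integrable_lineDeriv_of_lipschitzWith {W : EuclideanSpace ℝ (Fin (n + 1)) → ℝ} {K : ℝ≥0} {R : ℝ}
    (hW : LipschitzWith K W) (hW0 : ∀ y, R ≤ ‖y‖ → W y = 0) (v : EuclideanSpace ℝ (Fin (n + 1))) :
    Integrable (fun y ↦ lineDeriv ℝ W y v) := by
  have h1 := (hW.locallyIntegrable_lineDeriv (μ := volume) v).integrableOn_isCompact
    (isCompact_closedBall 0 R)
  refine (integrableOn_iff_integrable_of_support_subset fun y hy ↦ ?_).1 h1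
  by_contra hc
  refine hy ?_
  rw [Metric.mem_closedBall, dist_zero_right, not_le] at hc
  have h2 : W =ᶠ[𝓝 y] fun _ ↦ 0 := by
    have : ∀ᶠ z in 𝓝 y, R < ‖z‖ := continuous_norm.continuousAt.eventually (lt_mem_nhds hc)
    exact this.mono fun s hs ↦ hW0 s hs.le
  simp only
  rw [h2.lineDeriv_eq]; simp [lineDeriv]

/-- The divergence theorem for a Lipschitz function with bounded support on a half space. -/
theorem setIntegral_lineDeriv_halfSpace {W : EuclideanSpace ℝ (Fin (n + 1)) → ℝ} {K : ℝ≥0} {R : ℝ}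
    (hR : 0 ≤ R) (hW : LipschitzWith K W) (hW0 : ∀ y, R ≤ ‖y‖ → W y = 0) (i : Fin (n + 1)) :
    ∫ y in {y | 0 ≤ y 0}, lineDeriv ℝ W y (EuclideanSpace.single i 1) =
      if i = 0 then -∫ y', W (insertCoord 0 0 y') else 0 := by
  have hH : MeasurableSet {y : EuclideanSpace ℝ (Fin (n + 1)) | 0 ≤ y 0} :=
    (isClosed_le continuous_const (by fun_prop)).measurableSet
  rw [← integral_indicator hH, integral_eq_integral_insertCoord i
    ((integrable_lineDeriv_of_lipschitzWith hW hW0 _).indicator hH)]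
  have hg : ∀ y', LipschitzWith K (fun s ↦ W (insertCoord i s y')) := fun y' ↦ by
    have := hW.comp (lipschitzWith_insertCoord i y')
    rwa [mul_one] at this
  have hg0 : ∀ y' t, R ≤ |t| → W (insertCoord i t y') = 0 := fun y' t ht ↦ by
    refine hW0 _ (ht.trans ?_)
    have := PiLp.norm_apply_le (insertCoord i t y') i
    rwa [insertCoord_apply_same] at this
  by_cases hi : i = 0
  · subst hi
    rw [if_pos rfl, ← integral_neg]
    congr 1 with y'
    rw [← (integral_deriv_of_lipschitzWith_of_eq_zero hR (hg y') (hg0 y')).2,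
      ← integral_indicator measurableSet_Ici]
    congr 1 with t
    simp only [indicator, mem_ofPred_eq, mem_Ici, insertCoord_apply_same, lineDeriv_insertCoord]
  · rw [if_neg hi]
    -- In a tangential direction the coordinate 0 is one of the frozen ones, at position `j` of
    -- `y'`. So each line lies wholly inside or wholly outside the half space.
    obtain ⟨j, hj⟩ := Fin.exists_succAbove_eq (Ne.symm hi)
    refine integral_eq_zero_of_ae (Eventually.of_forall fun y' ↦ ?_)
    simp only [indicator, mem_ofPred_eq, Pi.zero_apply]
    rw [← hj]
    simp only [insertCoord_apply_succAbove]
    by_cases hy : 0 ≤ y' j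
    · simp only [hy, if_true]
      simp only [lineDeriv_insertCoord]
      exact (integral_deriv_of_lipschitzWith_of_eq_zero hR (hg y') (hg0 y')).1
    · simp [hy]

/-- Reflection in the boundary of the half space, on the complement of the half space. -/
def foldHalfSpace (y : EuclideanSpace ℝ (Fin (n + 1))) : EuclideanSpace ℝ (Fin (n + 1)) :=
  WithLp.toLp 2 (Function.update y.ofLp 0 |y 0|)

lemma foldHalfSpace_apply_zero (y : EuclideanSpace ℝ (Fin (n + 1))) :
    foldHalfSpace y 0 = |y 0| := by simp [foldHalfSpace]

lemma foldHalfSpace_of_nonneg {y : EuclideanSpace ℝ (Fin (n + 1))} (hy : 0 ≤ y 0) :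
    foldHalfSpace y = y := by
  ext j
  simp [foldHalfSpace, abs_of_nonneg hy]

lemma norm_foldHalfSpace (y : EuclideanSpace ℝ (Fin (n + 1))) : ‖foldHalfSpace y‖ = ‖y‖ := by
  simp only [EuclideanSpace.norm_eq, foldHalfSpace]
  congr 1
  refine Finset.sum_congr rfl fun j _ ↦ ?_
  by_cases hj : j = 0
  · subst hj; simp
  · simp [hj]

lemma lipschitzWith_foldHalfSpace :
    LipschitzWith 1 (foldHalfSpace : EuclideanSpace ℝ (Fin (n + 1)) → _) := by
  refine LipschitzWith.of_dist_le_mul fun y z ↦ ?_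
  simp only [NNReal.coe_one, one_mul, EuclideanSpace.dist_eq, foldHalfSpace]
  refine Real.sqrt_le_sqrt (Finset.sum_le_sum fun j _ ↦ ?_)
  by_cases hj : j = 0
  · subst hj
    simp only [Function.update_self, Real.dist_eq]
    exact pow_le_pow_left₀ (abs_nonneg _) (abs_abs_sub_abs_le_abs_sub _ _) 2
  · simp [hj]

lemma ae_apply_zero_ne_zero : ∀ᵐ y : EuclideanSpace ℝ (Fin (n + 1)), y 0 ≠ 0 := by
  have h := Measure.addHaar_submodule (volume : Measure (EuclideanSpace ℝ (Fin (n + 1))))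
    (LinearMap.ker (EuclideanSpace.proj (0 : Fin (n + 1)) :
      EuclideanSpace ℝ (Fin (n + 1)) →L[ℝ] ℝ).toLinearMap) (by
    intro h
    have : EuclideanSpace.single (0 : Fin (n + 1)) (1 : ℝ) ∈
      (⊤ : Submodule ℝ (EuclideanSpace ℝ (Fin (n + 1)))) := trivial
    rw [← h] at this
    simp at this)
  rw [measure_eq_zero_iff_ae_notMem] at h
  filter_upwards [h] with y hy hy0
  exact hy (by simpa using hy0)

/-- The divergence theorem on a half space, for a function which is Lipschitz on the half space and
has bounded support. -/
theorem setIntegral_fderiv_halfSpace {W : EuclideanSpace ℝ (Fin (n + 1)) → ℝ} {K : ℝ≥0} {R : ℝ}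
    (hR : 0 ≤ R) (hW : LipschitzOnWith K W {y | 0 ≤ y 0})
    (hW0 : ∀ y, 0 ≤ y 0 → R ≤ ‖y‖ → W y = 0) (i : Fin (n + 1)) :
    IntegrableOn (fun y ↦ fderiv ℝ W y (EuclideanSpace.single i 1)) {y | 0 < y 0} ∧
    ∫ y in {y | 0 < y 0}, fderiv ℝ W y (EuclideanSpace.single i 1) =
      if i = 0 then -∫ y', W (insertCoord 0 0 y') else 0 := by
  -- Even reflection extends `W` to the whole space with the same Lipschitz constant and the same
  -- decay. The two functions agree near every point with y₀ > 0, so there they have the same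
  -- derivative.
  set W' : EuclideanSpace ℝ (Fin (n + 1)) → ℝ := fun y ↦ W (foldHalfSpace y) with hW'
  have hmaps : ∀ y : EuclideanSpace ℝ (Fin (n + 1)), foldHalfSpace y ∈
    {y : EuclideanSpace ℝ (Fin (n + 1)) | 0 ≤ y 0} := fun y ↦ by
    simp [foldHalfSpace_apply_zero]
  have h1 : LipschitzWith K W' := by
    have := hW.comp (lipschitzWith_foldHalfSpace.lipschitzOnWith (s := univ)) fun y _ ↦ hmaps y
    rw [mul_one, lipschitzOnWith_univ] at this
    exact this
  have h2 : ∀ y, R ≤ ‖y‖ → W' y = 0 := fun y hy ↦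
    hW0 _ (hmaps y) (by rwa [norm_foldHalfSpace])
  have hopen : IsOpen {y : EuclideanSpace ℝ (Fin (n + 1)) | 0 < y 0} :=
    isOpen_lt continuous_const (by fun_prop)
  have h3 : ∀ᵐ y : EuclideanSpace ℝ (Fin (n + 1)), y ∈ {y : EuclideanSpace ℝ (Fin (n + 1)) | 0 < y 0} →
      lineDeriv ℝ W' y (EuclideanSpace.single i 1) = fderiv ℝ W y (EuclideanSpace.single i 1) := by
    filter_upwards [h1.ae_differentiableAt] with y hy hy0
    have : W' =ᶠ[𝓝 y] W := by
      filter_upwards [hopen.mem_nhds hy0] with z hz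
      simp only [hW', foldHalfSpace_of_nonneg (le_of_lt hz)]
    rw [← this.fderiv_eq, hy.lineDeriv_eq_fderiv]
  have h4 := setIntegral_lineDeriv_halfSpace hR h1 h2 i
  have h5 : ({y : EuclideanSpace ℝ (Fin (n + 1)) | 0 ≤ y 0} : Set _) =ᵐ[volume]
      ({y : EuclideanSpace ℝ (Fin (n + 1)) | 0 < y 0} : Set _) := by
    filter_upwards [ae_apply_zero_ne_zero] with y hy
    exact propext ⟨fun h ↦ lt_of_le_of_ne h (Ne.symm hy), le_of_lt⟩
  constructor
  · exact (integrable_lineDeriv_of_lipschitzWith h1 h2 _).integrableOn.congr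
      ((ae_restrict_iff' hopen.measurableSet).2 h3)
  · rw [← setIntegral_congr_ae hopen.measurableSet h3, ← setIntegral_congr_set h5, h4]
    congr 3 with y'
    simp only [hW']
    rw [foldHalfSpace_of_nonneg]
    simp [insertCoord_apply_same]

end HalfSpace

/-! ### Local comparison of measures -/

section MeasureComparison

/-- By the Lindelöf property countably many of the neighbourhoods cover `s`. Cutting them into
disjoint pieces and summing preserves the constant. -/
lemma measure_le_of_forall_exists_nhds_le_mul {X : Type*} [TopologicalSpace X]
    [SecondCountableTopology X] [MeasurableSpace X] [OpensMeasurableSpace X] {μ ν : Measure X}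
    {s : Set X} {c : ℝ≥0∞}
    (h : ∀ x ∈ s, ∃ U ∈ 𝓝 x, ∀ B, B ⊆ U → B ⊆ s → MeasurableSet B → μ B ≤ c * ν B)
    {B : Set X} (hBs : B ⊆ s) (hB : MeasurableSet B) : μ B ≤ c * ν B := by
  choose! U hU hUB using h
  obtain ⟨t, hts, htc, hst⟩ := TopologicalSpace.countable_cover_nhdsWithin
    (f := fun x ↦ interior (U x)) (s := s)
    fun x hx ↦ mem_nhdsWithin_of_mem_nhds (interior_mem_nhds.2 (hU x hx))
  rcases t.eq_empty_or_nonempty with rfl | htn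
  · have : B = ∅ := by
      simp only [mem_empty_iff_false, iUnion_of_empty, iUnion_empty, subset_empty_iff] at hst
      exact subset_empty_iff.1 (hst ▸ hBs)
    simp [this]
  obtain ⟨x, rfl⟩ := htc.exists_eq_range htn
  set V : ℕ → Set X := disjointed fun k ↦ interior (U (x k)) with hV
  have hVm : ∀ k, MeasurableSet (V k) := fun k ↦
    MeasurableSet.disjointed (fun k ↦ isOpen_interior.measurableSet) k
  have hBV : B = ⋃ k, B ∩ V k := by
    rw [← inter_iUnion, hV, iUnion_disjointed, eq_comm, inter_eq_left]
    refine hBs.trans (hst.trans ?_)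
    simp
  have hdisj : Pairwise (Function.onFun Disjoint fun k ↦ B ∩ V k) := fun i j hij ↦
    ((disjoint_disjointed _) hij).mono inter_subset_right inter_subset_right
  calc μ B = ∑' k, μ (B ∩ V k) := by
        conv_lhs => rw [hBV]
        exact measure_iUnion hdisj fun k ↦ hB.inter (hVm k)
    _ ≤ ∑' k, c * ν (B ∩ V k) := by
        refine ENNReal.tsum_le_tsum fun k ↦ hUB (x k) (hts (mem_range_self k)) _ ?_ ?_
          (hB.inter (hVm k))
        · exact (inter_subset_right.trans (disjointed_subset _ _)).trans interior_subset
        · exact inter_subset_left.trans hBs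
    _ = c * ν B := by
        rw [ENNReal.tsum_mul_left]
        conv_rhs => rw [hBV]
        rw [measure_iUnion hdisj fun k ↦ hB.inter (hVm k)]

/-- The neighbourhoods may shrink as c decreases to 1, since the global inequality is obtained for
each c before the limit is taken. -/
lemma measure_le_of_forall_one_lt_exists_nhds_le_mul {X : Type*} [TopologicalSpace X]
    [SecondCountableTopology X] [MeasurableSpace X] [OpensMeasurableSpace X] {μ ν : Measure X}
    {s : Set X}
    (h : ∀ x ∈ s, ∀ c : ℝ≥0∞, 1 < c →
      ∃ U ∈ 𝓝 x, ∀ B, B ⊆ U → B ⊆ s → MeasurableSet B → μ B ≤ c * ν B)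
    {B : Set X} (hBs : B ⊆ s) (hB : MeasurableSet B) : μ B ≤ ν B := by
  have h1 : ∀ c : ℝ≥0∞, 1 < c → μ B ≤ c * ν B := fun c hc ↦
    measure_le_of_forall_exists_nhds_le_mul (fun x hx ↦ h x hx c hc) hBs hB
  have h2 : Tendsto (fun c : ℝ≥0∞ ↦ c * ν B) (𝓝[>] 1) (𝓝 (1 * ν B)) :=
    tendsto_nhdsWithin_of_tendsto_nhds
      (ENNReal.Tendsto.mul_const tendsto_id (Or.inl one_ne_zero))
  rw [one_mul] at h2
  have : (𝓝[>] (1 : ℝ≥0∞)).NeBot := nhdsGT_neBot_of_exists_gt ⟨2, by norm_num⟩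
  exact ge_of_tendsto h2 (eventually_mem_nhdsWithin.mono fun c hc ↦ h1 c hc)

lemma euclideanHausdorffMeasure_image_le_of_lipschitzOnWith {X Y : Type*} [EMetricSpace X]
    [MeasurableSpace X] [BorelSpace X] [EMetricSpace Y] [MeasurableSpace Y] [BorelSpace Y]
    {K : ℝ≥0} {f : X → Y} {s : Set X} (h : LipschitzOnWith K f s) (k : ℕ) :
    μHE[k] (f '' s) ≤ (K : ℝ≥0∞) ^ k * μHE[k] s := by
  simp only [Measure.euclideanHausdorffMeasure_def, Measure.smul_apply, ENNReal.smul_def,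
    smul_eq_mul]
  have := h.hausdorffMeasure_image_le (d := k) (Nat.cast_nonneg k)
  rw [ENNReal.rpow_natCast] at this
  calc _ ≤ _ := mul_le_mul_right this _
    _ = _ := by ring

end MeasureComparison

/-! ### Gram determinants and the Jacobian on the bounding hyperplane -/

section Gram

variable {n : ℕ} {V : Type*} [NormedAddCommGroup V] [InnerProductSpace ℝ V]

/-- The boundary of the half space, as an isometric copy of a Euclidean space. -/
def boundaryIncl (n : ℕ) : EuclideanSpace ℝ (Fin n) →ₗᵢ[ℝ] EuclideanSpace ℝ (Fin (n + 1)) where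
  toFun y := insertCoord 0 0 y
  map_add' x y := by
    ext j
    refine Fin.cases ?_ (fun i ↦ ?_) j <;> simp [insertCoord]
  map_smul' c x := by
    ext j
    refine Fin.cases ?_ (fun i ↦ ?_) j <;> simp [insertCoord]
  norm_map' x := by
    simp [EuclideanSpace.norm_eq, Fin.sum_univ_succ, insertCoord]

lemma boundaryIncl_single (i : Fin n) :
    boundaryIncl n (EuclideanSpace.single i 1) = EuclideanSpace.single i.succ 1 := by
  ext j
  refine Fin.cases ?_ (fun k ↦ ?_) j
  · simp [boundaryIncl, insertCoord, (Fin.succ_ne_zero i).symm]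
  · simp [boundaryIncl, insertCoord, Pi.single_apply]

lemma boundaryIncl_apply (y : EuclideanSpace ℝ (Fin n)) : boundaryIncl n y = insertCoord 0 0 y := rfl

lemma mem_range_boundaryIncl {y : EuclideanSpace ℝ (Fin (n + 1))} :
    y ∈ range (boundaryIncl n) ↔ y 0 = 0 := by
  constructor
  · rintro ⟨z, rfl⟩
    exact insertCoord_apply_same 0 0 z
  · intro h
    refine ⟨WithLp.toLp 2 fun i ↦ y i.succ, ?_⟩
    ext j
    refine Fin.cases ?_ (fun k ↦ ?_) j
    · rw [boundaryIncl_apply, insertCoord_apply_same, h]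
    · simp [boundaryIncl_apply, insertCoord]

/-- The Jacobian of the restriction of a linear isomorphism `L` to the hyperplane `y₀ = 0` is the
Jacobian of `L` times the length of the gradient of `y₀`. -/
lemma normDet_comp_boundaryIncl (L : EuclideanSpace ℝ (Fin (n + 1)) ≃ₗ[ℝ] V) {u : V}
    (hu : ∀ v, inner ℝ u (L v) = v 0) :
    ((L : EuclideanSpace ℝ (Fin (n + 1)) →ₗ[ℝ] V) ∘ₗ (boundaryIncl n).toLinearMap).normDet =
      (L : EuclideanSpace ℝ (Fin (n + 1)) →ₗ[ℝ] V).normDet * ‖u‖ := by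
  set e : Fin (n + 1) → V := fun i ↦ L (EuclideanSpace.single i 1) with he
  set G := Matrix.gram ℝ e with hG
  have h1 := (L : EuclideanSpace ℝ (Fin (n + 1)) →ₗ[ℝ] V).normDet_sq_eq_det_gram
    (EuclideanSpace.basisFun (Fin (n + 1)) ℝ)
  have h2 := ((L : EuclideanSpace ℝ (Fin (n + 1)) →ₗ[ℝ] V) ∘ₗ
    (boundaryIncl n).toLinearMap).normDet_sq_eq_det_gram (EuclideanSpace.basisFun (Fin n) ℝ)
  have h3 : Matrix.gram ℝ (fun i : Fin n ↦ ((L : EuclideanSpace ℝ (Fin (n + 1)) →ₗ[ℝ] V) ∘ₗ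
    (boundaryIncl n).toLinearMap) (EuclideanSpace.basisFun (Fin n) ℝ i)) =
      G.submatrix Fin.succ Fin.succ := by
    ext i j
    simp [Matrix.gram_apply, hG, he, boundaryIncl_single]
  simp only [RCLike.ofReal_real_eq_id, id_eq] at h1 h2
  rw [h3] at h2
  have h1' : (L : EuclideanSpace ℝ (Fin (n + 1)) →ₗ[ℝ] V).normDet ^ 2 = G.det := by
    rw [h1]; congr 1; ext i j; simp [hG, he, Matrix.gram_apply]
  set a := L.symm u with ha
  have hua : u = ∑ j, a j • e j := by
    have : a = ∑ j, a j • EuclideanSpace.single j (1 : ℝ) := by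
      ext k; simp [Pi.single_apply]
    calc u = L a := by simp [ha]
      _ = _ := by
        conv_lhs => rw [this]
        simp [he]
  have hGa : G.mulVec a.ofLp = Pi.single 0 1 := by
    ext i
    have h4 : inner ℝ (e i) u = (Pi.single 0 1 : Fin (n + 1) → ℝ) i := by
      rw [real_inner_comm, he, hu]; simp [Pi.single_apply, eq_comm]
    rw [← h4, hua, inner_sum]
    simp [Matrix.mulVec, dotProduct, hG, Matrix.gram_apply, inner_smul_right, mul_comm]
  have hnorm : ‖u‖ ^ 2 = a 0 := by
    rw [← real_inner_self_eq_norm_sq, ← hu a, ha, LinearEquiv.apply_symm_apply]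
  -- Cramer's rule: the zeroth diagonal entry of the inverse is the complementary minor, the Gram
  -- determinant of the restriction, divided by det G.
  have hdet : G.det * a 0 = (G.submatrix Fin.succ Fin.succ).det := by
    have h5 : (G.adjugate.mulVec (G.mulVec a.ofLp)) 0 = G.det * a 0 := by
      rw [Matrix.mulVec_mulVec, Matrix.adjugate_mul, Matrix.smul_mulVec, Matrix.one_mulVec]
      simp
    rw [← h5, hGa]
    simp [Matrix.adjugate_fin_succ_eq_det_submatrix, Fin.succAbove_zero]
  rw [← sq_eq_sq₀ (LinearMap.normDet_nonneg _) (mul_nonneg (LinearMap.normDet_nonneg _)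
    (norm_nonneg _)), mul_pow, h1', hnorm, hdet, h2]

end Gram

/-! ### The derivative of a chart and its inverse -/

section Chart

variable {d : ℕ} [NeZero d] {M : Type*} [EMetricSpace M]
  [ChartedSpace (EuclideanHalfSpace d) M] [IsManifold (𝓡∂ d) ∞ M]

/-- The inverse of the derivative of the chart at `x₀` at the point `x`. -/
def symmCoord (x₀ x : M) : EuclideanSpace ℝ (Fin d) →L[ℝ] TangentSpace (𝓡∂ d) x :=
  (trivializationAt (EuclideanSpace ℝ (Fin d)) (TangentSpace (𝓡∂ d)) x₀).symmL ℝ x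

/-- The derivative of the chart at `x₀` at the point `x`. -/
def toCoord (x₀ x : M) : TangentSpace (𝓡∂ d) x →L[ℝ] EuclideanSpace ℝ (Fin d) :=
  mfderiv (𝓡∂ d) 𝓘(ℝ, EuclideanSpace ℝ (Fin d)) (extChartAt (𝓡∂ d) x₀) x

lemma toCoord_eq {x₀ x : M} (hx : x ∈ (extChartAt (𝓡∂ d) x₀).source) :
    toCoord x₀ x = (trivializationAt (EuclideanSpace ℝ (Fin d))
      (TangentSpace (𝓡∂ d)) x₀).continuousLinearMapAt ℝ x := by
  rw [extChartAt_source] at hx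
  exact (TangentBundle.continuousLinearMapAt_trivializationAt (I := 𝓡∂ d) hx).symm

lemma symmCoord_toCoord {x₀ x : M} (hx : x ∈ (extChartAt (𝓡∂ d) x₀).source)
    (v : TangentSpace (𝓡∂ d) x) : symmCoord x₀ x (toCoord x₀ x v) = v := by
  rw [toCoord_eq hx]
  exact Trivialization.symmL_continuousLinearMapAt _ (by simpa using hx) v

lemma toCoord_symmCoord {x₀ x : M} (hx : x ∈ (extChartAt (𝓡∂ d) x₀).source)
    (v : EuclideanSpace ℝ (Fin d)) : toCoord x₀ x (symmCoord x₀ x v) = v := by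
  rw [toCoord_eq hx]
  exact Trivialization.continuousLinearMapAt_symmL _ (by simpa using hx) v

lemma symmCoord_eq_mfderivWithin {x₀ x : M} (hx : x ∈ (extChartAt (𝓡∂ d) x₀).source) :
    (symmCoord x₀ x : EuclideanSpace ℝ (Fin d) → EuclideanSpace ℝ (Fin d)) =
      mfderivWithin 𝓘(ℝ, EuclideanSpace ℝ (Fin d)) (𝓡∂ d) (extChartAt (𝓡∂ d) x₀).symm
    (range (𝓡∂ d)) (extChartAt (𝓡∂ d) x₀ x) := by
  rw [extChartAt_source] at hx
  exact congrArg (fun L : EuclideanSpace ℝ (Fin d) →L[ℝ] EuclideanSpace ℝ (Fin d) ↦ (L : _ → _))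
    (TangentBundle.symmL_trivializationAt (I := 𝓡∂ d) hx)

lemma coordVec_eq {x₀ : M} {y : EuclideanSpace ℝ (Fin d)} (hy : y ∈ (extChartAt (𝓡∂ d) x₀).target)
    (i : Fin d) : coordVec x₀ y i =
      symmCoord x₀ ((extChartAt (𝓡∂ d) x₀).symm y) (EuclideanSpace.single i 1) := by
  have h := symmCoord_eq_mfderivWithin ((extChartAt (𝓡∂ d) x₀).map_target hy)
  rw [(extChartAt (𝓡∂ d) x₀).right_inv hy] at h
  exact (congrFun h (EuclideanSpace.single i 1)).symm

/-- The derivative of the chart as a linear isomorphism. -/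
def coordEquiv {x₀ x : M} (hx : x ∈ (extChartAt (𝓡∂ d) x₀).source) :
    EuclideanSpace ℝ (Fin d) ≃ₗ[ℝ] TangentSpace (𝓡∂ d) x :=
  LinearEquiv.ofLinearMap (symmCoord x₀ x).toLinearMap (toCoord x₀ x).toLinearMap
    (by ext v; exact symmCoord_toCoord hx v) (by ext1 v; exact toCoord_symmCoord hx v)

lemma coordEquiv_apply {x₀ x : M} (hx : x ∈ (extChartAt (𝓡∂ d) x₀).source)
    (v : EuclideanSpace ℝ (Fin d)) : coordEquiv hx v = symmCoord x₀ x v := rfl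

lemma mfderiv_symmCoord {x₀ x : M} (hx : x ∈ (extChartAt (𝓡∂ d) x₀).source)
    {F : Type*} [NormedAddCommGroup F] [NormedSpace ℝ F] {u : M → F}
    (hu : MDifferentiableAt (𝓡∂ d) 𝓘(ℝ, F) u x) (v : EuclideanSpace ℝ (Fin d)) :
    mfderiv (𝓡∂ d) 𝓘(ℝ, F) u x (symmCoord x₀ x v) =
      fderivWithin ℝ (u ∘ (extChartAt (𝓡∂ d) x₀).symm) (range (𝓡∂ d)) (extChartAt (𝓡∂ d) x₀ x) v := by
  have hx' := (extChartAt (𝓡∂ d) x₀).map_source hx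
  have h1 : MDifferentiableWithinAt 𝓘(ℝ, EuclideanSpace ℝ (Fin d)) (𝓡∂ d)
      (extChartAt (𝓡∂ d) x₀).symm (range (𝓡∂ d)) (extChartAt (𝓡∂ d) x₀ x) :=
    mdifferentiableWithinAt_extChartAt_symm hx'
  have h2 : MDifferentiableAt (𝓡∂ d) 𝓘(ℝ, F) u
      ((extChartAt (𝓡∂ d) x₀).symm (extChartAt (𝓡∂ d) x₀ x)) := by
    rwa [(extChartAt (𝓡∂ d) x₀).left_inv hx]
  have h3 := mfderiv_comp_mfderivWithin (extChartAt (𝓡∂ d) x₀ x) h2 h1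
    ((𝓡∂ d).uniqueMDiffOn _ (extChartAt_target_subset_range x₀ hx'))
  rw [← mfderivWithin_eq_fderivWithin, h3]
  have h4 := congrFun (symmCoord_eq_mfderivWithin hx) v
  -- The base points agree only propositionally, so the derivative is transported along the equality
  -- after tangent spaces are read as the model space.
  have h5 : ∀ z, z = x → ∀ w : EuclideanSpace ℝ (Fin d),
      (mfderiv (𝓡∂ d) 𝓘(ℝ, F) u z : EuclideanSpace ℝ (Fin d) →L[ℝ] F) w =
      (mfderiv (𝓡∂ d) 𝓘(ℝ, F) u x : EuclideanSpace ℝ (Fin d) →L[ℝ] F) w := by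
    rintro z rfl w; rfl
  refine Eq.trans ?_ (h5 _ ((extChartAt (𝓡∂ d) x₀).left_inv hx) _).symm
  exact congrArg (mfderiv (𝓡∂ d) 𝓘(ℝ, F) u x : EuclideanSpace ℝ (Fin d) →L[ℝ] F) h4

end Chart

/-! ### Smoothness of the metric coefficients -/

section Metric

variable {d : ℕ} [NeZero d] {M : Type*} [EMetricSpace M]
  [ChartedSpace (EuclideanHalfSpace d) M] [IsManifold (𝓡∂ d) ∞ M]
  [RiemannianBundle (fun x : M ↦ TangentSpace (𝓡∂ d) x)]
  [IsContMDiffRiemannianBundle (𝓡∂ d) ∞ (EuclideanSpace ℝ (Fin d))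
      (fun x : M ↦ TangentSpace (𝓡∂ d) x)]

/-- Read in the trivialization at `x₀`, the field x ↦ `symmCoord x₀ x v` is the constant v, hence
smooth, and the metric is smooth on smooth sections. -/
lemma contMDiffOn_inner_symmCoord (x₀ : M) (v w : EuclideanSpace ℝ (Fin d)) :
    ContMDiffOn (𝓡∂ d) 𝓘(ℝ, ℝ) ∞ (fun x ↦ inner ℝ (symmCoord x₀ x v) (symmCoord x₀ x w))
      (extChartAt (𝓡∂ d) x₀).source := by
  have h : ∀ v : EuclideanSpace ℝ (Fin d), ContMDiffOn (𝓡∂ d)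
      ((𝓡∂ d).prod 𝓘(ℝ, EuclideanSpace ℝ (Fin d))) ∞
      (fun x ↦ TotalSpace.mk' (EuclideanSpace ℝ (Fin d)) x (symmCoord x₀ x v))
      (extChartAt (𝓡∂ d) x₀).source := by
    intro v
    have := (trivializationAt (EuclideanSpace ℝ (Fin d)) (TangentSpace (𝓡∂ d))
      x₀).contMDiffOn_section_baseSet_iff (IB := 𝓡∂ d) (n := ∞) (s := fun x ↦ symmCoord x₀ x v)
    rw [extChartAt_source]
    refine this.2 ?_
    refine (contMDiffOn_const (c := v)).congr fun y hy ↦ ?_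
    have := Trivialization.continuousLinearMapAt_symmL (R := ℝ) (trivializationAt (EuclideanSpace ℝ (Fin d))
      (TangentSpace (𝓡∂ d)) x₀) hy v
    rw [Trivialization.continuousLinearMapAt_apply, Trivialization.linearMapAt_apply, if_pos hy] at this
    exact this
  exact (h v).inner_bundle (h w)

end Metric

/-! ### Euclidean models of an inner product space -/

section InnerProductSpace

variable {d : ℕ} {V : Type*} [NormedAddCommGroup V] [InnerProductSpace ℝ V]

lemma normDet_eq_sqrt_det {k : ℕ} (L : EuclideanSpace ℝ (Fin k) →ₗ[ℝ] V) :
    L.normDet = √(Matrix.det (Matrix.of fun i j : Fin k ↦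
      inner ℝ (L (EuclideanSpace.single i 1)) (L (EuclideanSpace.single j 1)))) := by
  have h := L.normDet_sq_eq_det_gram (EuclideanSpace.basisFun (Fin k) ℝ)
  rw [eq_comm, Real.sqrt_eq_iff_eq_sq _ L.normDet_nonneg, eq_comm]
  · refine Eq.trans h ?_
    congr 1
    ext i j
    simp [Matrix.gram_apply]
  · refine le_of_le_of_eq (sq_nonneg L.normDet) (Eq.trans h ?_)
    congr 1
    ext i j
    simp [Matrix.gram_apply]

/-- Compose `L` with the isometry given by an orthonormal basis. The tangent space is thereby
replaced by the fixed space ℝ^d, in which Hausdorff measures of linear images are known, with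
lengths and Jacobians unchanged. -/
lemma exists_euclidean_model (L : EuclideanSpace ℝ (Fin d) ≃ₗ[ℝ] V) :
    ∃ T : EuclideanSpace ℝ (Fin d) ≃L[ℝ] EuclideanSpace ℝ (Fin d), (∀ v, ‖T v‖ = ‖L v‖) ∧
      ∀ (k : ℕ) (j : EuclideanSpace ℝ (Fin k) →ₗ[ℝ] EuclideanSpace ℝ (Fin d)),
        ((T : EuclideanSpace ℝ (Fin d) →ₗ[ℝ] EuclideanSpace ℝ (Fin d)) ∘ₗ j).normDet =
          ((L : EuclideanSpace ℝ (Fin d) →ₗ[ℝ] V) ∘ₗ j).normDet := by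
  have : FiniteDimensional ℝ V := L.finiteDimensional
  have hd : Module.finrank ℝ V = d := by rw [← L.finrank_eq]; simp
  set A : V ≃ₗᵢ[ℝ] EuclideanSpace ℝ (Fin d) :=
    ((stdOrthonormalBasis ℝ V).reindex (finCongr hd)).repr with hA
  refine ⟨(L.trans A.toLinearEquiv).toContinuousLinearEquiv, fun v ↦ ?_, fun k j ↦ ?_⟩
  · simp
  · rw [normDet_eq_sqrt_det, normDet_eq_sqrt_det]
    simp

end InnerProductSpace

/-! ### Jacobians of the inverse chart and continuity of the metric -/

section Metric

variable {d : ℕ} [NeZero d] {M : Type*} [EMetricSpace M]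
  [ChartedSpace (EuclideanHalfSpace d) M] [IsManifold (𝓡∂ d) ∞ M]

lemma mfderivWithin_extChartAt_symm {x₀ : M} {y : EuclideanSpace ℝ (Fin d)}
    (hy : y ∈ (extChartAt (𝓡∂ d) x₀).target) (v : EuclideanSpace ℝ (Fin d)) :
    mfderivWithin 𝓘(ℝ, EuclideanSpace ℝ (Fin d)) (𝓡∂ d) (extChartAt (𝓡∂ d) x₀).symm
      (range (𝓡∂ d)) y v = symmCoord x₀ ((extChartAt (𝓡∂ d) x₀).symm y) v := by
  have h := symmCoord_eq_mfderivWithin ((extChartAt (𝓡∂ d) x₀).map_target hy)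
  rw [(extChartAt (𝓡∂ d) x₀).right_inv hy] at h
  exact (congrFun h v).symm

variable [RiemannianBundle (fun x : M ↦ TangentSpace (𝓡∂ d) x)]

/-- The Jacobian at `x` of the inverse of the chart at `x₀`, restricted to a subspace. -/
def coordJac {k : ℕ} (j : EuclideanSpace ℝ (Fin k) →ₗᵢ[ℝ] EuclideanSpace ℝ (Fin d)) (x₀ x : M) : ℝ :=
  LinearMap.normDet (𝕜 := ℝ) (U := EuclideanSpace ℝ (Fin k)) (V := TangentSpace (𝓡∂ d) x)
    ((symmCoord x₀ x).toLinearMap ∘ₗ j.toLinearMap)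

lemma coordJac_eq_sqrt_det {k : ℕ} (j : EuclideanSpace ℝ (Fin k) →ₗᵢ[ℝ] EuclideanSpace ℝ (Fin d))
    (x₀ x : M) : coordJac j x₀ x = √(Matrix.det (Matrix.of fun i i' : Fin k ↦
      inner ℝ (symmCoord x₀ x (j (EuclideanSpace.single i 1)))
        (symmCoord x₀ x (j (EuclideanSpace.single i' 1))))) :=
  normDet_eq_sqrt_det (V := TangentSpace (𝓡∂ d) x) _

lemma coordJac_pos {k : ℕ} (j : EuclideanSpace ℝ (Fin k) →ₗᵢ[ℝ] EuclideanSpace ℝ (Fin d))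
    {x₀ x : M} (hx : x ∈ (extChartAt (𝓡∂ d) x₀).source) : 0 < coordJac j x₀ x := by
  refine lt_of_le_of_ne (LinearMap.normDet_nonneg _) (Ne.symm ?_)
  refine ((LinearMap.normDet_ne_zero_tfae (𝕜 := ℝ) (U := EuclideanSpace ℝ (Fin k))
    (V := TangentSpace (𝓡∂ d) x) ((symmCoord x₀ x).toLinearMap ∘ₗ j.toLinearMap)).out 0 4).2 ?_
  exact (coordEquiv hx).injective.comp j.injective

lemma sqrtDetMetric_eq_coordJac {x₀ : M} {y : EuclideanSpace ℝ (Fin d)}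
    (hy : y ∈ (extChartAt (𝓡∂ d) x₀).target) :
    sqrtDetMetric x₀ y = coordJac (LinearIsometry.id : EuclideanSpace ℝ (Fin d) →ₗᵢ[ℝ]
      EuclideanSpace ℝ (Fin d)) x₀ ((extChartAt (𝓡∂ d) x₀).symm y) := by
  refine Eq.trans ?_ (coordJac_eq_sqrt_det (LinearIsometry.id : EuclideanSpace ℝ (Fin d) →ₗᵢ[ℝ]
    EuclideanSpace ℝ (Fin d)) x₀ _).symm
  simp only [sqrtDetMetric, coordVec_eq hy]
  rfl

lemma exists_coord_model {x₀ x : M} (hx : x ∈ (extChartAt (𝓡∂ d) x₀).source) :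
    ∃ T : EuclideanSpace ℝ (Fin d) ≃L[ℝ] EuclideanSpace ℝ (Fin d),
      (∀ v, ‖T v‖ = ‖symmCoord x₀ x v‖) ∧
      ∀ (k : ℕ) (j : EuclideanSpace ℝ (Fin k) →ₗᵢ[ℝ] EuclideanSpace ℝ (Fin d)),
        ((T : EuclideanSpace ℝ (Fin d) →ₗ[ℝ] EuclideanSpace ℝ (Fin d)) ∘ₗ
          j.toLinearMap).normDet = coordJac j x₀ x := by
  obtain ⟨T, h1, h2⟩ := exists_euclidean_model (V := TangentSpace (𝓡∂ d) x) (coordEquiv hx)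
  exact ⟨T, h1, fun k j ↦ h2 k j.toLinearMap⟩

lemma norm_sq_symmCoord (x₀ x : M) (v : EuclideanSpace ℝ (Fin d)) :
    ‖symmCoord x₀ x v‖ ^ 2 = ∑ i, ∑ j, v i * v j *
      inner ℝ (symmCoord x₀ x (EuclideanSpace.single i 1))
        (symmCoord x₀ x (EuclideanSpace.single j 1)) := by
  have : v = ∑ i, v i • EuclideanSpace.single i (1 : ℝ) := by
    ext k; simp [Pi.single_apply]
  conv_lhs => rw [this]
  rw [map_sum, ← real_inner_self_eq_norm_sq, sum_inner]
  refine Finset.sum_congr rfl fun i _ ↦ ?_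
  rw [inner_sum]
  refine Finset.sum_congr rfl fun j _ ↦ ?_
  rw [map_smul, map_smul, real_inner_smul_left, real_inner_smul_right, mul_assoc]

variable [IsContMDiffRiemannianBundle (𝓡∂ d) ∞ (EuclideanSpace ℝ (Fin d))
      (fun x : M ↦ TangentSpace (𝓡∂ d) x)]

lemma contMDiffOn_coordJac {k : ℕ}
    (j : EuclideanSpace ℝ (Fin k) →ₗᵢ[ℝ] EuclideanSpace ℝ (Fin d)) (x₀ : M) :
    ContMDiffOn (𝓡∂ d) 𝓘(ℝ, ℝ) ∞ (coordJac j x₀) (extChartAt (𝓡∂ d) x₀).source := by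
  intro x hx
  have h1 : ContMDiffWithinAt (𝓡∂ d) 𝓘(ℝ, ℝ) ∞ (fun x ↦ Matrix.det (Matrix.of fun i i' : Fin k ↦
      inner ℝ (symmCoord x₀ x (j (EuclideanSpace.single i 1)))
        (symmCoord x₀ x (j (EuclideanSpace.single i' 1)))))
      (extChartAt (𝓡∂ d) x₀).source x := by
    simp only [Matrix.det_apply', Matrix.of_apply]
    refine ContMDiffWithinAt.sum fun σ _ ↦ ContMDiffWithinAt.mul contMDiffWithinAt_const ?_
    refine contMDiffWithinAt_finsetProd fun i _ ↦ ?_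
    exact contMDiffOn_inner_symmCoord x₀ _ _ x hx
  have h2 := coordJac_pos j hx
  rw [coordJac_eq_sqrt_det, Real.sqrt_pos] at h2
  have h3 := (Real.contDiffAt_sqrt (n := ∞) h2.ne').contMDiffAt.comp_contMDiffWithinAt x h1
  refine h3.congr_of_eventuallyEq (Eventually.of_forall fun y ↦ coordJac_eq_sqrt_det j x₀ y)
    (coordJac_eq_sqrt_det j x₀ x)

/-- The metric in the chart at `x₀` varies continuously. -/
lemma eventually_norm_symmCoord_le {x₀ x : M} (hx : x ∈ (extChartAt (𝓡∂ d) x₀).source) {r : ℝ}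
    (hr : 1 < r) : ∀ᶠ y in 𝓝 x, ∀ v : EuclideanSpace ℝ (Fin d),
      ‖symmCoord x₀ y v‖ ≤ r * ‖symmCoord x₀ x v‖ ∧
      ‖symmCoord x₀ x v‖ ≤ r * ‖symmCoord x₀ y v‖ := by
  obtain ⟨T, hT, -⟩ := exists_coord_model hx
  obtain ⟨K, hK⟩ : ∃ K : ℝ, 0 < K ∧ ∀ v, ‖v‖ ^ 2 ≤ K * ‖symmCoord x₀ x v‖ ^ 2 := by
    refine ⟨‖(T.symm : EuclideanSpace ℝ (Fin d) →L[ℝ] EuclideanSpace ℝ (Fin d))‖ ^ 2 + 1,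
      by positivity, fun v ↦ ?_⟩
    have h1 : ‖v‖ ≤ ‖(T.symm : EuclideanSpace ℝ (Fin d) →L[ℝ] EuclideanSpace ℝ (Fin d))‖ * ‖T v‖ := by
      simpa using (T.symm : EuclideanSpace ℝ (Fin d) →L[ℝ] EuclideanSpace ℝ (Fin d)).le_opNorm (T v)
    rw [hT] at h1
    calc ‖v‖ ^ 2 ≤ _ := pow_le_pow_left₀ (norm_nonneg _) h1 2
      _ ≤ _ := by rw [mul_pow]; gcongr; linarith
  obtain ⟨hK0, hK⟩ := hK
  -- Chosen so that 1 - η = r⁻² and 1 + η ≤ r². A relative error η in the squared norm thus costs at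
  -- most a factor r in the norm, in either direction.
  set η : ℝ := (r ^ 2 - 1) / r ^ 2 with hη
  have hr2 : 1 < r ^ 2 := by nlinarith
  have hη0 : 0 < η := by rw [hη]; apply div_pos <;> nlinarith
  -- Each of the d² metric coefficients may change by δ, the error in the quadratic form is at most
  -- d² δ |v|², and |v|² is at most K times the form at x.
  set δ : ℝ := η / (K * ((d : ℝ) ^ 2)) with hδ
  have hd0 : (0 : ℝ) < d := by exact_mod_cast NeZero.pos d
  have hδ0 : 0 < δ := by positivity
  have hsrc : (extChartAt (𝓡∂ d) x₀).source ∈ 𝓝 x := (isOpen_extChartAt_source x₀).mem_nhds hx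
  have hev : ∀ᶠ y in 𝓝 x, ∀ i j : Fin d,
      |inner ℝ (symmCoord x₀ y (EuclideanSpace.single i 1))
        (symmCoord x₀ y (EuclideanSpace.single j 1)) -
      inner ℝ (symmCoord x₀ x (EuclideanSpace.single i 1))
        (symmCoord x₀ x (EuclideanSpace.single j 1))| < δ := by
    rw [eventually_all]; intro i
    rw [eventually_all]; intro j
    have hc : ContinuousAt (fun y ↦ inner ℝ (symmCoord x₀ y (EuclideanSpace.single i 1))
        (symmCoord x₀ y (EuclideanSpace.single j 1))) x :=
      (contMDiffOn_inner_symmCoord x₀ (EuclideanSpace.single i 1)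
        (EuclideanSpace.single j 1)).continuousOn.continuousAt hsrc
    exact (Metric.continuousAt_iff'.1 hc) δ hδ0
  filter_upwards [hev] with y hy v
  have h1 : |‖symmCoord x₀ y v‖ ^ 2 - ‖symmCoord x₀ x v‖ ^ 2| ≤ η * ‖symmCoord x₀ x v‖ ^ 2 := by
    rw [norm_sq_symmCoord x₀ y, norm_sq_symmCoord x₀ x]
    calc _ = |∑ i, ∑ j, v i * v j * (inner ℝ (symmCoord x₀ y (EuclideanSpace.single i 1))
        (symmCoord x₀ y (EuclideanSpace.single j 1)) -
      inner ℝ (symmCoord x₀ x (EuclideanSpace.single i 1))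
        (symmCoord x₀ x (EuclideanSpace.single j 1)))| := by
          simp only [mul_sub, Finset.sum_sub_distrib]
      _ ≤ ∑ i : Fin d, ∑ j : Fin d, ‖v‖ * ‖v‖ * δ := by
          refine (Finset.abs_sum_le_sum_abs _ _).trans (Finset.sum_le_sum fun i _ ↦ ?_)
          refine (Finset.abs_sum_le_sum_abs _ _).trans (Finset.sum_le_sum fun j _ ↦ ?_)
          rw [abs_mul, abs_mul]
          have := PiLp.norm_apply_le v i
          have := PiLp.norm_apply_le v j
          have := hy i j
          simp only [Real.norm_eq_abs] at *
          gcongr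
      _ = d ^ 2 * δ * ‖v‖ ^ 2 := by simp; ring
      _ ≤ d ^ 2 * δ * (K * ‖symmCoord x₀ x v‖ ^ 2) := by gcongr; exact hK v
      _ = η * ‖symmCoord x₀ x v‖ ^ 2 := by rw [hδ]; field_simp
      _ = _ := by rw [norm_sq_symmCoord x₀ x]
  rw [abs_le] at h1
  have hη1 : η ≤ r ^ 2 - 1 := by
    rw [hη]; exact div_le_self (by linarith) hr2.le
  have hη2 : r ^ 2 * (1 - η) = 1 := by rw [hη]; field_simp; ring
  have hr0 : 0 ≤ r := by linarith
  constructor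
  · refine le_of_sq_le_sq ?_ (by positivity)
    rw [mul_pow]
    nlinarith [sq_nonneg ‖symmCoord x₀ x v‖]
  · refine le_of_sq_le_sq ?_ (by positivity)
    rw [mul_pow]
    have : (1 - η) * ‖symmCoord x₀ x v‖ ^ 2 ≤ ‖symmCoord x₀ y v‖ ^ 2 := by linarith
    calc ‖symmCoord x₀ x v‖ ^ 2 = r ^ 2 * ((1 - η) * ‖symmCoord x₀ x v‖ ^ 2) := by
          rw [← mul_assoc, hη2, one_mul]
      _ ≤ _ := by gcongr

end Metric

/-! ### The Riemannian distance is almost Euclidean at small scale -/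

section Distance

variable {d : ℕ} [NeZero d] {M : Type*} [EMetricSpace M]
  [ChartedSpace (EuclideanHalfSpace d) M] [IsManifold (𝓡∂ d) ∞ M]
  [RiemannianBundle (fun x : M ↦ TangentSpace (𝓡∂ d) x)]
  [IsContMDiffRiemannianBundle (𝓡∂ d) ∞ (EuclideanSpace ℝ (Fin d))
      (fun x : M ↦ TangentSpace (𝓡∂ d) x)]
  [IsRiemannianManifold (𝓡∂ d) M]

lemma enorm_le_ofReal_mul_of_norm_le {E F : Type*} [SeminormedAddGroup E] [SeminormedAddGroup F]
    {r : ℝ} {a : E} {b : F} (h : ‖a‖ ≤ r * ‖b‖) (hr : 0 ≤ r) :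
    ‖a‖ₑ ≤ ENNReal.ofReal r * ‖b‖ₑ := by
  rw [← ofReal_norm, ← ofReal_norm, ← ENNReal.ofReal_mul hr]
  exact ENNReal.ofReal_le_ofReal h

/-- The straight coordinate segment is a competitor for the distance. It stays in the chart because
a ball intersected with the half space is convex, and its Riemannian speed is at most r times the
speed measured by the metric frozen at x. -/
lemma exists_nhds_edist_le {x₀ x : M} (hx : x ∈ (extChartAt (𝓡∂ d) x₀).source) {r : ℝ}
    (hr : 1 < r) : ∃ U ∈ 𝓝 x, ∀ p ∈ U, ∀ q ∈ U, edist p q ≤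
      ENNReal.ofReal r * ‖symmCoord x₀ x (extChartAt (𝓡∂ d) x₀ p - extChartAt (𝓡∂ d) x₀ q)‖ₑ := by
  set φ := extChartAt (𝓡∂ d) x₀ with hφ
  have hφx := φ.map_source hx
  obtain ⟨δ, δpos, hδ⟩ : ∃ δ > 0, Metric.ball (φ x) δ ∩ range (𝓡∂ d) ⊆ φ.target ∩
      {y | ∀ v : EuclideanSpace ℝ (Fin d),
        ‖symmCoord x₀ (φ.symm y) v‖ ≤ r * ‖symmCoord x₀ x v‖} := by
    refine Metric.mem_nhdsWithin_iff.1 (inter_mem (extChartAt_target_mem_nhdsWithin' hx) ?_)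
    refine nhdsWithin_le_nhds ?_
    have h1 : ContinuousAt φ.symm (φ x) := continuousAt_extChartAt_symm'' hφx
    have h2 := eventually_norm_symmCoord_le hx hr
    rw [← φ.left_inv hx] at h2
    filter_upwards [h1.eventually h2] with y hy v
    have := (hy v).1
    rwa [φ.left_inv hx] at this
  refine ⟨φ.source ∩ φ ⁻¹' (Metric.ball (φ x) δ), inter_mem ((isOpen_extChartAt_source x₀).mem_nhds hx)
    ((continuousAt_extChartAt' hx).preimage_mem_nhds (Metric.ball_mem_nhds _ δpos)), ?_⟩
  rintro p ⟨hps, hp⟩ q ⟨hqs, hq⟩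
  rw [IsRiemannianManifold.out (I := 𝓡∂ d) p q]
  let η := ContinuousAffineMap.lineMap (R := ℝ) (φ p) (φ q)
  set γ := φ.symm ∘ η with hγ
  have hη : Icc 0 1 ⊆ ⇑η ⁻¹' (φ.target ∩ {y | ∀ v : EuclideanSpace ℝ (Fin d),
        ‖symmCoord x₀ (φ.symm y) v‖ ≤ r * ‖symmCoord x₀ x v‖}) := by
    simp only [← image_subset_iff, ContinuousAffineMap.coe_lineMap_eq, ← segment_eq_image_lineMap, η]
    refine Subset.trans ?_ hδ
    exact ((convex_ball _ _).inter (𝓡∂ d).convex_range).segment_subset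
      ⟨hp, extChartAt_target_subset_range x₀ (φ.map_source hps)⟩
      ⟨hq, extChartAt_target_subset_range x₀ (φ.map_source hqs)⟩
  have η_smooth : ContMDiffOn 𝓘(ℝ, ℝ) 𝓘(ℝ, EuclideanSpace ℝ (Fin d)) 1 η (Icc 0 1) := by
    apply ContMDiff.contMDiffOn
    rw [contMDiff_iff_contDiff]
    exact ContinuousAffineMap.contDiff _
  have h1 : riemannianEDist (𝓡∂ d) p q ≤ pathELength (𝓡∂ d) γ 0 1 := by
    apply riemannianEDist_le_pathELength _ _ _ zero_le_one
    · exact (contMDiffOn_extChartAt_symm x₀).comp η_smooth fun t ht ↦ (hη ht).1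
    · simp [hγ, η, ContinuousAffineMap.coe_lineMap_eq, hφ]
      exact φ.left_inv hps
    · simp [hγ, η, ContinuousAffineMap.coe_lineMap_eq]
      exact φ.left_inv hqs
  refine h1.trans ?_
  rw [pathELength_eq_lintegral_mfderivWithin_Icc]
  calc _ ≤ ∫⁻ t in Icc (0 : ℝ) 1, ENNReal.ofReal r * ‖symmCoord x₀ x (φ p - φ q)‖ₑ := by
        refine setLIntegral_mono' measurableSet_Icc fun t ht ↦ ?_
        have h2 : mfderivWithin 𝓘(ℝ, ℝ) (𝓡∂ d) γ (Icc 0 1) t 1 =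
            symmCoord x₀ (φ.symm (η t)) (φ q - φ p) := by
          rw [← mfderivWithin_extChartAt_symm (hη ht).1]
          have h3 := mfderivWithin_comp t (mdifferentiableWithinAt_extChartAt_symm (hη ht).1)
            (η_smooth.mdifferentiableOn one_ne_zero t ht)
            (fun t ht ↦ extChartAt_target_subset_range x₀ (hη ht).1)
            ((uniqueMDiffWithinAt_iff_uniqueDiffWithinAt).2 (uniqueDiffOn_Icc zero_lt_one t ht))
          have h4 : mfderivWithin 𝓘(ℝ, ℝ) 𝓘(ℝ, EuclideanSpace ℝ (Fin d)) η (Icc 0 1) t 1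
              = φ q - φ p := by
            rw [mfderivWithin_eq_fderivWithin, fderivWithin_eq_fderiv
              (uniqueDiffOn_Icc zero_lt_one _ ht) (ContinuousAffineMap.differentiableAt _)]
            change fderiv ℝ (ContinuousAffineMap.lineMap (R := ℝ) (φ p) (φ q)) t 1 = _
            simp
          rw [← h4, hγ, h3]
          rfl
        rw [h2]
        refine enorm_le_ofReal_mul_of_norm_le ?_ (by linarith)
        rw [← norm_neg, ← map_neg, neg_sub]
        exact (hη ht).2 _
    _ = _ := by simp

/-- A path that nearly realises the distance is too short to leave the region where the metric is
comparable with the one at x. Its coordinate image, measured by the frozen metric, is at least as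
long as the straight segment. -/
lemma exists_nhds_enorm_le {x₀ x : M} (hx : x ∈ (extChartAt (𝓡∂ d) x₀).source) {r : ℝ}
    (hr : 1 < r) {T : EuclideanSpace ℝ (Fin d) →L[ℝ] EuclideanSpace ℝ (Fin d)}
    (hT : ∀ v, ‖T v‖ = ‖symmCoord x₀ x v‖) : ∃ U ∈ 𝓝 x, ∀ p ∈ U, ∀ q ∈ U,
      ‖T (extChartAt (𝓡∂ d) x₀ p - extChartAt (𝓡∂ d) x₀ q)‖ₑ ≤ ENNReal.ofReal r * edist p q := by
  set φ := extChartAt (𝓡∂ d) x₀ with hφ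
  have hev : φ.source ∩ {z | ∀ v : EuclideanSpace ℝ (Fin d),
      ‖symmCoord x₀ x v‖ ≤ r * ‖symmCoord x₀ z v‖} ∈ 𝓝 x := by
    refine inter_mem ((isOpen_extChartAt_source x₀).mem_nhds hx) ?_
    filter_upwards [eventually_norm_symmCoord_le hx hr] with y hy v using (hy v).2
  obtain ⟨ε, εpos, εtop, hε⟩ : ∃ ε : ℝ≥0∞, 0 < ε ∧ ε ≠ ⊤ ∧ Metric.eball x ε ⊆ φ.source ∩
      {z | ∀ v : EuclideanSpace ℝ (Fin d), ‖symmCoord x₀ x v‖ ≤ r * ‖symmCoord x₀ z v‖} := by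
    obtain ⟨ε, εpos, hε⟩ := EMetric.mem_nhds_iff.1 hev
    exact ⟨min ε 1, by simp [εpos], by simp, (Metric.eball_subset_eball (min_le_left _ _)).trans hε⟩
  have h4 : ε / 4 + ε / 4 = ε / 2 := by
    rw [← ENNReal.add_div, ← two_mul, show (4 : ℝ≥0∞) = 2 * 2 by norm_num,
      ENNReal.mul_div_mul_left _ _ (by simp) (by simp)]
  have h2 : ε / 2 + ε / 2 = ε := ENNReal.add_halves ε
  have h42 : ε / 4 ≤ ε / 2 := by rw [← h4]; exact le_self_add
  -- Two points of this ball are less than ε/2 apart. A path shorter than ε/2 starting at one of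
  -- them stays within ε/2 + ε/4 < ε of x.
  refine ⟨Metric.eball x (ε / 4), Metric.eball_mem_nhds _ (ENNReal.div_pos εpos.ne' (by simp)), ?_⟩
  intro p hp q hq
  have hpq : edist p q < ε / 2 := by
    rw [← h4]
    exact (edist_triangle_right p q x).trans_lt
      (ENNReal.add_lt_add (Metric.mem_eball.1 hp) (Metric.mem_eball.1 hq))
  -- The infimum defining the distance need not be attained, so the bound is proved for every
  -- slightly larger length s and passed to the limit.
  have key : ∀ s, edist p q < s → s < ε / 2 → ‖T (φ p - φ q)‖ₑ ≤ ENNReal.ofReal r * s := by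
    intro s hs hsε
    rw [IsRiemannianManifold.out (I := 𝓡∂ d) p q] at hs
    obtain ⟨γ, hγ0, hγ1, hγ, hγs⟩ := exists_lt_of_riemannianEDist_lt hs
    have hgood : ∀ t ∈ Icc (0 : ℝ) 1, γ t ∈ φ.source ∩
        {z | ∀ v : EuclideanSpace ℝ (Fin d), ‖symmCoord x₀ x v‖ ≤ r * ‖symmCoord x₀ z v‖} := by
      intro t ht
      refine hε ?_
      have h1 : edist p (γ t) < ε / 2 := by
        rw [IsRiemannianManifold.out (I := 𝓡∂ d) p (γ t)]
        refine lt_of_le_of_lt (riemannianEDist_le_pathELength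
          (hγ.mono (Icc_subset_Icc_right ht.2)) hγ0 rfl ht.1) ?_
        exact ((pathELength_mono le_rfl ht.2).trans_lt hγs).trans hsε
      rw [Metric.mem_eball]
      calc edist (γ t) x ≤ edist (γ t) p + edist p x := edist_triangle _ _ _
        _ < ε / 2 + ε / 2 := by
          refine ENNReal.add_lt_add (by rwa [edist_comm]) ?_
          exact (Metric.mem_eball.1 hp).trans_le h42
        _ = ε := h2
    set γ' : ℝ → EuclideanSpace ℝ (Fin d) := φ ∘ γ with hγ'
    have hγ's : ContMDiffOn 𝓘(ℝ, ℝ) 𝓘(ℝ, EuclideanSpace ℝ (Fin d)) 1 γ' (Icc 0 1) := by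
      refine contMDiffOn_extChartAt.comp (I' := 𝓡∂ d) (t := (chartAt _ x₀).source) hγ
        fun t ht ↦ ?_
      have := (hgood t ht).1
      rwa [hφ, extChartAt_source] at this
    have hγ'd : ContDiffOn ℝ 1 γ' (Icc 0 1) := contMDiffOn_iff_contDiffOn.1 hγ's
    have hTd : ContDiffOn ℝ 1 (fun t ↦ T (γ' t)) (Icc 0 1) := T.contDiff.comp_contDiffOn hγ'd
    have h5 := enorm_sub_le_lintegral_derivWithin_Icc_of_contDiffOn_Icc hTd zero_le_one
    have h6 : ‖T (φ p - φ q)‖ₑ = ‖T (γ' 1) - T (γ' 0)‖ₑ := by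
      rw [← map_sub, hγ', Function.comp_apply, Function.comp_apply, hγ0, hγ1, ← enorm_neg,
        ← map_neg, neg_sub]
    rw [h6]
    refine h5.trans ?_
    calc _ ≤ ∫⁻ t in Icc (0 : ℝ) 1, ENNReal.ofReal r *
          ‖mfderivWithin 𝓘(ℝ, ℝ) (𝓡∂ d) γ (Icc 0 1) t 1‖ₑ := by
          refine setLIntegral_mono' measurableSet_Icc fun t ht ↦ ?_
          have hu := uniqueDiffOn_Icc (zero_lt_one (α := ℝ)) t ht
          have hdt := (hγ'd.differentiableOn one_ne_zero) t ht
          have h7 : derivWithin (fun t ↦ T (γ' t)) (Icc 0 1) t =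
              T (toCoord x₀ (γ t) (mfderivWithin 𝓘(ℝ, ℝ) (𝓡∂ d) γ (Icc 0 1) t 1)) := by
            have h8 := (T.hasFDerivAt.comp_hasDerivWithinAt t hdt.hasDerivWithinAt).derivWithin hu
            refine Eq.trans h8 ?_
            have h9 := mfderiv_comp_mfderivWithin t (mdifferentiableAt_extChartAt
              (by have := (hgood t ht).1; rwa [hφ, extChartAt_source] at this))
              (hγ.mdifferentiableOn one_ne_zero t ht)
              ((uniqueMDiffWithinAt_iff_uniqueDiffWithinAt).2 hu)
            rw [← fderivWithin_derivWithin, ← mfderivWithin_eq_fderivWithin]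
            exact congrArg (fun L : ℝ →L[ℝ] EuclideanSpace ℝ (Fin d) ↦ T (L 1)) h9
          rw [h7]
          refine enorm_le_ofReal_mul_of_norm_le ?_ (by linarith)
          rw [hT]
          refine ((hgood t ht).2 _).trans_eq ?_
          rw [symmCoord_toCoord (hgood t ht).1]
      _ = ENNReal.ofReal r * pathELength (𝓡∂ d) γ 0 1 := by
          rw [lintegral_const_mul' _ _ ENNReal.ofReal_ne_top,
            pathELength_eq_lintegral_mfderivWithin_Icc]
      _ ≤ _ := by gcongr
  have hlim : Tendsto (fun s : ℝ≥0∞ ↦ ENNReal.ofReal r * s) (𝓝[>] (edist p q))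
      (𝓝 (ENNReal.ofReal r * edist p q)) :=
    tendsto_nhdsWithin_of_tendsto_nhds
      (ENNReal.Tendsto.const_mul tendsto_id (Or.inr ENNReal.ofReal_ne_top))
  have : (𝓝[>] (edist p q)).NeBot := nhdsGT_neBot_of_exists_gt ⟨_, hpq⟩
  refine ge_of_tendsto hlim ?_
  filter_upwards [self_mem_nhdsWithin, nhdsWithin_le_nhds (gt_mem_nhds hpq)] with s hs hs' using
    key s hs hs'

end Distance

/-! ### The area formula in a chart -/

section MeasureFormula

lemma measurableSet_inter_preimage_of_continuousOn {X Y : Type*} [TopologicalSpace X]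
    [MeasurableSpace X] [BorelSpace X] [TopologicalSpace Y] [MeasurableSpace Y] [BorelSpace Y]
    {f : X → Y} {s : Set X} {B : Set Y} (hf : ContinuousOn f s) (hs : MeasurableSet s)
    (hB : MeasurableSet B) : MeasurableSet (s ∩ f ⁻¹' B) := by
  have h1 : Measurable (s.domRestrict f) :=
    (continuousOn_iff_continuous_domRestrict.1 hf).measurable
  have h2 := MeasurableSet.subtype_image hs (h1 hB)
  have h3 : Subtype.val '' (s.domRestrict f ⁻¹' B) = s ∩ f ⁻¹' B := by
    ext x; simp [and_comm]
  rwa [h3] at h2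

lemma exists_one_lt_ofReal_pow_lt {c : ℝ≥0∞} (hc : 1 < c) (k : ℕ) :
    ∃ r : ℝ, 1 < r ∧ ENNReal.ofReal r ^ k < c := by
  have h1 : Tendsto (fun r : ℝ ↦ ENNReal.ofReal r ^ k) (𝓝[>] 1) (𝓝 1) := by
    refine tendsto_nhdsWithin_of_tendsto_nhds ?_
    have : Continuous fun r : ℝ ↦ ENNReal.ofReal r ^ k :=
      (ENNReal.continuous_pow k).comp ENNReal.continuous_ofReal
    simpa using this.tendsto 1
  have h2 := h1.eventually (gt_mem_nhds hc)
  obtain ⟨r, hr, hr1⟩ := (h2.and self_mem_nhdsWithin).exists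
  exact ⟨r, hr1, hr⟩

variable {d : ℕ} [NeZero d] {M : Type*} [EMetricSpace M]
  [ChartedSpace (EuclideanHalfSpace d) M]

lemma measurableSet_extChartAt_target (x₀ : M) :
    MeasurableSet (extChartAt (𝓡∂ d) x₀).target := by
  rw [extChartAt_target]
  exact (((chartAt (EuclideanHalfSpace d) x₀).open_target.preimage
    (𝓡∂ d).continuous_symm).measurableSet).inter (𝓡∂ d).isClosed_range.measurableSet

/-- The coordinates, in a subspace of the model space, of the points of a set in the chart at
`x₀`. -/
def coordSet {k : ℕ} (j : EuclideanSpace ℝ (Fin k) →ₗᵢ[ℝ] EuclideanSpace ℝ (Fin d)) (x₀ : M)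
    (B : Set M) : Set (EuclideanSpace ℝ (Fin k)) :=
  (j ⁻¹' (extChartAt (𝓡∂ d) x₀).target) ∩ (fun z ↦ (extChartAt (𝓡∂ d) x₀).symm (j z)) ⁻¹' B

lemma continuousOn_extChartAt_symm_comp {k : ℕ}
    (j : EuclideanSpace ℝ (Fin k) →ₗᵢ[ℝ] EuclideanSpace ℝ (Fin d)) (x₀ : M) :
    ContinuousOn (fun z ↦ (extChartAt (𝓡∂ d) x₀).symm (j z))
      (j ⁻¹' (extChartAt (𝓡∂ d) x₀).target) :=
  (continuousOn_extChartAt_symm x₀).comp j.continuous.continuousOn fun _ hz ↦ hz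

lemma image_extChartAt_eq_image_coordSet {k : ℕ}
    {j : EuclideanSpace ℝ (Fin k) →ₗᵢ[ℝ] EuclideanSpace ℝ (Fin d)} {x₀ : M}
    {B : Set M} (hB : B ⊆ (extChartAt (𝓡∂ d) x₀).source ∩ extChartAt (𝓡∂ d) x₀ ⁻¹' range j) :
    extChartAt (𝓡∂ d) x₀ '' B = j '' coordSet j x₀ B := by
  ext y
  constructor
  · rintro ⟨x, hx, rfl⟩
    obtain ⟨z, hz⟩ := (hB hx).2
    refine ⟨z, ⟨?_, ?_⟩, hz⟩
    · rw [mem_preimage, hz]; exact (extChartAt (𝓡∂ d) x₀).map_source (hB hx).1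
    · rw [mem_preimage, hz, (extChartAt (𝓡∂ d) x₀).left_inv (hB hx).1]; exact hx
  · rintro ⟨z, hz, rfl⟩
    exact ⟨_, hz.2, (extChartAt (𝓡∂ d) x₀).right_inv hz.1⟩

variable [MeasurableSpace M] [BorelSpace M]

lemma measurableSet_coordSet {k : ℕ}
    (j : EuclideanSpace ℝ (Fin k) →ₗᵢ[ℝ] EuclideanSpace ℝ (Fin d)) (x₀ : M)
    {B : Set M} (hB : MeasurableSet B) : MeasurableSet (coordSet j x₀ B) :=
  measurableSet_inter_preimage_of_continuousOn (continuousOn_extChartAt_symm_comp j x₀)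
    ((measurableSet_extChartAt_target x₀).preimage j.continuous.measurable) hB

lemma aemeasurable_extChartAt_symm_comp {k : ℕ}
    (j : EuclideanSpace ℝ (Fin k) →ₗᵢ[ℝ] EuclideanSpace ℝ (Fin d)) (x₀ : M) :
    AEMeasurable (fun z ↦ (extChartAt (𝓡∂ d) x₀).symm (j z))
      (volume.restrict (j ⁻¹' (extChartAt (𝓡∂ d) x₀).target)) :=
  (continuousOn_extChartAt_symm_comp j x₀).aemeasurable
    ((measurableSet_extChartAt_target x₀).preimage j.continuous.measurable)

variable [IsManifold (𝓡∂ d) ∞ M] [RiemannianBundle (fun x : M ↦ TangentSpace (𝓡∂ d) x)]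

/-- The Riemannian measure of the submanifold of `M` that is the image of a subspace under the
inverse of the chart at `x₀`. -/
def coordMeasure {k : ℕ} (j : EuclideanSpace ℝ (Fin k) →ₗᵢ[ℝ] EuclideanSpace ℝ (Fin d)) (x₀ : M) :
    Measure M :=
  (((volume.restrict (j ⁻¹' (extChartAt (𝓡∂ d) x₀).target)).withDensity fun z ↦
    ENNReal.ofReal (coordJac j x₀ ((extChartAt (𝓡∂ d) x₀).symm (j z)))).map
      fun z ↦ (extChartAt (𝓡∂ d) x₀).symm (j z))

lemma coordMeasure_apply {k : ℕ} (j : EuclideanSpace ℝ (Fin k) →ₗᵢ[ℝ] EuclideanSpace ℝ (Fin d))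
    (x₀ : M) {B : Set M} (hB : MeasurableSet B) :
    coordMeasure j x₀ B = ∫⁻ z in coordSet j x₀ B,
      ENNReal.ofReal (coordJac j x₀ ((extChartAt (𝓡∂ d) x₀).symm (j z))) := by
  rw [coordMeasure, Measure.map_apply_of_aemeasurable ((aemeasurable_extChartAt_symm_comp
    j x₀).mono_ac (withDensity_absolutelyContinuous _ _)) hB, withDensity_apply',
    Measure.restrict_restrict', inter_comm]
  · rfl
  · exact (measurableSet_extChartAt_target x₀).preimage j.continuous.measurable

variable [IsContMDiffRiemannianBundle (𝓡∂ d) ∞ (EuclideanSpace ℝ (Fin d))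
      (fun x : M ↦ TangentSpace (𝓡∂ d) x)]
  [IsRiemannianManifold (𝓡∂ d) M]

/-- The map T ∘ φ is bi-Lipschitz with constant r near x, which distorts k-dimensional measure by at
most r^k. It sends `B` to a linear image of its coordinate set, whose measure is the Jacobian at x
times Lebesgue measure. Letting the Jacobian vary costs one more factor r, hence the choice r^(k+1)
< c. -/
lemma exists_nhds_euclideanHausdorffMeasure {k : ℕ}
    (j : EuclideanSpace ℝ (Fin k) →ₗᵢ[ℝ] EuclideanSpace ℝ (Fin d)) {x₀ x : M}
    (hx : x ∈ (extChartAt (𝓡∂ d) x₀).source) {c : ℝ≥0∞} (hc : 1 < c) :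
    ∃ U ∈ 𝓝 x, ∀ B, B ⊆ U →
      B ⊆ (extChartAt (𝓡∂ d) x₀).source ∩ extChartAt (𝓡∂ d) x₀ ⁻¹' range j → MeasurableSet B →
      μHE[k] B ≤ c * coordMeasure j x₀ B ∧ coordMeasure j x₀ B ≤ c * μHE[k] B := by
  obtain ⟨r, hr, hrc⟩ := exists_one_lt_ofReal_pow_lt hc (k + 1)
  obtain ⟨T, hT, hTj⟩ := exists_coord_model hx
  obtain ⟨U₁, hU₁, h1⟩ := exists_nhds_edist_le hx hr
  obtain ⟨U₂, hU₂, h2⟩ := exists_nhds_enorm_le hx hr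
    (T := (T : EuclideanSpace ℝ (Fin d) →L[ℝ] EuclideanSpace ℝ (Fin d))) hT
  set φ := extChartAt (𝓡∂ d) x₀ with hφ
  have hD0 : 0 < coordJac j x₀ x := coordJac_pos j hx
  have hDc : ContinuousAt (coordJac j x₀) x :=
    (contMDiffOn_coordJac j x₀).continuousOn.continuousAt
      ((isOpen_extChartAt_source x₀).mem_nhds hx)
  have hU₃ : {y | coordJac j x₀ y < r * coordJac j x₀ x ∧ coordJac j x₀ x < r * coordJac j x₀ y} ∈
      𝓝 x := by
    have h3 : coordJac j x₀ x < r * coordJac j x₀ x := by nlinarith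
    exact (hDc.eventually (gt_mem_nhds h3)).and
      ((continuousAt_const.mul hDc).eventually (lt_mem_nhds h3))
  refine ⟨U₁ ∩ U₂ ∩ _, inter_mem (inter_mem hU₁ hU₂) hU₃, fun B hBU hBs hB ↦ ?_⟩
  set F : M → EuclideanSpace ℝ (Fin d) := fun p ↦ T (φ p) with hF
  have hFB : F '' B = ((T : EuclideanSpace ℝ (Fin d) →ₗ[ℝ] EuclideanSpace ℝ (Fin d)) ∘ₗ
      j.toLinearMap) '' coordSet j x₀ B := by
    have := image_extChartAt_eq_image_coordSet hBs
    rw [hF, LinearMap.coe_comp, image_comp, ← image_image T]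
    exact congrArg (image T) this
  have hμF : μHE[k] (F '' B) = ENNReal.ofReal (coordJac j x₀ x) * volume (coordSet j x₀ B) := by
    rw [← hTj k j, hFB]
    have := LinearMap.euclideanHausdorffMeasure_image_eq_normDet_mul_volume
      ((T : EuclideanSpace ℝ (Fin d) →ₗ[ℝ] EuclideanSpace ℝ (Fin d)) ∘ₗ j.toLinearMap)
      (coordSet j x₀ B)
    rwa [finrank_euclideanSpace_fin] at this
  have hlipF : LipschitzOnWith r.toNNReal F B := fun p hp q hq ↦ by
    have := h2 p (hBU hp).1.2 q (hBU hq).1.2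
    rw [edist_eq_enorm_sub, hF, ← map_sub]
    exact this
  have hlipG : LipschitzOnWith r.toNNReal (fun y ↦ φ.symm (T.symm y)) (F '' B) := by
    rintro _ ⟨p, hp, rfl⟩ _ ⟨q, hq, rfl⟩
    have h4 := h1 p (hBU hp).1.1 q (hBU hq).1.1
    rw [edist_eq_enorm_sub]
    simp only [hF, ContinuousLinearEquiv.symm_apply_apply, φ.left_inv (hBs hp).1,
      φ.left_inv (hBs hq).1, ← map_sub]
    refine h4.trans_eq ?_
    rw [← ofReal_norm, ← ofReal_norm, ← hT]
    rfl
  have hGB : (fun y ↦ φ.symm (T.symm y)) '' (F '' B) = B := by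
    rw [image_image]
    ext p
    constructor
    · rintro ⟨q, hq, rfl⟩
      simpa [hF, φ.left_inv (hBs hq).1] using hq
    · intro hp
      exact ⟨p, hp, by simp [hF, φ.left_inv (hBs hp).1]⟩
  have h5 := euclideanHausdorffMeasure_image_le_of_lipschitzOnWith hlipF k
  have h6 := euclideanHausdorffMeasure_image_le_of_lipschitzOnWith hlipG k
  rw [hGB] at h6
  have hmem : ∀ z ∈ coordSet j x₀ B, coordJac j x₀ (φ.symm (j z)) < r * coordJac j x₀ x ∧
      coordJac j x₀ x < r * coordJac j x₀ (φ.symm (j z)) := fun z hz ↦ (hBU hz.2).2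
  have hr0 : (0 : ℝ) ≤ r := by linarith
  constructor
  · calc μHE[k] B ≤ ENNReal.ofReal r ^ k * (ENNReal.ofReal (coordJac j x₀ x) *
        volume (coordSet j x₀ B)) := by rw [← hμF]; exact h6
      _ ≤ ENNReal.ofReal r ^ k * (ENNReal.ofReal r * coordMeasure j x₀ B) := by
        refine mul_le_mul' le_rfl ?_
        rw [coordMeasure_apply j x₀ hB, ← lintegral_const_mul' _ _ ENNReal.ofReal_ne_top,
          ← setLIntegral_const]
        refine setLIntegral_mono' (measurableSet_coordSet j x₀ hB) fun z hz ↦ ?_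
        rw [← ENNReal.ofReal_mul hr0]
        exact ENNReal.ofReal_le_ofReal (hmem z hz).2.le
      _ = ENNReal.ofReal r ^ (k + 1) * coordMeasure j x₀ B := by rw [pow_succ, mul_assoc]
      _ ≤ _ := by gcongr
  · calc coordMeasure j x₀ B ≤ ENNReal.ofReal r * (ENNReal.ofReal (coordJac j x₀ x) *
            volume (coordSet j x₀ B)) := by
          rw [coordMeasure_apply j x₀ hB, ← setLIntegral_const,
            ← lintegral_const_mul' _ _ ENNReal.ofReal_ne_top]
          refine setLIntegral_mono' (measurableSet_coordSet j x₀ hB) fun z hz ↦ ?_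
          rw [← ENNReal.ofReal_mul hr0]
          exact ENNReal.ofReal_le_ofReal (hmem z hz).1.le
      _ ≤ ENNReal.ofReal r * (ENNReal.ofReal r ^ k * μHE[k] B) := by
        rw [← hμF]; gcongr; exact h5
      _ = ENNReal.ofReal r ^ (k + 1) * μHE[k] B := by rw [pow_succ]; ring
      _ ≤ _ := by gcongr

/-- The Euclidean Hausdorff measure of the Riemannian distance, on a coordinate subspace of the
chart at `x₀`, is given by the Riemannian area element. -/
theorem euclideanHausdorffMeasure_eq_coordMeasure [SecondCountableTopology M] {k : ℕ}
    (j : EuclideanSpace ℝ (Fin k) →ₗᵢ[ℝ] EuclideanSpace ℝ (Fin d)) {x₀ : M} {B : Set M}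
    (hBs : B ⊆ (extChartAt (𝓡∂ d) x₀).source ∩ extChartAt (𝓡∂ d) x₀ ⁻¹' range j)
    (hB : MeasurableSet B) : μHE[k] B = coordMeasure j x₀ B := by
  refine le_antisymm ?_ ?_
  · refine measure_le_of_forall_one_lt_exists_nhds_le_mul (fun x hx c hc ↦ ?_) hBs hB
    obtain ⟨U, hU, h⟩ := exists_nhds_euclideanHausdorffMeasure j hx.1 hc
    exact ⟨U, hU, fun B h1 h2 h3 ↦ (h B h1 h2 h3).1⟩
  · refine measure_le_of_forall_one_lt_exists_nhds_le_mul (fun x hx c hc ↦ ?_) hBs hB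
    obtain ⟨U, hU, h⟩ := exists_nhds_euclideanHausdorffMeasure j hx.1 hc
    exact ⟨U, hU, fun B h1 h2 h3 ↦ (h B h1 h2 h3).2⟩

end MeasureFormula

set_option linter.unusedSectionVars false

/-! ### Boundary, normal component and divergence under change of chart -/

section Invariance

variable {d : ℕ} [NeZero d] {M : Type*} [EMetricSpace M]
  [ChartedSpace (EuclideanHalfSpace d) M] [IsManifold (𝓡∂ d) ∞ M]

/-- Being interior is defined by the chart at the point itself; invariance under smooth coordinate
changes lets any chart decide it. -/
lemma isInteriorPoint_iff_extChartAt_pos {x₀ x : M}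
    (hx : x ∈ (extChartAt (𝓡∂ d) x₀).source) :
    (𝓡∂ d).IsInteriorPoint x ↔ 0 < extChartAt (𝓡∂ d) x₀ x 0 := by
  rw [extChartAt_source] at hx
  rw [ModelWithCorners.isInteriorPoint_iff_of_mem_atlas (n := ∞) (by simp)
    (chart_mem_atlas _ x₀) hx]
  have h : extChartAt (𝓡∂ d) x₀ x ∈ interior (range (𝓡∂ d)) ↔
      0 < extChartAt (𝓡∂ d) x₀ x 0 := by
    rw [interior_range_modelWithCornersEuclideanHalfSpace]; rfl
  rw [← h]
  exact ⟨fun h1 ↦ OpenPartialHomeomorph.interior_extend_target_subset_interior_range _ h1,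
    fun h1 ↦ (chartAt _ x₀).mem_interior_extend_target ((chartAt _ x₀).map_source hx) h1⟩

lemma extChartAt_zero_nonneg {x₀ x : M} (hx : x ∈ (extChartAt (𝓡∂ d) x₀).source) :
    0 ≤ extChartAt (𝓡∂ d) x₀ x 0 := by
  have h : extChartAt (𝓡∂ d) x₀ x ∈ range (𝓡∂ d) :=
    extChartAt_target_subset_range x₀ ((extChartAt (𝓡∂ d) x₀).map_source hx)
  rwa [range_modelWithCornersEuclideanHalfSpace] at h

lemma isBoundaryPoint_iff_extChartAt_eq_zero {x₀ x : M}
    (hx : x ∈ (extChartAt (𝓡∂ d) x₀).source) :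
    (𝓡∂ d).IsBoundaryPoint x ↔ extChartAt (𝓡∂ d) x₀ x 0 = 0 := by
  rw [ModelWithCorners.isBoundaryPoint_iff_not_isInteriorPoint,
    isInteriorPoint_iff_extChartAt_pos hx, not_lt]
  exact ⟨fun h ↦ le_antisymm h (extChartAt_zero_nonneg hx), fun h ↦ h.le⟩

lemma mdifferentiableAt_extChartAt_source {x₀ x : M}
    (hx : x ∈ (extChartAt (𝓡∂ d) x₀).source) :
    MDifferentiableAt (𝓡∂ d) 𝓘(ℝ, EuclideanSpace ℝ (Fin d)) (extChartAt (𝓡∂ d) x₀) x :=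
  mdifferentiableAt_extChartAt (by rwa [extChartAt_source] at hx)

/-- The derivative of a coordinate change. -/
lemma toCoord_symmCoord_eq_fderivWithin {x₀ x₁ x : M}
    (hx : x ∈ (extChartAt (𝓡∂ d) x₀).source) (hx₁ : x ∈ (extChartAt (𝓡∂ d) x₁).source)
    (v : EuclideanSpace ℝ (Fin d)) : toCoord x₀ x (symmCoord x₁ x v) =
      fderivWithin ℝ (extChartAt (𝓡∂ d) x₀ ∘ (extChartAt (𝓡∂ d) x₁).symm) (range (𝓡∂ d))
        (extChartAt (𝓡∂ d) x₁ x) v :=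
  mfderiv_symmCoord hx₁ (mdifferentiableAt_extChartAt_source hx) v

lemma contDiffWithinAt_transition {x₀ x₁ x : M}
    (hx : x ∈ (extChartAt (𝓡∂ d) x₀).source) (hx₁ : x ∈ (extChartAt (𝓡∂ d) x₁).source) :
    ContDiffWithinAt ℝ ∞ (extChartAt (𝓡∂ d) x₀ ∘ (extChartAt (𝓡∂ d) x₁).symm)
      (range (𝓡∂ d)) (extChartAt (𝓡∂ d) x₁ x) := by
  refine contDiffWithinAt_ext_coord_change x₀ x₁ ?_
  rw [PartialEquiv.trans_source]
  refine ⟨(extChartAt (𝓡∂ d) x₁).map_source hx₁, ?_⟩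
  rw [mem_preimage, PartialEquiv.left_inv _ hx₁]
  exact hx

/-- Written in the chart at `x₀`, the first coordinate of the chart at x is nonnegative and vanishes
at x. Its derivative is therefore nonnegative on inward directions and zero on tangential ones, so
it is a multiple of dy₀. This makes the outward normal, defined by the chart at x, computable in any
chart. -/
lemma exists_toCoord_symmCoord_zero_eq_mul {x₀ x : M} (hx : x ∈ (extChartAt (𝓡∂ d) x₀).source)
    (hb : (𝓡∂ d).IsBoundaryPoint x) :
    ∃ c : ℝ, 0 < c ∧ ∀ v : EuclideanSpace ℝ (Fin d), toCoord x x (symmCoord x₀ x v) 0 = c * v 0 := by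
  have hxx := mem_extChartAt_source (I := 𝓡∂ d) x
  set ℓ : EuclideanSpace ℝ (Fin d) →L[ℝ] ℝ :=
    (EuclideanSpace.proj (𝕜 := ℝ) (0 : Fin d)) ∘L
      ((toCoord x x : EuclideanSpace ℝ (Fin d) →L[ℝ] EuclideanSpace ℝ (Fin d)) ∘L
      (symmCoord x₀ x : EuclideanSpace ℝ (Fin d) →L[ℝ] EuclideanSpace ℝ (Fin d))) with hℓ
  have hℓv : ∀ v, ℓ v = toCoord x x (symmCoord x₀ x v) 0 := fun v ↦ rfl
  set F : EuclideanSpace ℝ (Fin d) → ℝ :=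
    fun y ↦ (extChartAt (𝓡∂ d) x ∘ (extChartAt (𝓡∂ d) x₀).symm) y 0 with hF
  set a := extChartAt (𝓡∂ d) x₀ x with ha
  have ha0 : a 0 = 0 := (isBoundaryPoint_iff_extChartAt_eq_zero hx).1 hb
  have hder : HasFDerivWithinAt F ℓ (range (𝓡∂ d)) a := by
    have h1 := ((contDiffWithinAt_transition hxx hx).differentiableWithinAt
      (by simp)).hasFDerivWithinAt
    have h2 := (EuclideanSpace.proj (𝕜 := ℝ) (0 : Fin d)).hasFDerivAt.comp_hasFDerivWithinAt a h1
    refine h2.congr_fderiv ?_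
    ext v
    rw [hℓv, toCoord_symmCoord_eq_fderivWithin hxx hx]
    rfl
  have hmin : IsLocalMinOn F (range (𝓡∂ d)) a := by
    have h0 : F a = 0 := by
      rw [hF, ha]
      simp only [Function.comp_apply, PartialEquiv.left_inv _ hx]
      exact (isBoundaryPoint_iff_extChartAt_eq_zero hxx).1 hb
    have h1 : ∀ᶠ y in 𝓝[range (𝓡∂ d)] a, (extChartAt (𝓡∂ d) x₀).symm y ∈
        (extChartAt (𝓡∂ d) x).source := by
      refine nhdsWithin_le_nhds ((continuousAt_extChartAt_symm''
        ((extChartAt (𝓡∂ d) x₀).map_source hx)).preimage_mem_nhds ?_)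
      rw [PartialEquiv.left_inv _ hx]
      exact extChartAt_source_mem_nhds x
    filter_upwards [h1] with y hy
    rw [h0]
    have := extChartAt_target_subset_range x ((extChartAt (𝓡∂ d) x).map_source hy)
    rwa [range_modelWithCornersEuclideanHalfSpace] at this
  have hpos : ∀ v : EuclideanSpace ℝ (Fin d), 0 ≤ v 0 → 0 ≤ ℓ v := by
    intro v hv
    refine hmin.hasFDerivWithinAt_nonneg hder ?_
    refine mem_posTangentConeAt_of_segment_subset ?_
    refine (𝓡∂ d).convex_range.segment_subset ?_ ?_
    · exact extChartAt_target_subset_range x₀ ((extChartAt (𝓡∂ d) x₀).map_source hx)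
    · rw [range_modelWithCornersEuclideanHalfSpace, mem_ofPred_eq, PiLp.add_apply, ha0, zero_add]
      exact hv
  have hzero : ∀ v : EuclideanSpace ℝ (Fin d), v 0 = 0 → ℓ v = 0 := fun v hv ↦ by
    refine le_antisymm ?_ (hpos v hv.ge)
    have := hpos (-v) (by simp [hv])
    rw [map_neg] at this
    linarith
  have hlin : ∀ v : EuclideanSpace ℝ (Fin d), ℓ v = ℓ (EuclideanSpace.single (0 : Fin d) (1 : ℝ)) * v 0 := by
    intro v
    have := hzero (v - v 0 • EuclideanSpace.single (0 : Fin d) (1 : ℝ)) (by simp)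
    rw [map_sub, map_smul, smul_eq_mul] at this
    linarith
  refine ⟨ℓ (EuclideanSpace.single (0 : Fin d) (1 : ℝ)), lt_of_le_of_ne (hpos _ (by simp)) ?_, fun v ↦ hlin v⟩
  -- The constant is not zero, since otherwise no tangent vector at x would have a nonzero first
  -- component in the chart at x.
  intro h0
  have h1 := hlin (toCoord x₀ x (symmCoord x x (EuclideanSpace.single (0 : Fin d) (1 : ℝ))))
  rw [← h0, zero_mul, hℓv, symmCoord_toCoord hx, toCoord_symmCoord hxx] at h1
  simp at h1

variable [RiemannianBundle (fun x : M ↦ TangentSpace (𝓡∂ d) x)]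

lemma inner_grad (f : M → ℝ) (x : M) (v : TangentSpace (𝓡∂ d) x) :
    inner ℝ (grad (d := d) f x) v = mfderiv (𝓡∂ d) 𝓘(ℝ, ℝ) f x v := by
  have : FiniteDimensional ℝ (TangentSpace (𝓡∂ d) x) :=
    inferInstanceAs (FiniteDimensional ℝ (EuclideanSpace ℝ (Fin d)))
  have : CompleteSpace (TangentSpace (𝓡∂ d) x) := FiniteDimensional.complete ℝ _
  exact InnerProductSpace.toDual_symm_apply

/-- The coefficient `X₀` of a vector field is its derivative of the first coordinate. -/
lemma inner_grad_extChartAt_zero {x₀ x : M} (hx : x ∈ (extChartAt (𝓡∂ d) x₀).source)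
    (v : TangentSpace (𝓡∂ d) x) :
    inner ℝ (grad (d := d) (fun y : M ↦ extChartAt (𝓡∂ d) x₀ y 0) x) v = toCoord x₀ x v 0 := by
  rw [inner_grad]
  have h1 := mdifferentiableAt_extChartAt_source hx
  have h2 : HasMFDerivAt 𝓘(ℝ, EuclideanSpace ℝ (Fin d)) 𝓘(ℝ, ℝ)
      (fun y : EuclideanSpace ℝ (Fin d) ↦ y 0) (extChartAt (𝓡∂ d) x₀ x)
      (EuclideanSpace.proj 0 : EuclideanSpace ℝ (Fin d) →L[ℝ] ℝ) :=
    (EuclideanSpace.proj (𝕜 := ℝ) (0 : Fin d)).hasFDerivAt.hasMFDerivAt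
  have h3 := (HasMFDerivAt.comp x h2 h1.hasMFDerivAt).mfderiv
  exact congrArg (fun L : EuclideanSpace ℝ (Fin d) →L[ℝ] ℝ ↦ L v) h3

/-- If the outer normal derivative is `-1`, the gradient has coefficient `|∇x₀|` in the first
coordinate of any chart. -/
lemma toCoord_grad_zero_of_normalDeriv {x₀ x : M} (hx : x ∈ (extChartAt (𝓡∂ d) x₀).source)
    (hb : (𝓡∂ d).IsBoundaryPoint x) {ρ : M → ℝ} (hρ : normalDeriv (d := d) ρ x = -1) :
    toCoord x₀ x (grad (d := d) ρ x) 0 = ‖grad (d := d) (fun y : M ↦ extChartAt (𝓡∂ d) x₀ y 0) x‖ := by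
  obtain ⟨c, hc, h⟩ := exists_toCoord_symmCoord_zero_eq_mul hx hb
  have hxx := mem_extChartAt_source (I := 𝓡∂ d) x
  set n₀ := grad (d := d) (fun y : M ↦ extChartAt (𝓡∂ d) x₀ y 0) x with hn₀
  set n := grad (d := d) (fun y : M ↦ extChartAt (𝓡∂ d) x y 0) x with hn
  have h1 : n = c • n₀ := by
    refine ext_inner_right ℝ fun v ↦ ?_
    rw [real_inner_smul_left, inner_grad_extChartAt_zero hx, inner_grad_extChartAt_zero hxx,
      ← h, symmCoord_toCoord hx]
  have h2 : n₀ ≠ 0 := by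
    intro h0
    have := inner_grad_extChartAt_zero hx (symmCoord x₀ x (EuclideanSpace.single (0 : Fin d) (1 : ℝ)))
    rw [← hn₀, h0, inner_zero_left, toCoord_symmCoord hx] at this
    simp at this
  have h3 : 0 < ‖n₀‖ := norm_pos_iff.2 h2
  rw [normalDeriv, ← inner_grad, outwardNormal, ← hn, h1, inner_neg_right, neg_inj, norm_smul,
    Real.norm_eq_abs, abs_of_pos hc, smul_smul, real_inner_smul_right, real_inner_comm,
    inner_grad_extChartAt_zero hx] at hρ
  field_simp at hρ
  exact hρ

/-- In coordinates ∇x₀ represents v ↦ v₀, so the Gram determinant identity gives the area density of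
the boundary in terms of √g. -/
lemma coordJac_boundaryIncl {n : ℕ} {M : Type*} [EMetricSpace M]
    [ChartedSpace (EuclideanHalfSpace (n + 1)) M] [IsManifold (𝓡∂ (n + 1)) ∞ M]
    [RiemannianBundle (fun x : M ↦ TangentSpace (𝓡∂ (n + 1)) x)] {x₀ x : M}
    (hx : x ∈ (extChartAt (𝓡∂ (n + 1)) x₀).source) : coordJac (boundaryIncl n) x₀ x =
      coordJac (LinearIsometry.id : EuclideanSpace ℝ (Fin (n + 1)) →ₗᵢ[ℝ]
      EuclideanSpace ℝ (Fin (n + 1))) x₀ x *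
        ‖grad (d := n + 1) (fun y : M ↦ extChartAt (𝓡∂ (n + 1)) x₀ y 0) x‖ := by
  have h := normDet_comp_boundaryIncl (V := TangentSpace (𝓡∂ (n + 1)) x) (coordEquiv hx)
    (u := grad (d := n + 1) (fun y : M ↦ extChartAt (𝓡∂ (n + 1)) x₀ y 0) x) (fun v ↦ by
      rw [coordEquiv_apply, inner_grad_extChartAt_zero hx, toCoord_symmCoord hx])
  exact h

/-- Change of chart for the square root of the determinant of the metric. -/
lemma coordJac_id_eq {x₀ x₁ x : M}
    (hx : x ∈ (extChartAt (𝓡∂ d) x₀).source) :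
    coordJac (LinearIsometry.id : EuclideanSpace ℝ (Fin d) →ₗᵢ[ℝ] EuclideanSpace ℝ (Fin d)) x₁ x =
      coordJac (LinearIsometry.id : EuclideanSpace ℝ (Fin d) →ₗᵢ[ℝ] EuclideanSpace ℝ (Fin d)) x₀ x *
      |LinearMap.det (((toCoord x₀ x : EuclideanSpace ℝ (Fin d) →L[ℝ] EuclideanSpace ℝ (Fin d)) ∘L
        (symmCoord x₁ x : EuclideanSpace ℝ (Fin d) →L[ℝ] EuclideanSpace ℝ (Fin d)) :
        EuclideanSpace ℝ (Fin d) →L[ℝ] EuclideanSpace ℝ (Fin d)) :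
        EuclideanSpace ℝ (Fin d) →ₗ[ℝ] EuclideanSpace ℝ (Fin d))| := by
  have h := LinearMap.normDet_comp_of_finrank_eq (𝕜 := ℝ) (U := EuclideanSpace ℝ (Fin d))
    (V := EuclideanSpace ℝ (Fin d)) (W := TangentSpace (𝓡∂ d) x)
    ((toCoord x₀ x).toLinearMap ∘ₗ (symmCoord x₁ x).toLinearMap)
    ((symmCoord x₀ x).toLinearMap) rfl
  rw [LinearMap.normDet_eq_abs_det] at h
  refine Eq.trans ?_ h
  rw [coordJac]
  congr 1
  ext1 v
  exact (symmCoord_toCoord hx _).symm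

/-- The divergence may be computed in any chart. -/
lemma sqrtDetMetric_mul_divergence {x₀ x : M} (hx : x ∈ (extChartAt (𝓡∂ d) x₀).source)
    (hi : (𝓡∂ d).IsInteriorPoint x) {X : ∀ x : M, TangentSpace (𝓡∂ d) x}
    (hX : DifferentiableAt ℝ (fun y ↦ sqrtDetMetric x₀ y • chartField X x₀ y)
      (extChartAt (𝓡∂ d) x₀ x)) :
    sqrtDetMetric x₀ (extChartAt (𝓡∂ d) x₀ x) * divergence X x =
      LinearMap.trace ℝ _ (fderiv ℝ (fun y ↦ sqrtDetMetric x₀ y • chartField X x₀ y)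
        (extChartAt (𝓡∂ d) x₀ x)).toLinearMap := by
  have hxx := mem_extChartAt_source (I := 𝓡∂ d) x
  set φ := extChartAt (𝓡∂ d) x₀ with hφ
  set φ' := extChartAt (𝓡∂ d) x with hφ'
  set a := φ' x with ha
  have hrange : range (𝓡∂ d) ∈ 𝓝 a := range_mem_nhds_isInteriorPoint hi
  have hψ : ContDiffAt ℝ ∞ (φ ∘ φ'.symm) a :=
    (contDiffWithinAt_transition hx hxx).contDiffAt hrange
  have hψa : (φ ∘ φ'.symm) a = φ x := by
    rw [Function.comp_apply, ha, φ'.left_inv hxx]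
  have hev : ∀ᶠ z in 𝓝 a, z ∈ φ'.target ∧ φ'.symm z ∈ φ.source ∧
      fderiv ℝ (φ ∘ φ'.symm) z =
        ((toCoord x₀ (φ'.symm z) : EuclideanSpace ℝ (Fin d) →L[ℝ] EuclideanSpace ℝ (Fin d)) ∘L
        (symmCoord x (φ'.symm z) : EuclideanSpace ℝ (Fin d) →L[ℝ] EuclideanSpace ℝ (Fin d))) := by
    have h1 : φ'.target ∈ 𝓝 a := by
      have := extChartAt_target_mem_nhdsWithin (I := 𝓡∂ d) x
      rwa [nhdsWithin_eq_nhds.2 hrange] at this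
    have h2 : φ'.symm ⁻¹' φ.source ∈ 𝓝 a := by
      refine (continuousAt_extChartAt_symm'' (φ'.map_source hxx)).preimage_mem_nhds ?_
      rw [φ'.left_inv hxx]
      exact (isOpen_extChartAt_source x₀).mem_nhds hx
    filter_upwards [h1, h2, eventually_mem_nhds_iff.2 hrange] with z hz1 hz2 hz3
    refine ⟨hz1, hz2, ?_⟩
    ext1 v
    have h3 := toCoord_symmCoord_eq_fderivWithin hz2 (φ'.map_target hz1) v
    rw [← hφ', φ'.right_inv hz1, fderivWithin_of_mem_nhds hz3] at h3
    exact h3.symm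
  set A : EuclideanSpace ℝ (Fin d) ≃L[ℝ] EuclideanSpace ℝ (Fin d) :=
    ((coordEquiv hxx).trans (coordEquiv hx).symm).toContinuousLinearEquiv with hA
  have hfA : fderiv ℝ (φ ∘ φ'.symm) a = A := by
    rw [hev.self_of_nhds.2.2, φ'.left_inv hxx]
    rfl
  have hdens := fun z (hz : z ∈ φ'.target) (hz' : φ'.symm z ∈ φ.source) ↦
    coordJac_id_eq (x₁ := x) hz'
  have key := trace_fderiv_of_vectorDensity (V := fun y ↦ sqrtDetMetric x₀ y • chartField X x₀ y)
    (V' := fun y ↦ sqrtDetMetric x y • chartField X x y) (contDiffAt_infty.1 hψ 2) A hfA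
    (by rwa [hψa]) (by
      filter_upwards [hev] with z ⟨hz1, hz2, hz3⟩
      rw [hz3, map_smul, sqrtDetMetric_eq_coordJac hz1, Function.comp_apply,
        sqrtDetMetric_eq_coordJac (φ.map_source hz2), φ.left_inv hz2, hdens z hz1 hz2, smul_smul,
        mul_comm]
      congr 1
      have h4 : chartField X x₀ (φ (φ'.symm z)) =
          (toCoord x₀ (φ'.symm z) (X (φ'.symm z)) : EuclideanSpace ℝ (Fin d)) := by
        -- The fields are evaluated at `φ.symm (φ p)` and at p, equal points with formally different
        -- tangent spaces.
        have h5 : ∀ q, q = φ'.symm z → (toCoord x₀ q (X q) : EuclideanSpace ℝ (Fin d)) =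
            toCoord x₀ (φ'.symm z) (X (φ'.symm z)) := by rintro q rfl; rfl
        exact h5 _ (φ.left_inv hz2)
      rw [h4]
      exact congrArg (toCoord x₀ (φ'.symm z)) (symmCoord_toCoord (φ'.map_target hz1) _))
  rw [hψa] at key
  obtain ⟨hd, htr⟩ := key
  have hdiv : divergence X x = (sqrtDetMetric x a)⁻¹ * LinearMap.trace ℝ _
      (fderiv ℝ (fun y ↦ sqrtDetMetric x y • chartField X x y) a).toLinearMap := by
    rw [divergence, trace_eq_sum_apply_single]
    congr 1
    refine Finset.sum_congr rfl fun i _ ↦ ?_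
    rw [fderivWithin_of_mem_nhds hrange]
    have := ((EuclideanSpace.proj (𝕜 := ℝ) i).hasFDerivAt.comp a hd.hasFDerivAt).fderiv
    exact congrArg (fun L : EuclideanSpace ℝ (Fin d) →L[ℝ] ℝ ↦ L (EuclideanSpace.single i 1)) this
  have hg : sqrtDetMetric x a = sqrtDetMetric x₀ (φ x) *
      |LinearMap.det (A : EuclideanSpace ℝ (Fin d) →ₗ[ℝ] EuclideanSpace ℝ (Fin d))| := by
    have h6 := hdens a hev.self_of_nhds.1 hev.self_of_nhds.2.1
    rw [sqrtDetMetric_eq_coordJac hev.self_of_nhds.1, h6,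
      sqrtDetMetric_eq_coordJac (φ.map_source hx), ← hev.self_of_nhds.2.2, hfA, φ'.left_inv hxx,
      φ.left_inv hx]
    rfl
  have h0 : 0 < sqrtDetMetric x₀ (φ x) := by
    rw [sqrtDetMetric_eq_coordJac (φ.map_source hx)]
    exact coordJac_pos _ (φ.map_target (φ.map_source hx))
  have h1 : 0 < |LinearMap.det
      (A : EuclideanSpace ℝ (Fin d) →ₗ[ℝ] EuclideanSpace ℝ (Fin d))| :=
    abs_pos.2 (LinearEquiv.isUnit_det' A.toLinearEquiv).ne_zero
  rw [hdiv, htr, hg]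
  field_simp

end Invariance

/-! ### Integrals over a chart domain as Euclidean integrals -/

section Transfer

variable {d : ℕ} [NeZero d] {M : Type*} [EMetricSpace M]
  [ChartedSpace (EuclideanHalfSpace d) M] [MeasurableSpace M] [BorelSpace M]

/-- The part of the domain of the chart at `x₀` whose coordinates lie in a subspace. -/
def chartSlice {k : ℕ} (j : EuclideanSpace ℝ (Fin k) →ₗᵢ[ℝ] EuclideanSpace ℝ (Fin d)) (x₀ : M) :
    Set M :=
  (extChartAt (𝓡∂ d) x₀).source ∩ extChartAt (𝓡∂ d) x₀ ⁻¹' range j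

lemma measurableSet_chartSlice {k : ℕ}
    (j : EuclideanSpace ℝ (Fin k) →ₗᵢ[ℝ] EuclideanSpace ℝ (Fin d)) (x₀ : M) :
    MeasurableSet (chartSlice j x₀) :=
  measurableSet_inter_preimage_of_continuousOn (continuousOn_extChartAt x₀)
    (isOpen_extChartAt_source x₀).measurableSet
    (j.isometry.isClosedEmbedding.isClosed_range.measurableSet)

lemma measurableSet_preimage_target {k : ℕ}
    (j : EuclideanSpace ℝ (Fin k) →ₗᵢ[ℝ] EuclideanSpace ℝ (Fin d)) (x₀ : M) :
    MeasurableSet (j ⁻¹' (extChartAt (𝓡∂ d) x₀).target) :=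
  (measurableSet_extChartAt_target x₀).preimage j.continuous.measurable

/-- The inverse of the chart at `x₀`, on a coordinate subspace. -/
def sliceParam {k : ℕ} (j : EuclideanSpace ℝ (Fin k) →ₗᵢ[ℝ] EuclideanSpace ℝ (Fin d)) (x₀ : M) :
    j ⁻¹' (extChartAt (𝓡∂ d) x₀).target → M :=
  fun z ↦ (extChartAt (𝓡∂ d) x₀).symm (j z)

lemma continuous_sliceParam {k : ℕ}
    (j : EuclideanSpace ℝ (Fin k) →ₗᵢ[ℝ] EuclideanSpace ℝ (Fin d)) (x₀ : M) :
    Continuous (sliceParam j x₀) :=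
  continuousOn_iff_continuous_domRestrict.1 (continuousOn_extChartAt_symm_comp j x₀)

lemma sliceParam_mem {k : ℕ}
    (j : EuclideanSpace ℝ (Fin k) →ₗᵢ[ℝ] EuclideanSpace ℝ (Fin d)) (x₀ : M)
    (z : j ⁻¹' (extChartAt (𝓡∂ d) x₀).target) :
    sliceParam j x₀ z ∈ chartSlice j x₀ := by
  refine ⟨(extChartAt (𝓡∂ d) x₀).map_target z.2, ?_⟩
  rw [sliceParam, mem_preimage, (extChartAt (𝓡∂ d) x₀).right_inv z.2]
  exact mem_range_self _

variable [SecondCountableTopology M]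

/-- An injective map continuous on a Borel subset of a Polish space has Borel images of Borel sets
(Lusin–Souslin). -/
lemma measurableEmbedding_sliceParam {k : ℕ}
    (j : EuclideanSpace ℝ (Fin k) →ₗᵢ[ℝ] EuclideanSpace ℝ (Fin d)) (x₀ : M) :
    MeasurableEmbedding (sliceParam j x₀) :=
  (continuousOn_extChartAt_symm_comp j x₀).measurableEmbedding
    (measurableSet_preimage_target j x₀) fun _ hz _ hz' h ↦
      j.injective ((extChartAt (𝓡∂ d) x₀).symm.injOn hz hz' h)

variable [IsManifold (𝓡∂ d) ∞ M] [RiemannianBundle (fun x : M ↦ TangentSpace (𝓡∂ d) x)]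
  [IsContMDiffRiemannianBundle (𝓡∂ d) ∞ (EuclideanSpace ℝ (Fin d))
      (fun x : M ↦ TangentSpace (𝓡∂ d) x)]

lemma continuous_coordJac_sliceParam {k : ℕ}
    (j : EuclideanSpace ℝ (Fin k) →ₗᵢ[ℝ] EuclideanSpace ℝ (Fin d)) (x₀ : M) :
    Continuous fun z ↦ coordJac j x₀ (sliceParam j x₀ z) :=
  (contMDiffOn_coordJac j x₀).continuousOn.comp_continuous (continuous_sliceParam j x₀)
    fun z ↦ (sliceParam_mem j x₀ z).1

variable [IsRiemannianManifold (𝓡∂ d) M]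

/-- The area formula restated as an image measure under a measurable embedding; in this form it
transports integrals, integrability and almost-everywhere statements. -/
lemma restrict_euclideanHausdorffMeasure_chartSlice {k : ℕ}
    (j : EuclideanSpace ℝ (Fin k) →ₗᵢ[ℝ] EuclideanSpace ℝ (Fin d)) (x₀ : M) :
    (μHE[k] : Measure M).restrict (chartSlice j x₀) =
      (((volume : Measure (EuclideanSpace ℝ (Fin k))).comap Subtype.val).withDensity fun z ↦
        ENNReal.ofReal (coordJac j x₀ (sliceParam j x₀ z))).map (sliceParam j x₀) := by
  ext B hB
  have h1 := euclideanHausdorffMeasure_eq_coordMeasure j (x₀ := x₀) (B := B ∩ chartSlice j x₀)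
    inter_subset_right (hB.inter (measurableSet_chartSlice j x₀))
  rw [Measure.restrict_apply hB, h1,
    coordMeasure_apply _ _ (hB.inter (measurableSet_chartSlice j x₀)),
    (measurableEmbedding_sliceParam j x₀).map_apply,
    withDensity_apply _ ((measurableEmbedding_sliceParam j x₀).measurable hB)]
  have h2 := setLIntegral_subtype (μ := volume) (measurableSet_preimage_target j x₀)
    (sliceParam j x₀ ⁻¹' B)
    (fun z ↦ ENNReal.ofReal (coordJac j x₀ ((extChartAt (𝓡∂ d) x₀).symm (j z))))
  refine Eq.trans ?_ h2.symm
  congr 2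
  ext z
  constructor
  · rintro ⟨hz, hzB⟩
    exact ⟨⟨z, hz⟩, hzB.1, rfl⟩
  · rintro ⟨z, hz, rfl⟩
    exact ⟨z.2, hz, sliceParam_mem j x₀ z⟩

lemma setIntegral_chartSlice {k : ℕ}
    (j : EuclideanSpace ℝ (Fin k) →ₗᵢ[ℝ] EuclideanSpace ℝ (Fin d)) (x₀ : M) (F : M → ℝ) :
    ∫ p in chartSlice j x₀, F p ∂μHE[k] = ∫ z in j ⁻¹' (extChartAt (𝓡∂ d) x₀).target,
      coordJac j x₀ ((extChartAt (𝓡∂ d) x₀).symm (j z)) *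
        F ((extChartAt (𝓡∂ d) x₀).symm (j z)) := by
  have h1 := (continuous_coordJac_sliceParam j x₀).measurable.ennreal_ofReal
  rw [restrict_euclideanHausdorffMeasure_chartSlice,
    (measurableEmbedding_sliceParam j x₀).integral_map,
    integral_withDensity_eq_integral_toReal_smul h1 (by simp)]
  rw [← integral_subtype_comap (measurableSet_preimage_target j x₀)]
  refine integral_congr_ae (Eventually.of_forall fun z ↦ ?_)
  simp only [smul_eq_mul]
  rw [ENNReal.toReal_ofReal (coordJac_pos j (sliceParam_mem j x₀ z).1).le]
  rfl

lemma integrableOn_chartSlice_iff {k : ℕ}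
    (j : EuclideanSpace ℝ (Fin k) →ₗᵢ[ℝ] EuclideanSpace ℝ (Fin d)) (x₀ : M) (F : M → ℝ) :
    IntegrableOn F (chartSlice j x₀) μHE[k] ↔ IntegrableOn (fun z ↦
      coordJac j x₀ ((extChartAt (𝓡∂ d) x₀).symm (j z)) *
        F ((extChartAt (𝓡∂ d) x₀).symm (j z))) (j ⁻¹' (extChartAt (𝓡∂ d) x₀).target) := by
  have h1 := (continuous_coordJac_sliceParam j x₀).measurable.ennreal_ofReal
  rw [IntegrableOn, restrict_euclideanHausdorffMeasure_chartSlice,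
    (measurableEmbedding_sliceParam j x₀).integrable_map_iff,
    integrable_withDensity_iff_integrable_smul' h1 (by simp),
    integrableOn_iff_comap_subtypeVal (measurableSet_preimage_target j x₀)]
  refine integrable_congr (Eventually.of_forall fun z ↦ ?_)
  simp only [smul_eq_mul, Function.comp_apply]
  rw [ENNReal.toReal_ofReal (coordJac_pos j (sliceParam_mem j x₀ z).1).le]
  rfl

lemma ae_restrict_chartSlice {k : ℕ}
    (j : EuclideanSpace ℝ (Fin k) →ₗᵢ[ℝ] EuclideanSpace ℝ (Fin d)) (x₀ : M) {P : M → Prop}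
    (h : ∀ᵐ z ∂volume.restrict (j ⁻¹' (extChartAt (𝓡∂ d) x₀).target),
      P ((extChartAt (𝓡∂ d) x₀).symm (j z))) :
    ∀ᵐ p ∂(μHE[k] : Measure M).restrict (chartSlice j x₀), P p := by
  rw [restrict_euclideanHausdorffMeasure_chartSlice,
    (measurableEmbedding_sliceParam j x₀).ae_map_iff]
  refine (withDensity_absolutelyContinuous _ _).ae_le ?_
  rwa [← map_comap_subtype_coe (measurableSet_preimage_target j x₀),
    (MeasurableEmbedding.subtype_coe (measurableSet_preimage_target j x₀)).ae_map_iff] at h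

end Transfer

/-! ### Products and extensions of Lipschitz functions -/

section Lipschitz

variable {X F : Type*} [PseudoMetricSpace X] [NormedAddCommGroup F] [NormedSpace ℝ F]

lemma exists_lipschitzOnWith_smul {a : X → ℝ} {g : X → F} {s : Set X} {K L : ℝ≥0} {A B : ℝ}
    (ha : LipschitzOnWith K a s) (hg : LipschitzOnWith L g s) (hA : ∀ x ∈ s, |a x| ≤ A)
    (hB : ∀ x ∈ s, ‖g x‖ ≤ B) : ∃ K', LipschitzOnWith K' (fun x ↦ a x • g x) s := by
  refine ⟨(A * L + B * K).toNNReal, LipschitzOnWith.of_dist_le_mul fun x hx y hy ↦ ?_⟩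
  refine le_trans ?_ (mul_le_mul_of_nonneg_right (Real.le_coe_toNNReal _) dist_nonneg)
  have h1 := ha.dist_le_mul x hx y hy
  have h2 := hg.dist_le_mul x hx y hy
  rw [dist_eq_norm] at h1 h2 ⊢
  have hA0 : 0 ≤ A := (abs_nonneg _).trans (hA x hx)
  calc ‖a x • g x - a y • g y‖ = ‖a x • (g x - g y) + (a x - a y) • g y‖ := by
        rw [smul_sub, sub_smul]; abel_nf
    _ ≤ |a x| * ‖g x - g y‖ + ‖a x - a y‖ * ‖g y‖ := by
        refine (norm_add_le _ _).trans_eq ?_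
        rw [norm_smul, norm_smul, Real.norm_eq_abs]
    _ ≤ A * (L * dist x y) + (K * dist x y) * B := by
        gcongr
        · exact hA x hx
        · exact hB y hy
    _ = _ := by ring

lemma exists_lipschitzOnWith_smul_of_isCompact {a : X → ℝ} {g : X → F} {s : Set X} {K L : ℝ≥0}
    (hs : IsCompact s) (ha : LipschitzOnWith K a s) (hg : LipschitzOnWith L g s) :
    ∃ K', LipschitzOnWith K' (fun x ↦ a x • g x) s := by
  obtain ⟨A, hA⟩ := hs.exists_bound_of_continuousOn ha.continuousOn
  obtain ⟨B, hB⟩ := hs.exists_bound_of_continuousOn hg.continuousOn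
  exact exists_lipschitzOnWith_smul ha hg hA hB

/-- Extension by zero of a Lipschitz function that vanishes near the boundary of a ball. -/
lemma exists_lipschitzOnWith_indicator {g : X → F} {c : X} {H : Set X} {r R B : ℝ} (hr : r < R)
    {K : ℝ≥0} (hg : LipschitzOnWith K g (Metric.closedBall c R ∩ H))
    (hB : ∀ x ∈ Metric.closedBall c R ∩ H, ‖g x‖ ≤ B)
    (h0 : ∀ x ∈ Metric.closedBall c R ∩ H, r < dist x c → g x = 0) :
    ∃ K', LipschitzOnWith K' ((Metric.closedBall c R).indicator g) H := by
  -- Where `g x` is nonzero, x lies within r of the centre, hence at distance at least R - r from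
  -- any point outside the ball. This bounds the jump.
  have key : ∀ x ∈ H, ∀ y ∈ H, x ∈ Metric.closedBall c R → y ∉ Metric.closedBall c R →
      ‖g x‖ ≤ B / (R - r) * dist x y := by
    intro x hx y hy hxR hyR
    have hB0 : 0 ≤ B := (norm_nonneg _).trans (hB x ⟨hxR, hx⟩)
    have hRr : 0 < R - r := by linarith
    by_cases h : r < dist x c
    · rw [h0 x ⟨hxR, hx⟩ h, norm_zero]; positivity
    · rw [Metric.mem_closedBall, not_le] at hyR
      have h1 : R - r ≤ dist x y := by
        have := dist_triangle y x c
        rw [dist_comm y x] at this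
        linarith
      calc ‖g x‖ ≤ B := hB x ⟨hxR, hx⟩
        _ = B / (R - r) * (R - r) := by field_simp
        _ ≤ _ := by gcongr
  refine ⟨max K (B / (R - r)).toNNReal, LipschitzOnWith.of_dist_le_mul fun x hx y hy ↦ ?_⟩
  have hm1 : (K : ℝ) ≤ (max K (B / (R - r)).toNNReal : ℝ≥0) := by exact_mod_cast le_max_left _ _
  have hm2 : B / (R - r) ≤ (max K (B / (R - r)).toNNReal : ℝ≥0) :=
    (Real.le_coe_toNNReal _).trans (by exact_mod_cast le_max_right _ _)
  by_cases hxR : x ∈ Metric.closedBall c R <;> by_cases hyR : y ∈ Metric.closedBall c R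
  · rw [indicator_of_mem hxR, indicator_of_mem hyR]
    exact (hg.dist_le_mul x ⟨hxR, hx⟩ y ⟨hyR, hy⟩).trans (by gcongr)
  · rw [indicator_of_mem hxR, indicator_of_notMem hyR, dist_zero_right]
    exact (key x hx y hy hxR hyR).trans (by gcongr)
  · rw [indicator_of_notMem hxR, indicator_of_mem hyR, dist_zero_left, dist_comm]
    exact (key y hy x hx hyR hxR).trans (by gcongr)
  · rw [indicator_of_notMem hxR, indicator_of_notMem hyR, dist_self]
    positivity

end Lipschitz

set_option linter.unusedSectionVars false

/-! ### Coordinate balls -/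

section ChartBall

variable {d : ℕ} [NeZero d] {M : Type*} [EMetricSpace M]
  [ChartedSpace (EuclideanHalfSpace d) M]

/-- The ball of radius `R` about `x₀` in the chart at `x₀`. -/
def chartBall (x₀ : M) (R : ℝ) : Set M :=
  (extChartAt (𝓡∂ d) x₀).source ∩
    extChartAt (𝓡∂ d) x₀ ⁻¹' Metric.ball (extChartAt (𝓡∂ d) x₀ x₀) R

/-- The closed half ball of radius `R` about `x₀` in the coordinates of the chart at `x₀`. -/
def coordBall (x₀ : M) (R : ℝ) : Set (EuclideanSpace ℝ (Fin d)) :=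
  Metric.closedBall (extChartAt (𝓡∂ d) x₀ x₀) R ∩ range (𝓡∂ d)

lemma isOpen_chartBall (x₀ : M) (R : ℝ) : IsOpen (chartBall (d := d) x₀ R) :=
  (continuousOn_extChartAt x₀).isOpen_inter_preimage (isOpen_extChartAt_source x₀)
    Metric.isOpen_ball

lemma chartBall_mem_nhds (x₀ : M) {R : ℝ} (hR : 0 < R) : chartBall (d := d) x₀ R ∈ 𝓝 x₀ :=
  (isOpen_chartBall x₀ R).mem_nhds ⟨mem_extChartAt_source x₀, Metric.mem_ball_self hR⟩

lemma isCompact_coordBall (x₀ : M) (R : ℝ) : IsCompact (coordBall (d := d) x₀ R) :=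
  (isCompact_closedBall _ _).inter_right (𝓡∂ d).isClosed_range

lemma convex_coordBall (x₀ : M) (R : ℝ) : Convex ℝ (coordBall (d := d) x₀ R) :=
  (convex_closedBall _ _).inter (𝓡∂ d).convex_range

lemma mem_range_iff_zero_le {y : EuclideanSpace ℝ (Fin d)} : y ∈ range (𝓡∂ d) ↔ 0 ≤ y 0 := by
  rw [range_modelWithCornersEuclideanHalfSpace]; rfl

lemma eventually_zero_lt {y : EuclideanSpace ℝ (Fin d)} (hy : 0 < y 0) : ∀ᶠ z in 𝓝 y, 0 < z 0 :=
  (EuclideanSpace.proj (𝕜 := ℝ) (0 : Fin d)).continuous.continuousAt.eventually (lt_mem_nhds hy)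

lemma coordBall_mem_nhds {x₀ : M} {R : ℝ} {y : EuclideanSpace ℝ (Fin d)} (hy : 0 < y 0)
    (hyR : y ∈ Metric.ball (extChartAt (𝓡∂ d) x₀ x₀) R) : coordBall x₀ R ∈ 𝓝 y := by
  filter_upwards [Metric.isOpen_ball.mem_nhds hyR, eventually_zero_lt hy] with z h1 h2
  exact ⟨Metric.ball_subset_closedBall h1, mem_range_iff_zero_le.2 h2.le⟩

variable [IsManifold (𝓡∂ d) ∞ M]

/-- A C¹ function on a compact convex set is Lipschitz; the half ball has both properties. -/
lemma exists_lipschitzOnWith_comp_extChartAt_symm {x₀ : M} {R : ℝ}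
    (hR : coordBall x₀ R ⊆ (extChartAt (𝓡∂ d) x₀).target) {u : M → ℝ}
    (hu : ContMDiffOn (𝓡∂ d) 𝓘(ℝ, ℝ) 1 u (extChartAt (𝓡∂ d) x₀).source) :
    ∃ K, LipschitzOnWith K (u ∘ (extChartAt (𝓡∂ d) x₀).symm) (coordBall x₀ R) := by
  have h1 : ContMDiffOn 𝓘(ℝ, EuclideanSpace ℝ (Fin d)) 𝓘(ℝ, ℝ) 1
      (u ∘ (extChartAt (𝓡∂ d) x₀).symm) (extChartAt (𝓡∂ d) x₀).target :=
    hu.comp (contMDiffOn_extChartAt_symm x₀) fun y hy ↦ (extChartAt (𝓡∂ d) x₀).map_target hy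
  exact ((contMDiffOn_iff_contDiffOn.1 h1).mono hR).exists_lipschitzOnWith one_ne_zero
    (convex_coordBall x₀ R) (isCompact_coordBall x₀ R)

variable [RiemannianBundle (fun x : M ↦ TangentSpace (𝓡∂ d) x)]
  [IsContMDiffRiemannianBundle (𝓡∂ d) ∞ (EuclideanSpace ℝ (Fin d))
      (fun x : M ↦ TangentSpace (𝓡∂ d) x)]

lemma exists_lipschitzOnWith_sqrtDetMetric {x₀ : M} {R : ℝ}
    (hR : coordBall x₀ R ⊆ (extChartAt (𝓡∂ d) x₀).target) :
    ∃ K, LipschitzOnWith K (sqrtDetMetric (d := d) x₀) (coordBall x₀ R) := by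
  obtain ⟨K, hK⟩ := exists_lipschitzOnWith_comp_extChartAt_symm hR
    ((contMDiffOn_coordJac (LinearIsometry.id : EuclideanSpace ℝ (Fin d) →ₗᵢ[ℝ]
      EuclideanSpace ℝ (Fin d)) x₀).of_le (by simp))
  refine ⟨K, fun y hy z hz ↦ ?_⟩
  rw [sqrtDetMetric_eq_coordJac (hR hy), sqrtDetMetric_eq_coordJac (hR hz)]
  exact hK hy hz

lemma sqrtDetMetric_pos {x₀ : M} {y : EuclideanSpace ℝ (Fin d)}
    (hy : y ∈ (extChartAt (𝓡∂ d) x₀).target) : 0 < sqrtDetMetric x₀ y := by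
  rw [sqrtDetMetric_eq_coordJac hy]
  exact coordJac_pos _ ((extChartAt (𝓡∂ d) x₀).map_target hy)

/-- Around every point there is a coordinate ball in which `√g X` is Lipschitz. -/
lemma IsLipschitzField.exists_coordBall {X : ∀ x : M, TangentSpace (𝓡∂ d) x}
    (hX : IsLipschitzField X) (x₀ : M) : ∃ R, 0 < R ∧
      coordBall x₀ R ⊆ (extChartAt (𝓡∂ d) x₀).target ∧
      ∃ K, LipschitzOnWith K (fun y ↦ sqrtDetMetric x₀ y • chartField X x₀ y) (coordBall x₀ R) := by
  obtain ⟨K, U, hU, hK⟩ := hX x₀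
  obtain ⟨ε, hε, h⟩ := Metric.mem_nhdsWithin_iff.1
    (inter_mem (extChartAt_target_mem_nhdsWithin (I := 𝓡∂ d) x₀) hU)
  have h1 : coordBall x₀ (ε / 2) ⊆ (extChartAt (𝓡∂ d) x₀).target ∩ U :=
    (inter_subset_inter_left _ (Metric.closedBall_subset_ball (by linarith))).trans h
  refine ⟨ε / 2, by positivity, h1.trans inter_subset_left, ?_⟩
  obtain ⟨L, hL⟩ := exists_lipschitzOnWith_sqrtDetMetric (h1.trans inter_subset_left)
  exact exists_lipschitzOnWith_smul_of_isCompact (isCompact_coordBall x₀ _) hL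
    (hK.mono (h1.trans inter_subset_right))

/-- Rademacher's theorem, with differentiability within the half ball upgraded at points having a
full neighbourhood in it. -/
lemma ae_differentiableAt_of_lipschitzOnWith_coordBall {x₀ : M} {R : ℝ} {K : ℝ≥0}
    {V : EuclideanSpace ℝ (Fin d) → EuclideanSpace ℝ (Fin d)}
    (hV : LipschitzOnWith K V (coordBall x₀ R)) :
    ∀ᵐ y, 0 < y 0 → y ∈ Metric.ball (extChartAt (𝓡∂ d) x₀ x₀) R → DifferentiableAt ℝ V y := by
  filter_upwards [hV.ae_differentiableWithinAt_of_mem (μ := volume)] with y hy h1 h2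
  exact (hy (mem_of_mem_nhds (coordBall_mem_nhds h1 h2))).differentiableAt
    (coordBall_mem_nhds h1 h2)

end ChartBall

set_option linter.unusedSectionVars false

/-! ### The half-space theorem for vector fields -/

section HalfSpace

lemma trace_fderiv_smul {d : ℕ} {v : EuclideanSpace ℝ (Fin d) → ℝ}
    {V : EuclideanSpace ℝ (Fin d) → EuclideanSpace ℝ (Fin d)} {y : EuclideanSpace ℝ (Fin d)}
    (hv : DifferentiableAt ℝ v y) (hV : DifferentiableAt ℝ V y) :
    LinearMap.trace ℝ _ (fderiv ℝ (fun z ↦ v z • V z) y).toLinearMap =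
      v y * LinearMap.trace ℝ _ (fderiv ℝ V y).toLinearMap + fderiv ℝ v y (V y) := by
  have h1 : fderiv ℝ (fun z ↦ v z • V z) y = v y • fderiv ℝ V y + (fderiv ℝ v y).smulRight (V y) :=
    (hv.hasFDerivAt.smul hV.hasFDerivAt).fderiv
  have h2 : V y = ∑ i, V y i • EuclideanSpace.single i (1 : ℝ) := by
    ext k; simp [Pi.single_apply]
  have h3 : fderiv ℝ v y (V y) = ∑ i, V y i * fderiv ℝ v y (EuclideanSpace.single i 1) := by
    conv_lhs => rw [h2]
    rw [map_sum]
    simp only [map_smul, smul_eq_mul]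
  rw [h1, h3, trace_eq_sum_apply_single, trace_eq_sum_apply_single, Finset.mul_sum,
    ← Finset.sum_add_distrib]
  refine Finset.sum_congr rfl fun i _ ↦ ?_
  simp [mul_comm]

/-- By Rademacher the trace is almost everywhere the sum of the ∂ᵢWᵢ, so the scalar formula can be
summed over i, and only i = 0 leaves a boundary term. -/
lemma integral_trace_fderiv_halfSpace {n : ℕ}
    {W : EuclideanSpace ℝ (Fin (n + 1)) → EuclideanSpace ℝ (Fin (n + 1))} {K : ℝ≥0} {R : ℝ}
    (hR : 0 ≤ R) (hW : LipschitzOnWith K W {y | 0 ≤ y 0})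
    (hW0 : ∀ y, 0 ≤ y 0 → R ≤ ‖y‖ → W y = 0) :
    IntegrableOn (fun y ↦ LinearMap.trace ℝ _ (fderiv ℝ W y).toLinearMap) {y | 0 < y 0} ∧
    ∫ y in {y | 0 < y 0}, LinearMap.trace ℝ _ (fderiv ℝ W y).toLinearMap =
      -∫ y', W (insertCoord 0 0 y') 0 := by
  have hWi : ∀ i, LipschitzOnWith (‖(EuclideanSpace.proj (𝕜 := ℝ) i :
      EuclideanSpace ℝ (Fin (n + 1)) →L[ℝ] ℝ)‖₊ * K) (fun y ↦ W y i) {y | 0 ≤ y 0} :=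
    fun i ↦ (EuclideanSpace.proj (𝕜 := ℝ) i :
      EuclideanSpace ℝ (Fin (n + 1)) →L[ℝ] ℝ).lipschitz.comp_lipschitzOnWith hW
  have h := fun i ↦ setIntegral_fderiv_halfSpace hR (hWi i)
    (fun y hy hyR ↦ by rw [hW0 y hy hyR]; rfl) i
  have hopen : IsOpen {y : EuclideanSpace ℝ (Fin (n + 1)) | 0 < y 0} :=
    isOpen_lt continuous_const (EuclideanSpace.proj (𝕜 := ℝ) (0 : Fin (n + 1))).continuous
  have hae : ∀ᵐ y ∂volume.restrict {y : EuclideanSpace ℝ (Fin (n + 1)) | 0 < y 0},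
      ∑ i, fderiv ℝ (fun y ↦ W y i) y (EuclideanSpace.single i 1) =
        LinearMap.trace ℝ _ (fderiv ℝ W y).toLinearMap := by
    rw [ae_restrict_iff' hopen.measurableSet]
    filter_upwards [hW.ae_differentiableWithinAt_of_mem (μ := volume)] with y hy hy0
    have hd : DifferentiableAt ℝ W y := by
      refine (hy (le_of_lt hy0)).differentiableAt ?_
      filter_upwards [hopen.mem_nhds hy0] with z hz using le_of_lt hz
    rw [trace_eq_sum_apply_single]
    refine Finset.sum_congr rfl fun i _ ↦ ?_
    have := ((EuclideanSpace.proj (𝕜 := ℝ) i).hasFDerivAt.comp y hd.hasFDerivAt).fderiv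
    exact congrArg (fun L : EuclideanSpace ℝ (Fin (n + 1)) →L[ℝ] ℝ ↦
      L (EuclideanSpace.single i 1)) this
  constructor
  · exact (integrable_congr hae).1 (integrable_finsetSum _ fun i _ ↦ (h i).1)
  · rw [← integral_congr_ae hae, integral_finsetSum _ fun i _ ↦ (h i).1]
    simp only [fun i ↦ (h i).2, Finset.sum_ite_eq', Finset.mem_univ, if_true]

end HalfSpace

/-! ### The localised field u X in coordinates -/

section LocalDivergence

variable {n : ℕ} {M : Type*} [EMetricSpace M]
  [ChartedSpace (EuclideanHalfSpace (n + 1)) M]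

lemma chartSlice_id (x₀ : M) : chartSlice (LinearIsometry.id : EuclideanSpace ℝ (Fin (n + 1)) →ₗᵢ[ℝ]
      EuclideanSpace ℝ (Fin (n + 1))) x₀ = (extChartAt (𝓡∂ (n + 1)) x₀).source :=
  inter_eq_left.2 fun _ _ ↦ ⟨_, rfl⟩

variable [IsManifold (𝓡∂ (n + 1)) ∞ M]

lemma chartSlice_boundaryIncl (x₀ : M) : chartSlice (boundaryIncl n) x₀ =
    (extChartAt (𝓡∂ (n + 1)) x₀).source ∩ (𝓡∂ (n + 1)).boundary M := by
  ext x
  refine and_congr_right fun hx ↦ ?_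
  rw [mem_preimage, mem_range_boundaryIncl]
  exact (isBoundaryPoint_iff_extChartAt_eq_zero hx).symm

lemma apply_eq_zero_of_notMem_tsupport {u : M → ℝ} {p : M} (hp : p ∉ tsupport u) :
    u p = 0 ∧ mfderiv (𝓡∂ (n + 1)) 𝓘(ℝ, ℝ) u p = 0 := by
  have h := notMem_tsupport_iff_eventuallyEq.1 hp
  refine ⟨h.self_of_nhds, ?_⟩
  rw [h.mfderiv_eq]
  exact mfderiv_const

variable [RiemannianBundle (fun x : M ↦ TangentSpace (𝓡∂ (n + 1)) x)]
  [IsContMDiffRiemannianBundle (𝓡∂ (n + 1)) ∞ (EuclideanSpace ℝ (Fin (n + 1)))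
      (fun x : M ↦ TangentSpace (𝓡∂ (n + 1)) x)]

/-- The field `u X` in the chart at `x₀`, multiplied by `√g` and extended by zero. -/
def localField (u : M → ℝ) (X : ∀ x : M, TangentSpace (𝓡∂ (n + 1)) x) (x₀ : M) (R : ℝ) :
    EuclideanSpace ℝ (Fin (n + 1)) → EuclideanSpace ℝ (Fin (n + 1)) :=
  (Metric.closedBall (extChartAt (𝓡∂ (n + 1)) x₀ x₀) R).indicator fun y ↦
    u ((extChartAt (𝓡∂ (n + 1)) x₀).symm y) • (sqrtDetMetric x₀ y • chartField X x₀ y)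

variable {X : ∀ x : M, TangentSpace (𝓡∂ (n + 1)) x} {x₀ : M} {R r : ℝ} {K : ℝ≥0} {u : M → ℝ}

lemma comp_symm_eq_zero (htu : tsupport u ⊆ chartBall (d := n + 1) x₀ r)
    {y : EuclideanSpace ℝ (Fin (n + 1))} (hy : y ∈ (extChartAt (𝓡∂ (n + 1)) x₀).target)
    (hyr : r ≤ dist y (extChartAt (𝓡∂ (n + 1)) x₀ x₀)) :
    (extChartAt (𝓡∂ (n + 1)) x₀).symm y ∉ tsupport u := by
  intro h
  have := (htu h).2
  rw [mem_preimage, (extChartAt (𝓡∂ (n + 1)) x₀).right_inv hy, Metric.mem_ball] at this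
  linarith

lemma localField_eq_zero (hR : coordBall x₀ R ⊆ (extChartAt (𝓡∂ (n + 1)) x₀).target)
    (htu : tsupport u ⊆ chartBall (d := n + 1) x₀ r)
    {y : EuclideanSpace ℝ (Fin (n + 1))} (hy : 0 ≤ y 0)
    (hyr : r ≤ dist y (extChartAt (𝓡∂ (n + 1)) x₀ x₀)) : localField (n := n) u X x₀ R y = 0 := by
  by_cases h : y ∈ Metric.closedBall (extChartAt (𝓡∂ (n + 1)) x₀ x₀) R
  · rw [localField, indicator_of_mem h, (apply_eq_zero_of_notMem_tsupport (n := n)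
      (comp_symm_eq_zero htu (hR ⟨h, mem_range_iff_zero_le.2 hy⟩) hyr)).1, zero_smul]
  · rw [localField, indicator_of_notMem h]

lemma exists_lipschitzOnWith_localField (hrR : r < R)
    (hR : coordBall x₀ R ⊆ (extChartAt (𝓡∂ (n + 1)) x₀).target)
    (hV : LipschitzOnWith K (fun y ↦ sqrtDetMetric x₀ y • chartField X x₀ y) (coordBall x₀ R))
    (hu : ContMDiff (𝓡∂ (n + 1)) 𝓘(ℝ, ℝ) 1 u) (htu : tsupport u ⊆ chartBall (d := n + 1) x₀ r) :
    ∃ L, LipschitzOnWith L (localField u X x₀ R) {y | 0 ≤ y 0} := by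
  obtain ⟨K₁, hK₁⟩ := exists_lipschitzOnWith_comp_extChartAt_symm hR hu.contMDiffOn
  obtain ⟨K₂, hK₂⟩ := exists_lipschitzOnWith_smul_of_isCompact (isCompact_coordBall x₀ R) hK₁ hV
  obtain ⟨B, hB⟩ := (isCompact_coordBall x₀ R).exists_bound_of_continuousOn hK₂.continuousOn
  rw [← range_modelWithCornersEuclideanHalfSpace]
  refine exists_lipschitzOnWith_indicator hrR hK₂ hB fun y hy hyr ↦ ?_
  have := localField_eq_zero (n := n) (X := X) hR htu (mem_range_iff_zero_le.1 hy.2) hyr.le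
  rwa [localField, indicator_of_mem hy.1] at this

/-- At almost every point of the open ball the product rule applies to u · (√g X), and chart
independence identifies the divergence of √g X with √g div X. -/
lemma ae_trace_fderiv_localField (hrR : r < R)
    (hR : coordBall x₀ R ⊆ (extChartAt (𝓡∂ (n + 1)) x₀).target)
    (hV : LipschitzOnWith K (fun y ↦ sqrtDetMetric x₀ y • chartField X x₀ y) (coordBall x₀ R))
    (hu : ContMDiff (𝓡∂ (n + 1)) 𝓘(ℝ, ℝ) 1 u) (htu : tsupport u ⊆ chartBall (d := n + 1) x₀ r) :
    ∀ᵐ y : EuclideanSpace ℝ (Fin (n + 1)), 0 < y 0 →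
      LinearMap.trace ℝ _ (fderiv ℝ (localField u X x₀ R) y).toLinearMap =
      (extChartAt (𝓡∂ (n + 1)) x₀).target.indicator (fun y ↦ sqrtDetMetric x₀ y *
        (inner ℝ (grad (d := n + 1) u ((extChartAt (𝓡∂ (n + 1)) x₀).symm y))
          (X ((extChartAt (𝓡∂ (n + 1)) x₀).symm y)) +
        u ((extChartAt (𝓡∂ (n + 1)) x₀).symm y) *
          divergence X ((extChartAt (𝓡∂ (n + 1)) x₀).symm y))) y := by
  filter_upwards [ae_differentiableAt_of_lipschitzOnWith_coordBall hV] with y hy hy0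
  by_cases hyR : y ∈ Metric.ball (extChartAt (𝓡∂ (n + 1)) x₀ x₀) R
  · have hyt : y ∈ (extChartAt (𝓡∂ (n + 1)) x₀).target :=
      hR ⟨Metric.ball_subset_closedBall hyR, mem_range_iff_zero_le.2 hy0.le⟩
    set φ := extChartAt (𝓡∂ (n + 1)) x₀ with hφ
    set p := φ.symm y with hp
    have hps : p ∈ φ.source := φ.map_target hyt
    have hpy : φ p = y := φ.right_inv hyt
    have hrange : range (𝓡∂ (n + 1)) ∈ 𝓝 y := by
      filter_upwards [eventually_zero_lt hy0] with z hz using mem_range_iff_zero_le.2 hz.le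
    have hud : DifferentiableAt ℝ (u ∘ φ.symm) y := by
      have h1 : ContMDiffOn 𝓘(ℝ, EuclideanSpace ℝ (Fin (n + 1))) 𝓘(ℝ, ℝ) 1
          (u ∘ φ.symm) φ.target := hu.comp_contMDiffOn (contMDiffOn_extChartAt_symm x₀)
      exact ((contMDiffOn_iff_contDiffOn.1 h1).differentiableOn one_ne_zero y hyt).differentiableAt
        (mem_of_superset (coordBall_mem_nhds hy0 hyR) hR)
    have hev : localField u X x₀ R =ᶠ[𝓝 y] fun y ↦ (u ∘ φ.symm) y •
        (sqrtDetMetric x₀ y • chartField X x₀ y) := by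
      filter_upwards [Metric.isOpen_ball.mem_nhds hyR] with z hz
      rw [localField, indicator_of_mem (Metric.ball_subset_closedBall hz)]
      rfl
    have hpi : (𝓡∂ (n + 1)).IsInteriorPoint p := by
      rw [isInteriorPoint_iff_extChartAt_pos hps, ← hφ, hpy]; exact hy0
    have hdiv := sqrtDetMetric_mul_divergence hps hpi (X := X) (by rw [← hφ, hpy]; exact hy hy0 hyR)
    rw [← hφ, hpy] at hdiv
    have hdu : fderiv ℝ (u ∘ φ.symm) y (chartField X x₀ y) =
        inner ℝ (grad (d := n + 1) u p) (X p) := by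
      rw [inner_grad]
      have h1 := mfderiv_symmCoord hps (hu.mdifferentiable one_ne_zero p) (toCoord x₀ p (X p))
      rw [symmCoord_toCoord hps, ← hφ, hpy, fderivWithin_of_mem_nhds hrange] at h1
      exact h1.symm
    rw [indicator_of_mem hyt, hev.fderiv_eq, trace_fderiv_smul hud (hy hy0 hyR), ← hdiv, map_smul,
      hdu, Function.comp_apply, smul_eq_mul]
    ring
  -- At radius R or more both sides vanish, because u is supported inside radius r < R. In
  -- particular the edge of the indicator does no harm.
  · rw [Metric.mem_ball, not_lt] at hyR
    have hev : localField u X x₀ R =ᶠ[𝓝 y] fun _ ↦ 0 := by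
      have h1 : ∀ᶠ z in 𝓝 y, r < dist z (extChartAt (𝓡∂ (n + 1)) x₀ x₀) :=
        (continuous_id.dist continuous_const).continuousAt.eventually
          (lt_mem_nhds (hrR.trans_le hyR))
      filter_upwards [h1, eventually_zero_lt hy0] with z hz hz0
      exact localField_eq_zero hR htu hz0.le hz.le
    rw [hev.fderiv_eq]
    symm
    by_cases hyt : y ∈ (extChartAt (𝓡∂ (n + 1)) x₀).target
    · have h2 := apply_eq_zero_of_notMem_tsupport (n := n)
        (comp_symm_eq_zero htu hyt (hrR.le.trans hyR))
      have h3 : inner ℝ (grad (d := n + 1) u ((extChartAt (𝓡∂ (n + 1)) x₀).symm y))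
          (X ((extChartAt (𝓡∂ (n + 1)) x₀).symm y)) = 0 := by
        rw [inner_grad, h2.2]; rfl
      rw [indicator_of_mem hyt, h2.1, h3]
      simp
    · rw [indicator_of_notMem hyt]
      simp

end LocalDivergence

set_option linter.unusedSectionVars false

/-! ### The divergence theorem in a coordinate ball -/

section LocalDivergenceTheorem

variable {n : ℕ} {M : Type*} [EMetricSpace M]
  [ChartedSpace (EuclideanHalfSpace (n + 1)) M] [IsManifold (𝓡∂ (n + 1)) ∞ M]
  [RiemannianBundle (fun x : M ↦ TangentSpace (𝓡∂ (n + 1)) x)]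
  [IsContMDiffRiemannianBundle (𝓡∂ (n + 1)) ∞ (EuclideanSpace ℝ (Fin (n + 1)))
      (fun x : M ↦ TangentSpace (𝓡∂ (n + 1)) x)]
  {X : ∀ x : M, TangentSpace (𝓡∂ (n + 1)) x} {x₀ : M} {R r : ℝ} {K : ℝ≥0} {u : M → ℝ}

/-- The divergence of `u X`, for a function `u` and a vector field `X`. -/
def divSMul (u : M → ℝ) (X : ∀ x : M, TangentSpace (𝓡∂ (n + 1)) x) (x : M) : ℝ :=
  inner ℝ (grad (d := n + 1) u x) (X x) + u x * divergence X x

lemma divSMul_eq_zero {p : M} (hp : p ∉ tsupport u) : divSMul u X p = 0 := by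
  have h := apply_eq_zero_of_notMem_tsupport (n := n) hp
  have h1 : inner ℝ (grad (d := n + 1) u p) (X p) = 0 := by rw [inner_grad, h.2]; rfl
  rw [divSMul, h.1, h1, zero_mul, add_zero]

/-- On the boundary (∇ρ)₀ = |∇x₀|, and √g |∇x₀| is the area density. The flux through the hyperplane
is thus u times the area element. -/
lemma localField_boundary (hR : coordBall x₀ R ⊆ (extChartAt (𝓡∂ (n + 1)) x₀).target)
    (hrR : r < R) (htu : tsupport u ⊆ chartBall (d := n + 1) x₀ r) {ρ : M → ℝ}
    (hρ : ∀ x ∈ (𝓡∂ (n + 1)).boundary M, normalDeriv (d := n + 1) ρ x = -1)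
    (z : EuclideanSpace ℝ (Fin n)) :
    localField u (grad (d := n + 1) ρ) x₀ R (insertCoord 0 0 z) 0 =
      (boundaryIncl n ⁻¹' (extChartAt (𝓡∂ (n + 1)) x₀).target).indicator (fun z ↦
        coordJac (boundaryIncl n) x₀ ((extChartAt (𝓡∂ (n + 1)) x₀).symm (boundaryIncl n z)) *
          u ((extChartAt (𝓡∂ (n + 1)) x₀).symm (boundaryIncl n z))) z := by
  rw [← boundaryIncl_apply]
  set y := boundaryIncl n z with hy
  have hy0 : y 0 = 0 := mem_range_boundaryIncl.1 (mem_range_self z)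
  by_cases h : y ∈ Metric.closedBall (extChartAt (𝓡∂ (n + 1)) x₀ x₀) R
  · have hyt : y ∈ (extChartAt (𝓡∂ (n + 1)) x₀).target :=
      hR ⟨h, mem_range_iff_zero_le.2 hy0.ge⟩
    have hps := (extChartAt (𝓡∂ (n + 1)) x₀).map_target hyt
    have hb : (𝓡∂ (n + 1)).IsBoundaryPoint ((extChartAt (𝓡∂ (n + 1)) x₀).symm y) := by
      rw [isBoundaryPoint_iff_extChartAt_eq_zero hps,
        (extChartAt (𝓡∂ (n + 1)) x₀).right_inv hyt, hy0]
    have h1 := toCoord_grad_zero_of_normalDeriv hps hb (hρ _ hb)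
    have h2 : chartField (grad (d := n + 1) ρ) x₀ y 0 = _ := h1
    rw [localField, indicator_of_mem h, indicator_of_mem (by exact hyt), coordJac_boundaryIncl hps,
      sqrtDetMetric_eq_coordJac hyt, ← h1, PiLp.smul_apply, PiLp.smul_apply, smul_eq_mul,
      smul_eq_mul, mul_comm]
    rfl
  · rw [localField, indicator_of_notMem h, PiLp.zero_apply, eq_comm]
    by_cases hyt : y ∈ (extChartAt (𝓡∂ (n + 1)) x₀).target
    · rw [Metric.mem_closedBall, not_le] at h
      rw [indicator_of_mem (by exact hyt), (apply_eq_zero_of_notMem_tsupport (n := n)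
        (comp_symm_eq_zero htu hyt (hrR.trans h).le)).1, mul_zero]
    · rw [indicator_of_notMem (by exact hyt)]

lemma norm_insertCoord_zero (z : EuclideanSpace ℝ (Fin n)) :
    ‖(insertCoord 0 0 z : EuclideanSpace ℝ (Fin (n + 1)))‖ = ‖z‖ := by
  rw [← boundaryIncl_apply]
  exact (boundaryIncl n).norm_map z

variable [MeasurableSpace M] [BorelSpace M] [SecondCountableTopology M]
  [IsRiemannianManifold (𝓡∂ (n + 1)) M]

/-- The divergence theorem for `u ∇ρ` with `∂ρ/∂N = -1`, for a function `u` supported in a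
coordinate ball. -/
theorem local_divergence_theorem (hr : 0 < r) (hrR : r < R)
    (hR : coordBall x₀ R ⊆ (extChartAt (𝓡∂ (n + 1)) x₀).target) {ρ : M → ℝ}
    (hV : LipschitzOnWith K (fun y ↦ sqrtDetMetric x₀ y •
      chartField (grad (d := n + 1) ρ) x₀ y) (coordBall x₀ R))
    (hρ : ∀ x ∈ (𝓡∂ (n + 1)).boundary M, normalDeriv (d := n + 1) ρ x = -1)
    (hu : ContMDiff (𝓡∂ (n + 1)) 𝓘(ℝ, ℝ) 1 u) (htu : tsupport u ⊆ chartBall (d := n + 1) x₀ r) :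
    IntegrableOn u ((𝓡∂ (n + 1)).boundary M) μHE[n] ∧
    Integrable (divSMul u (grad (d := n + 1) ρ)) μHE[n + 1] ∧
    ∫ p in (𝓡∂ (n + 1)).boundary M, u p ∂μHE[n] =
      -∫ p, divSMul u (grad (d := n + 1) ρ) p ∂μHE[n + 1] := by
  set φ := extChartAt (𝓡∂ (n + 1)) x₀ with hφ
  obtain ⟨L, hL⟩ := exists_lipschitzOnWith_localField hrR hR hV hu htu
  -- The half-space theorem uses balls about the origin, while the support lies about `φ x₀`; hence
  -- the added norm.
  have hR0 : 0 ≤ ‖φ x₀‖ + r := by positivity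
  have hW0 : ∀ y : EuclideanSpace ℝ (Fin (n + 1)), 0 ≤ y 0 → ‖φ x₀‖ + r ≤ ‖y‖ →
      localField u (grad (d := n + 1) ρ) x₀ R y = 0 := by
    intro y hy hyr
    refine localField_eq_zero hR htu hy ?_
    rw [dist_eq_norm]
    have := norm_sub_norm_le y (φ x₀)
    linarith
  obtain ⟨hint, hdiv⟩ := integral_trace_fderiv_halfSpace hR0 hL hW0
  have hae := ae_trace_fderiv_localField hrR hR hV hu htu
  have hT : MeasurableSet φ.target := measurableSet_extChartAt_target x₀
  have hTj := measurableSet_preimage_target (boundaryIncl n) x₀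
  have hH : MeasurableSet {y : EuclideanSpace ℝ (Fin (n + 1)) | 0 < y 0} :=
    (isOpen_lt continuous_const
      (EuclideanSpace.proj (𝕜 := ℝ) (0 : Fin (n + 1))).continuous).measurableSet
  have hbd : MeasurableSet ((𝓡∂ (n + 1)).boundary M) :=
    (ModelWithCorners.isClosed_boundary (n := ∞) (by simp)).measurableSet
  -- the boundary term
  have hbu : (fun z ↦ localField u (grad (d := n + 1) ρ) x₀ R (insertCoord 0 0 z) 0) =
      (boundaryIncl n ⁻¹' φ.target).indicator (fun z ↦
        coordJac (boundaryIncl n) x₀ (φ.symm (boundaryIncl n z)) *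
          u (φ.symm (boundaryIncl n z))) :=
    funext fun z ↦ localField_boundary hR hrR htu hρ z
  -- The boundary flux is continuous with compact support, so integrability of `u` over the boundary
  -- follows without a separate bound on the area.
  have hcont : Continuous fun z : EuclideanSpace ℝ (Fin n) ↦
      localField u (grad (d := n + 1) ρ) x₀ R (insertCoord 0 0 z) 0 := by
    refine (EuclideanSpace.proj (𝕜 := ℝ) (0 : Fin (n + 1))).continuous.comp
      (hL.continuousOn.comp_continuous (boundaryIncl n).continuous fun z ↦ ?_)
    exact (mem_range_boundaryIncl.1 (mem_range_self z)).ge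
  have hcs : HasCompactSupport fun z : EuclideanSpace ℝ (Fin n) ↦
      localField u (grad (d := n + 1) ρ) x₀ R (insertCoord 0 0 z) 0 := by
    refine HasCompactSupport.intro (isCompact_closedBall 0 (‖φ x₀‖ + r)) fun z hz ↦ ?_
    rw [mem_closedBall_zero_iff, not_le] at hz
    rw [hW0 _ (by rw [insertCoord_apply_same]) (by rw [norm_insertCoord_zero]; exact hz.le)]
    rfl
  have hbint := hcont.integrable_of_hasCompactSupport (μ := volume) hcs
  rw [hbu, integrable_indicator_iff hTj, ← integrableOn_chartSlice_iff,
    chartSlice_boundaryIncl] at hbint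
  have hu0 : ∀ p ∉ φ.source, u p = 0 := fun p hp ↦
    (apply_eq_zero_of_notMem_tsupport (n := n) fun h ↦ hp (htu h).1).1
  have hF0 : ∀ p ∉ φ.source, divSMul u (grad (d := n + 1) ρ) p = 0 := fun p hp ↦
    divSMul_eq_zero fun h ↦ hp (htu h).1
  have hbeq : ∫ p in (𝓡∂ (n + 1)).boundary M, u p ∂μHE[n] =
      ∫ z, localField u (grad (d := n + 1) ρ) x₀ R (insertCoord 0 0 z) 0 := by
    rw [setIntegral_eq_of_subset_of_forall_sdiff_eq_zero hbd
      (s := φ.source ∩ (𝓡∂ (n + 1)).boundary M) inter_subset_right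
      (fun p hp ↦ hu0 p fun h ↦ hp.2 ⟨h, hp.1⟩), hφ, ← chartSlice_boundaryIncl,
      setIntegral_chartSlice, hbu, integral_indicator hTj]
  -- the interior term
  set G : EuclideanSpace ℝ (Fin (n + 1)) → ℝ := fun y ↦
    coordJac (LinearIsometry.id : EuclideanSpace ℝ (Fin (n + 1)) →ₗᵢ[ℝ]
      EuclideanSpace ℝ (Fin (n + 1))) x₀ (φ.symm y) *
      divSMul u (grad (d := n + 1) ρ) (φ.symm y) with hG
  have hae' : (fun y ↦ LinearMap.trace ℝ _
      (fderiv ℝ (localField u (grad (d := n + 1) ρ) x₀ R) y).toLinearMap) =ᵐ[volume.restrict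
        {y : EuclideanSpace ℝ (Fin (n + 1)) | 0 < y 0}] φ.target.indicator G := by
    refine (ae_restrict_iff' hH).2 ?_
    filter_upwards [hae] with y hy hy0
    rw [hy hy0]
    by_cases hyt : y ∈ φ.target
    · rw [indicator_of_mem hyt, indicator_of_mem hyt, sqrtDetMetric_eq_coordJac hyt]
      rfl
    · rw [indicator_of_notMem hyt, indicator_of_notMem hyt]
  -- The chart target contains boundary points with y₀ = 0, which form a null set.
  have hset : ({y : EuclideanSpace ℝ (Fin (n + 1)) | 0 < y 0} ∩ φ.target : Set _) =ᵐ[volume]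
      φ.target := by
    filter_upwards [ae_apply_zero_ne_zero (n := n)] with y hy
    refine propext ⟨fun h ↦ h.2, fun h ↦ ⟨?_, h⟩⟩
    exact lt_of_le_of_ne (mem_range_iff_zero_le.1 (extChartAt_target_subset_range x₀ h)) hy.symm
  have hGint : IntegrableOn G φ.target := by
    have h1 : IntegrableOn (φ.target.indicator G) {y | 0 < y 0} :=
      (integrable_congr hae').1 hint
    rw [IntegrableOn, integrable_indicator_iff hT, IntegrableOn,
      Measure.restrict_restrict hT, inter_comm] at h1
    rwa [← integrableOn_congr_set_ae hset]
  have hGF : IntegrableOn (divSMul u (grad (d := n + 1) ρ)) φ.source μHE[n + 1] := by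
    rw [hφ, ← chartSlice_id, integrableOn_chartSlice_iff]
    exact hGint
  have hieq : ∫ p, divSMul u (grad (d := n + 1) ρ) p ∂μHE[n + 1] =
      ∫ y in {y : EuclideanSpace ℝ (Fin (n + 1)) | 0 < y 0}, LinearMap.trace ℝ _
        (fderiv ℝ (localField u (grad (d := n + 1) ρ) x₀ R) y).toLinearMap := by
    rw [integral_congr_ae hae', setIntegral_indicator hT, setIntegral_congr_set hset,
      ← setIntegral_eq_integral_of_forall_compl_eq_zero hF0, hφ, ← chartSlice_id,
      setIntegral_chartSlice]
    rfl
  refine ⟨?_, ?_, by rw [hbeq, hieq, hdiv, neg_neg]⟩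
  · refine (integrableOn_congr_fun (fun p hp ↦ ?_) hbd).1
      ((integrable_indicator_iff ((isOpen_extChartAt_source x₀).measurableSet.inter hbd)).2
        hbint).integrableOn
    by_cases h : p ∈ φ.source
    · exact indicator_of_mem (s := φ.source ∩ (𝓡∂ (n + 1)).boundary M) ⟨h, hp⟩ u
    · rw [indicator_of_notMem fun h' ↦ h h'.1, hu0 p h]
  · refine (integrableOn_iff_integrable_of_support_subset fun p hp ↦ ?_).1 hGF
    by_contra h
    exact hp (hF0 p h)

end LocalDivergenceTheorem

set_option linter.unusedSectionVars false

/-! ### Local bounds for divergence and volume -/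

section LocalBounds

variable {n : ℕ} {M : Type*} [EMetricSpace M]
  [ChartedSpace (EuclideanHalfSpace (n + 1)) M] [IsManifold (𝓡∂ (n + 1)) ∞ M]
  [RiemannianBundle (fun x : M ↦ TangentSpace (𝓡∂ (n + 1)) x)]
  [IsContMDiffRiemannianBundle (𝓡∂ (n + 1)) ∞ (EuclideanSpace ℝ (Fin (n + 1)))
      (fun x : M ↦ TangentSpace (𝓡∂ (n + 1)) x)]
  {X : ∀ x : M, TangentSpace (𝓡∂ (n + 1)) x} {x₀ : M} {R r : ℝ} {K : ℝ≥0}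

lemma abs_trace_le {d : ℕ} (L : EuclideanSpace ℝ (Fin d) →L[ℝ] EuclideanSpace ℝ (Fin d)) :
    |LinearMap.trace ℝ _ L.toLinearMap| ≤ d * ‖L‖ := by
  rw [trace_eq_sum_apply_single]
  refine (Finset.abs_sum_le_sum_abs _ _).trans ?_
  calc ∑ i : Fin d, |L (EuclideanSpace.single i 1) i| ≤ ∑ _i : Fin d, ‖L‖ := by
        refine Finset.sum_le_sum fun i _ ↦ ?_
        refine (PiLp.norm_apply_le (L (EuclideanSpace.single i 1)) i).trans ?_
        simpa using L.le_opNorm (EuclideanSpace.single i 1)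
    _ = _ := by simp

variable [MeasurableSpace M] [BorelSpace M] [SecondCountableTopology M]
  [IsRiemannianManifold (𝓡∂ (n + 1)) M]

/-- The trace of the derivative of √g X is at most the dimension times its Lipschitz constant, and
√g has a positive minimum on the compact half ball. -/
lemma exists_ae_abs_divergence_le (hR0 : 0 < R)
    (hR : coordBall x₀ R ⊆ (extChartAt (𝓡∂ (n + 1)) x₀).target)
    (hV : LipschitzOnWith K (fun y ↦ sqrtDetMetric x₀ y • chartField X x₀ y) (coordBall x₀ R)) :
    ∃ C : ℝ, ∀ᵐ p ∂(μHE[n + 1] : Measure M).restrict (chartBall (d := n + 1) x₀ R),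
      |divergence X p| ≤ C := by
  set φ := extChartAt (𝓡∂ (n + 1)) x₀ with hφ
  obtain ⟨L, hL⟩ := exists_lipschitzOnWith_sqrtDetMetric hR
  obtain ⟨y₀, hy₀, hmin⟩ := (isCompact_coordBall x₀ R).exists_isMinOn
    ⟨φ x₀, Metric.mem_closedBall_self hR0.le,
      extChartAt_target_subset_range x₀ (mem_extChartAt_target x₀)⟩ hL.continuousOn
  set m := sqrtDetMetric x₀ y₀ with hm
  have hm0 : 0 < m := sqrtDetMetric_pos (hR hy₀)
  refine ⟨((n + 1 : ℕ) * K) / m, ?_⟩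
  have h1 := ae_restrict_chartSlice (LinearIsometry.id : EuclideanSpace ℝ (Fin (n + 1)) →ₗᵢ[ℝ]
      EuclideanSpace ℝ (Fin (n + 1))) x₀ (P := fun p ↦ p ∈ chartBall (d := n + 1) x₀ R →
        |divergence X p| ≤ ((n + 1 : ℕ) * K) / m) ?_
  · rw [chartSlice_id, ae_restrict_iff' (isOpen_extChartAt_source x₀).measurableSet] at h1
    rw [ae_restrict_iff' (isOpen_chartBall x₀ R).measurableSet]
    filter_upwards [h1] with p hp hpb using hp hpb.1 hpb
  · refine (ae_restrict_iff' (measurableSet_extChartAt_target x₀)).2 ?_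
    filter_upwards [ae_differentiableAt_of_lipschitzOnWith_coordBall hV,
      ae_apply_zero_ne_zero (n := n)] with y hy hy0 hyt hyb
    rw [LinearIsometry.id_apply] at hyb ⊢
    have hyt' : y ∈ φ.target := hyt
    have hpos : 0 < y 0 := lt_of_le_of_ne
      (mem_range_iff_zero_le.1 (extChartAt_target_subset_range x₀ hyt')) hy0.symm
    have hyR : y ∈ Metric.ball (φ x₀) R := by
      have := hyb.2
      rwa [mem_preimage, ← hφ, φ.right_inv hyt'] at this
    have hps := φ.map_target hyt'
    have hdiff := hy hpos hyR
    have hdiv := sqrtDetMetric_mul_divergence hps (X := X)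
      (by rw [isInteriorPoint_iff_extChartAt_pos hps, ← hφ, φ.right_inv hyt']; exact hpos)
      (by rw [← hφ, φ.right_inv hyt']; exact hdiff)
    rw [← hφ, φ.right_inv hyt'] at hdiv
    have h2 := abs_trace_le (fderiv ℝ (fun y ↦ sqrtDetMetric x₀ y • chartField X x₀ y) y)
    rw [← hdiv, abs_mul] at h2
    have h3 : ‖fderiv ℝ (fun y ↦ sqrtDetMetric x₀ y • chartField X x₀ y) y‖ ≤ K :=
      norm_fderiv_le_of_lipschitzOn ℝ (coordBall_mem_nhds hpos hyR) hV
    have h4 : m ≤ |sqrtDetMetric x₀ y| := (hmin (mem_of_mem_nhds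
      (coordBall_mem_nhds hpos hyR))).trans (le_abs_self _)
    rw [le_div_iff₀ hm0]
    calc |divergence X (φ.symm y)| * m ≤ |divergence X (φ.symm y)| * |sqrtDetMetric x₀ y| := by
          gcongr
      _ ≤ (n + 1 : ℕ) * ‖fderiv ℝ (fun y ↦ sqrtDetMetric x₀ y • chartField X x₀ y) y‖ := by
          rw [mul_comm]; exact h2
      _ ≤ _ := by gcongr

lemma euclideanHausdorffMeasure_chartBall_lt_top
    (hR : coordBall x₀ R ⊆ (extChartAt (𝓡∂ (n + 1)) x₀).target) :
    (μHE[n + 1] : Measure M) (chartBall (d := n + 1) x₀ R) < ⊤ := by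
  obtain ⟨L, hL⟩ := exists_lipschitzOnWith_sqrtDetMetric hR
  obtain ⟨B, hB⟩ := (isCompact_coordBall x₀ R).exists_bound_of_continuousOn hL.continuousOn
  have hm := (isOpen_chartBall (d := n + 1) x₀ R).measurableSet
  rw [euclideanHausdorffMeasure_eq_coordMeasure (LinearIsometry.id :
    EuclideanSpace ℝ (Fin (n + 1)) →ₗᵢ[ℝ] EuclideanSpace ℝ (Fin (n + 1)))
    (B := chartBall (d := n + 1) x₀ R) (inter_subset_left.trans (chartSlice_id x₀).ge) hm, coordMeasure_apply _ _ hm]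
  set S := coordSet (LinearIsometry.id :
      EuclideanSpace ℝ (Fin (n + 1)) →ₗᵢ[ℝ] EuclideanSpace ℝ (Fin (n + 1))) x₀
      (chartBall (d := n + 1) x₀ R) with hS
  have hmem : ∀ y ∈ S, y ∈ (extChartAt (𝓡∂ (n + 1)) x₀).target ∧
        y ∈ coordBall x₀ R := by
    intro y hy
    have hyt : y ∈ (extChartAt (𝓡∂ (n + 1)) x₀).target := hy.1
    refine ⟨hyt, ?_, extChartAt_target_subset_range x₀ hyt⟩
    have : extChartAt (𝓡∂ (n + 1)) x₀ ((extChartAt (𝓡∂ (n + 1)) x₀).symm y) ∈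
      Metric.ball (extChartAt (𝓡∂ (n + 1)) x₀ x₀) R := hy.2.2
    rw [(extChartAt (𝓡∂ (n + 1)) x₀).right_inv hyt] at this
    exact Metric.ball_subset_closedBall this
  calc _ ≤ ∫⁻ _y in S, ENNReal.ofReal B := by
        refine setLIntegral_mono' (measurableSet_coordSet _ x₀ hm) fun y hy ↦ ?_
        refine ENNReal.ofReal_le_ofReal ((le_abs_self _).trans ?_)
        have := hB y (hmem y hy).2
        rwa [sqrtDetMetric_eq_coordJac (hmem y hy).1] at this
    _ < ⊤ := by
        rw [setLIntegral_const]
        refine ENNReal.mul_lt_top ENNReal.ofReal_lt_top ?_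
        exact (measure_mono fun y hy ↦ (hmem y hy).2).trans_lt
          (isCompact_coordBall x₀ R).measure_lt_top

end LocalBounds

/-! ### The global divergence theorem -/

section Global

variable {n : ℕ} {M : Type*} [EMetricSpace M]
  [ChartedSpace (EuclideanHalfSpace (n + 1)) M] [IsManifold (𝓡∂ (n + 1)) ∞ M]
  [RiemannianBundle (fun x : M ↦ TangentSpace (𝓡∂ (n + 1)) x)]
  [IsContMDiffRiemannianBundle (𝓡∂ (n + 1)) ∞ (EuclideanSpace ℝ (Fin (n + 1)))
      (fun x : M ↦ TangentSpace (𝓡∂ (n + 1)) x)]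
  [MeasurableSpace M] [BorelSpace M]
  [IsRiemannianManifold (𝓡∂ (n + 1)) M] [CompactSpace M]
  {X : ∀ x : M, TangentSpace (𝓡∂ (n + 1)) x}

lemma exists_ae_abs_divergence_le_of_compactSpace (hX : IsLipschitzField X) :
    ∃ C : ℝ, ∀ᵐ p ∂(μHE[n + 1] : Measure M), |divergence X p| ≤ C := by
  have : SecondCountableTopology M := inferInstance
  choose R hR0 hR K hV using fun x₀ ↦ hX.exists_coordBall x₀
  choose C hC using fun x₀ ↦ exists_ae_abs_divergence_le (hR0 x₀) (hR x₀) (hV x₀)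
  obtain ⟨t, ht⟩ := CompactSpace.elim_nhds_subcover (fun x₀ ↦ chartBall (d := n + 1) x₀ (R x₀))
    fun x₀ ↦ chartBall_mem_nhds x₀ (hR0 x₀)
  have h1 : ∀ x₀ ∈ t, ∀ᵐ p ∂(μHE[n + 1] : Measure M), p ∈ chartBall (d := n + 1) x₀ (R x₀) →
      |divergence X p| ≤ C x₀ := fun x₀ _ ↦
    (ae_restrict_iff' (isOpen_chartBall x₀ _).measurableSet).1 (hC x₀)
  refine ⟨∑ x₀ ∈ t, |C x₀|, ?_⟩
  have h2 := (Finset.eventually_all t).2 h1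
  filter_upwards [h2] with p hp
  have : p ∈ ⋃ x₀ ∈ t, chartBall (d := n + 1) x₀ (R x₀) := by rw [ht]; trivial
  obtain ⟨x₀, hx₀, hpx⟩ := mem_iUnion₂.1 this
  exact ((hp x₀ hx₀ hpx).trans (le_abs_self _)).trans
    (Finset.single_le_sum (f := fun x ↦ |C x|) (fun _ _ ↦ abs_nonneg _) hx₀)

lemma isFiniteMeasure_euclideanHausdorffMeasure :
    IsFiniteMeasure (μHE[n + 1] : Measure M) := by
  have : SecondCountableTopology M := inferInstance
  refine ⟨isCompact_univ.measure_lt_top_of_nhdsWithin fun x₀ _ ↦ ?_⟩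
  obtain ⟨ε, hε, h⟩ := Metric.mem_nhdsWithin_iff.1
    (extChartAt_target_mem_nhdsWithin (I := 𝓡∂ (n + 1)) x₀)
  have h1 : coordBall x₀ (ε / 2) ⊆ (extChartAt (𝓡∂ (n + 1)) x₀).target :=
    (inter_subset_inter_left _ (Metric.closedBall_subset_ball (by linarith))).trans h
  exact ⟨_, nhdsWithin_le_nhds (chartBall_mem_nhds x₀ (half_pos hε)),
    euclideanHausdorffMeasure_chartBall_lt_top h1⟩

lemma divSMul_add {v w : M → ℝ} {p : M} (hv : MDifferentiableAt (𝓡∂ (n + 1)) 𝓘(ℝ, ℝ) v p)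
    (hw : MDifferentiableAt (𝓡∂ (n + 1)) 𝓘(ℝ, ℝ) w p) :
    divSMul (v + w) X p = divSMul v X p + divSMul w X p := by
  have h2 : inner ℝ (grad (d := n + 1) (v + w) p) (X p) =
      inner ℝ (grad (d := n + 1) v p) (X p) + inner ℝ (grad (d := n + 1) w p) (X p) := by
    simp only [inner_grad]
    exact congrArg (fun L : EuclideanSpace ℝ (Fin (n + 1)) →L[ℝ] ℝ ↦ L (X p)) (mfderiv_add hv hw)
  simp only [divSMul]
  rw [h2, Pi.add_apply]
  ring

lemma divSMul_sum {ι : Type*} (t : Finset ι) {v : ι → M → ℝ} {p : M}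
    (hv : ∀ i, ContMDiff (𝓡∂ (n + 1)) 𝓘(ℝ, ℝ) 1 (v i)) :
    divSMul (∑ i ∈ t, v i) X p = ∑ i ∈ t, divSMul (v i) X p := by
  classical
  induction t using Finset.induction_on with
  | empty =>
    rw [Finset.sum_empty, Finset.sum_empty]
    exact divSMul_eq_zero (by simp [tsupport])
  | insert i t hi ih =>
    have h : ContMDiff (𝓡∂ (n + 1)) 𝓘(ℝ, ℝ) 1 (∑ i ∈ t, v i) := contMDiff_finsetSum' fun i _ ↦ hv i
    rw [Finset.sum_insert hi, Finset.sum_insert hi, divSMul_add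
      ((hv i).mdifferentiable one_ne_zero p) (h.mdifferentiable one_ne_zero p), ih]

/-- The divergence theorem for `u ∇ρ`, when `∂ρ/∂N = -1` on the boundary and `∇ρ` is Lipschitz. -/
theorem divergence_theorem {ρ : M → ℝ} (hX : IsLipschitzField (grad (d := n + 1) ρ))
    (hρ : ∀ x ∈ (𝓡∂ (n + 1)).boundary M, normalDeriv (d := n + 1) ρ x = -1) {u : M → ℝ}
    (hu : ContMDiff (𝓡∂ (n + 1)) 𝓘(ℝ, ℝ) 1 u) :
    IntegrableOn u ((𝓡∂ (n + 1)).boundary M) μHE[n] ∧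
    Integrable (divSMul u (grad (d := n + 1) ρ)) μHE[n + 1] ∧
    ∫ p in (𝓡∂ (n + 1)).boundary M, u p ∂μHE[n] =
      -∫ p, divSMul u (grad (d := n + 1) ρ) p ∂μHE[n + 1] := by
  have : SecondCountableTopology M := inferInstance
  choose R hR0 hR K hV using fun x₀ ↦ hX.exists_coordBall x₀
  -- Half radii leave an annulus in which the localised field vanishes, as its extension by zero
  -- requires.
  obtain ⟨t, ht⟩ := CompactSpace.elim_nhds_subcover
    (fun x₀ ↦ chartBall (d := n + 1) x₀ (R x₀ / 2))
    fun x₀ ↦ chartBall_mem_nhds x₀ (half_pos (hR0 x₀))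
  obtain ⟨f, hf⟩ := SmoothPartitionOfUnity.exists_isSubordinate (𝓡∂ (n + 1)) (isClosed_univ (X := M))
    (fun i : t ↦ chartBall (d := n + 1) i.1 (R i.1 / 2)) (fun i ↦ isOpen_chartBall _ _) (by
      rw [← top_eq_univ, ← ht]
      refine iUnion₂_subset fun i hi ↦ ?_
      exact subset_iUnion (fun i : t ↦ chartBall (d := n + 1) i.1 (R i.1 / 2)) ⟨i, hi⟩)
  -- The partition of unity multiplies `u`, not the field: the pieces remain C¹ and ∇ρ is left
  -- unchanged.
  set v : t → M → ℝ := fun i x ↦ f i x * u x with hv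
  have hvs : ∀ i, ContMDiff (𝓡∂ (n + 1)) 𝓘(ℝ, ℝ) 1 (v i) := fun i ↦
    ((f i).contMDiff.of_le (by simp)).mul hu
  have hsum : u = ∑ i, v i := by
    ext x
    have := f.sum_eq_one (mem_univ x)
    rw [finsum_eq_sum_of_fintype] at this
    rw [Finset.sum_apply, ← Finset.sum_mul, this, one_mul]
  have key := fun i : t ↦ local_divergence_theorem (half_pos (hR0 i)) (half_lt_self (hR0 i))
    (hR i) (hV i) hρ (hvs i) ((tsupport_mul_subset_left).trans (hf i))
  have hdiv : divSMul u (grad (d := n + 1) ρ) = ∑ i, divSMul (v i) (grad (d := n + 1) ρ) := by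
    ext p
    conv_lhs => rw [hsum]
    rw [divSMul_sum _ hvs, Finset.sum_apply]
  refine ⟨?_, ?_, ?_⟩
  · rw [hsum]
    exact integrable_finsetSum' _ fun i _ ↦ (key i).1
  · rw [hdiv]
    exact integrable_finsetSum' _ fun i _ ↦ (key i).2.1
  · rw [hdiv]
    conv_lhs => rw [hsum]
    simp only [Finset.sum_apply]
    rw [integral_finsetSum _ fun i _ ↦ (key i).1, integral_finsetSum _ fun i _ ↦ (key i).2.1,
      ← Finset.sum_neg_distrib]
    exact Finset.sum_congr rfl fun i _ ↦ (key i).2.2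

end Global

set_option linter.unusedSectionVars false

/-! ### Continuity of the length of the gradient -/

section Gradient

variable {d : ℕ} [NeZero d] {M : Type*} [EMetricSpace M]
  [ChartedSpace (EuclideanHalfSpace d) M] [IsManifold (𝓡∂ d) ∞ M]

lemma continuousOn_mfderiv_symmCoord {f : M → ℝ} (hf : ContMDiff (𝓡∂ d) 𝓘(ℝ, ℝ) 1 f) (x₀ : M)
    (v : EuclideanSpace ℝ (Fin d)) :
    ContinuousOn (fun x ↦ (mfderiv (𝓡∂ d) 𝓘(ℝ, ℝ) f x (symmCoord x₀ x v) : ℝ))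
      (extChartAt (𝓡∂ d) x₀).source := by
  set φ := extChartAt (𝓡∂ d) x₀ with hφ
  have h1 : ContDiffOn ℝ 1 (f ∘ φ.symm) φ.target :=
    contMDiffOn_iff_contDiffOn.1 (hf.comp_contMDiffOn (contMDiffOn_extChartAt_symm x₀))
  have hu : UniqueDiffOn ℝ φ.target := uniqueDiffOn_extChartAt_target x₀
  have h2 : ContinuousOn (fun x ↦ fderivWithin ℝ (f ∘ φ.symm) φ.target (φ x) v) φ.source :=
    ((h1.continuousOn_fderivWithin hu le_rfl).clm_apply continuousOn_const).comp
      (continuousOn_extChartAt x₀) φ.mapsTo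
  refine h2.congr fun x hx ↦ ?_
  refine (mfderiv_symmCoord hx (hf.mdifferentiable one_ne_zero x) v).trans ?_
  have hx' := φ.map_source hx
  have h3 : DifferentiableWithinAt ℝ (f ∘ φ.symm) (range (𝓡∂ d)) (φ x) :=
    (h1.differentiableOn one_ne_zero _ hx').mono_of_mem_nhdsWithin
      (extChartAt_target_mem_nhdsWithin' hx)
  exact congrArg (fun L : EuclideanSpace ℝ (Fin d) →L[ℝ] ℝ ↦ L v)
    ((h3.hasFDerivWithinAt.mono (extChartAt_target_subset_range x₀)).fderivWithin (hu _ hx')).symm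

/-- The partial derivatives of `f` in the chart at `x₀`. -/
def chartDeriv (f : M → ℝ) (x₀ x : M) (i : Fin d) : ℝ :=
  mfderiv (𝓡∂ d) 𝓘(ℝ, ℝ) f x (symmCoord x₀ x (EuclideanSpace.single i 1))

variable [RiemannianBundle (fun x : M ↦ TangentSpace (𝓡∂ d) x)]
  [IsContMDiffRiemannianBundle (𝓡∂ d) ∞ (EuclideanSpace ℝ (Fin d))
      (fun x : M ↦ TangentSpace (𝓡∂ d) x)]

/-- The matrix of the metric in the chart at `x₀`. -/
def gramMatrix (x₀ x : M) : Matrix (Fin d) (Fin d) ℝ :=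
  Matrix.of fun i i' ↦ inner ℝ (symmCoord x₀ x (EuclideanSpace.single i 1))
    (symmCoord x₀ x (EuclideanSpace.single i' 1))

lemma det_gramMatrix_pos {x₀ x : M} (hx : x ∈ (extChartAt (𝓡∂ d) x₀).source) :
    0 < (gramMatrix (d := d) x₀ x).det := by
  have h := coordJac_pos (LinearIsometry.id : EuclideanSpace ℝ (Fin d) →ₗᵢ[ℝ]
    EuclideanSpace ℝ (Fin d)) hx
  rw [coordJac_eq_sqrt_det, Real.sqrt_pos] at h
  exact h

lemma gramMatrix_mulVec_toCoord {x₀ x : M} (hx : x ∈ (extChartAt (𝓡∂ d) x₀).source)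
    (f : M → ℝ) : Matrix.mulVec (gramMatrix (d := d) x₀ x) (toCoord x₀ x (grad (d := d) f x)) =
      chartDeriv (d := d) f x₀ x := by
  ext i
  have h1 : (toCoord x₀ x (grad (d := d) f x) : EuclideanSpace ℝ (Fin d)) =
      ∑ j, toCoord x₀ x (grad (d := d) f x) j • EuclideanSpace.single j (1 : ℝ) := by
    ext k; simp [Pi.single_apply]
  have h2 : inner ℝ (symmCoord x₀ x (EuclideanSpace.single i 1)) (grad (d := d) f x) =
      ∑ j, toCoord x₀ x (grad (d := d) f x) j *
        inner ℝ (symmCoord x₀ x (EuclideanSpace.single i 1))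
        (symmCoord x₀ x (EuclideanSpace.single j 1)) := by
    conv_lhs => rw [← symmCoord_toCoord hx (grad (d := d) f x), h1]
    rw [map_sum, inner_sum]
    refine Finset.sum_congr rfl fun j _ ↦ ?_
    rw [map_smul, real_inner_smul_right]
  have h3 := inner_grad f x (symmCoord x₀ x (EuclideanSpace.single i 1))
  rw [real_inner_comm, h2] at h3
  refine Eq.trans ?_ h3
  rw [Matrix.mulVec, dotProduct]
  exact Finset.sum_congr rfl fun j _ ↦ mul_comm _ _

/-- The coordinate formula |∇f|² = gⁱʲ ∂ᵢf ∂ⱼf expresses the length by continuous scalar functions,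
which avoids comparing vectors in different tangent spaces. -/
lemma norm_sq_grad {x₀ x : M} (hx : x ∈ (extChartAt (𝓡∂ d) x₀).source) (f : M → ℝ) :
    ‖grad (d := d) f x‖ ^ 2 = dotProduct (chartDeriv (d := d) f x₀ x)
      (Matrix.mulVec (gramMatrix (d := d) x₀ x)⁻¹ (chartDeriv (d := d) f x₀ x)) := by
  have hdet : IsUnit (gramMatrix (d := d) x₀ x).det := (det_gramMatrix_pos hx).ne'.isUnit
  have h1 : (toCoord x₀ x (grad (d := d) f x) : EuclideanSpace ℝ (Fin d)) =
      ∑ j, toCoord x₀ x (grad (d := d) f x) j • EuclideanSpace.single j (1 : ℝ) := by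
    ext k; simp [Pi.single_apply]
  conv_rhs => rw [← gramMatrix_mulVec_toCoord hx, Matrix.mulVec_mulVec, Matrix.nonsing_inv_mul _ hdet,
    Matrix.one_mulVec, gramMatrix_mulVec_toCoord hx]
  have h2 : grad (d := d) f x = symmCoord x₀ x
      (∑ j, toCoord x₀ x (grad (d := d) f x) j • EuclideanSpace.single j (1 : ℝ)) := by
    rw [← h1, symmCoord_toCoord hx]
  rw [← real_inner_self_eq_norm_sq]
  refine (congrArg (inner ℝ (grad (d := d) f x)) h2).trans ?_
  rw [map_sum, inner_sum, dotProduct]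
  refine Finset.sum_congr rfl fun j _ ↦ ?_
  rw [map_smul, real_inner_smul_right, inner_grad, mul_comm]
  rfl

lemma continuous_norm_grad {f : M → ℝ} (hf : ContMDiff (𝓡∂ d) 𝓘(ℝ, ℝ) 1 f) :
    Continuous fun x ↦ ‖grad (d := d) f x‖ := by
  refine continuous_iff_continuousAt.2 fun x₀ ↦ ?_
  have h : ContinuousOn (fun x ↦ ‖grad (d := d) f x‖) (extChartAt (𝓡∂ d) x₀).source := by
    rw [continuousOn_iff_continuous_domRestrict]
    have hα : Continuous fun x : (extChartAt (𝓡∂ d) x₀).source ↦ chartDeriv (d := d) f x₀ x.1 :=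
      continuous_pi fun i ↦ continuousOn_iff_continuous_domRestrict.1
        (continuousOn_mfderiv_symmCoord hf x₀ (EuclideanSpace.single i 1))
    have hG : Continuous fun x : (extChartAt (𝓡∂ d) x₀).source ↦ gramMatrix (d := d) x₀ x.1 :=
      continuous_matrix fun i j ↦ continuousOn_iff_continuous_domRestrict.1
        (contMDiffOn_inner_symmCoord x₀ (EuclideanSpace.single i 1)
          (EuclideanSpace.single j 1)).continuousOn
    have hGi : Continuous fun x : (extChartAt (𝓡∂ d) x₀).source ↦
        (gramMatrix (d := d) x₀ x.1)⁻¹ := by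
      simp only [Matrix.inv_def, Ring.inverse_eq_inv']
      exact (hG.matrix_det.inv₀ fun x ↦ (det_gramMatrix_pos x.2).ne').smul hG.matrix_adjugate
    have h1 := (hα.dotProduct (hGi.matrix_mulVec hα)).sqrt
    refine h1.congr fun x ↦ ?_
    rw [← norm_sq_grad x.2, Real.sqrt_sq (norm_nonneg _)]
    rfl
  exact h.continuousAt (extChartAt_source_mem_nhds x₀)

lemma inner_grad_comp {f : M → ℝ} {x : M} (hf : MDifferentiableAt (𝓡∂ d) 𝓘(ℝ, ℝ) f x) {g : ℝ → ℝ}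
    {g' : ℝ} (hg : HasDerivAt g g' (f x)) (v : TangentSpace (𝓡∂ d) x) :
    inner ℝ (grad (d := d) (fun y ↦ g (f y)) x) v = g' * inner ℝ (grad (d := d) f x) v := by
  rw [inner_grad, inner_grad]
  have h1 := (hg.hasFDerivAt.hasMFDerivAt.comp x hf.hasMFDerivAt).mfderiv
  refine (congrArg (fun L : EuclideanSpace ℝ (Fin d) →L[ℝ] ℝ ↦ L v) h1).trans ?_
  exact mul_comm _ _

end Gradient

/-! ### Normalised measures and essential suprema -/

section Normalized

variable {d : ℕ} {M : Type*} [EMetricSpace M] [MeasurableSpace M] [BorelSpace M]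

lemma integral_euclideanHausdorffMeasure_eq [IsFiniteMeasure (μHE[d] : Measure M)] (g : M → ℝ) :
    ∫ x, g x ∂μHE[d] = (μHE[d] (univ : Set M)).toReal * ∫ x, g x ∂lamInterior d M := by
  rw [lamInterior, integral_smul_measure, ENNReal.toReal_inv, smul_eq_mul]
  rcases eq_or_ne (μHE[d] (univ : Set M)) 0 with h | h
  · rw [Measure.measure_univ_eq_zero.1 h]; simp
  · rw [mul_inv_cancel_left₀]
    exact ENNReal.toReal_ne_zero.2 ⟨h, measure_ne_top _ _⟩

/-- The bound `C` does not enter the conclusion, but it keeps the essential supremum finite; an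
infinite one would give `supNorm` the value 0. -/
lemma ae_abs_le_supNorm [IsFiniteMeasure (μHE[d] : Measure M)] {u : M → ℝ} {C : ℝ}
    (hu : ∀ᵐ x ∂(μHE[d] : Measure M), |u x| ≤ C) :
    ∀ᵐ x ∂(μHE[d] : Measure M), |u x| ≤ supNorm d u := by
  have hc : (μHE[d] (univ : Set M))⁻¹ ≠ 0 := ENNReal.inv_ne_zero.2 (measure_ne_top _ _)
  have h1 : ∀ᵐ x ∂lamInterior d M, ‖u x‖ ≤ C := (Measure.ae_ennreal_smul_measure_iff hc).2 hu
  have h2 : eLpNorm u ⊤ (lamInterior d M) ≠ ⊤ := by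
    rw [eLpNorm_exponent_top]
    exact ((eLpNormEssSup_le_of_ae_bound h1).trans_lt ENNReal.ofReal_lt_top).ne
  have h3 : ∀ᵐ x ∂lamInterior d M, |u x| ≤ supNorm d u := by
    filter_upwards [ae_le_eLpNormEssSup (f := u) (μ := lamInterior d M)] with x hx
    rw [← eLpNorm_exponent_top] at hx
    have := ENNReal.toReal_mono h2 hx
    rwa [toReal_enorm] at this
  exact (Measure.ae_ennreal_smul_measure_iff hc).1 h3

lemma isFiniteMeasure_lamInterior [IsFiniteMeasure (μHE[d] : Measure M)] :
    IsFiniteMeasure (lamInterior d M) := by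
  rcases eq_or_ne (μHE[d] (univ : Set M)) 0 with h | h
  · rw [lamInterior, Measure.measure_univ_eq_zero.1 h, smul_zero]; infer_instance
  · exact Measure.smul_finite _ (ENNReal.inv_ne_top.2 h)

end Normalized

/-! ### The trace inequality -/

section BoundaryEstimate

variable {n : ℕ} {M : Type*} [EMetricSpace M]
  [ChartedSpace (EuclideanHalfSpace (n + 1)) M] [IsManifold (𝓡∂ (n + 1)) ∞ M]
  [RiemannianBundle (fun x : M ↦ TangentSpace (𝓡∂ (n + 1)) x)]
  [IsContMDiffRiemannianBundle (𝓡∂ (n + 1)) ∞ (EuclideanSpace ℝ (Fin (n + 1)))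
      (fun x : M ↦ TangentSpace (𝓡∂ (n + 1)) x)]
  [MeasurableSpace M] [BorelSpace M]
  [IsRiemannianManifold (𝓡∂ (n + 1)) M] [CompactSpace M]

/-- The trace inequality `∫_∂ |f|^p ≤ p G ∫ |f|^(p-1) |∇f| + L ∫ |f|^p` that follows from the
divergence theorem for `|f|^p ∇ρ`, with `G = |∇ρ|_∞` and `L = |(Δρ)⁻|_∞`. -/
theorem setIntegral_boundary_rpow_le {ρ f : M → ℝ} (hρ : ContMDiff (𝓡∂ (n + 1)) 𝓘(ℝ, ℝ) 1 ρ)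
    (hρN : ∀ x ∈ (𝓡∂ (n + 1)).boundary M, normalDeriv (d := n + 1) ρ x = -1)
    (hρLip : IsLipschitzField (grad (d := n + 1) ρ))
    (hf : ContMDiff (𝓡∂ (n + 1)) 𝓘(ℝ, ℝ) 1 f) {p : ℝ} (hp : 1 < p) :
    ∫ x in (𝓡∂ (n + 1)).boundary M, |f x| ^ p ∂μHE[n] ≤
      p * supNorm (n + 1) (fun x : M ↦ ‖grad (d := n + 1) ρ x‖) *
        ∫ x, |f x| ^ (p - 1) * ‖grad (d := n + 1) f x‖ ∂μHE[n + 1] +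
      supNorm (n + 1) (fun x : M ↦ (laplacian (d := n + 1) ρ x)⁻) *
        ∫ x, |f x| ^ p ∂μHE[n + 1] := by
  have hfin : IsFiniteMeasure (μHE[n + 1] : Measure M) := isFiniteMeasure_euclideanHausdorffMeasure
  set G := supNorm (n + 1) (fun x : M ↦ ‖grad (d := n + 1) ρ x‖) with hG
  set L := supNorm (n + 1) (fun x : M ↦ (laplacian (d := n + 1) ρ x)⁻) with hL
  have hGae : ∀ᵐ x ∂(μHE[n + 1] : Measure M), ‖grad (d := n + 1) ρ x‖ ≤ G := by
    obtain ⟨C, hC⟩ := isCompact_univ.exists_bound_of_continuousOn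
      (continuous_norm_grad hρ).continuousOn
    filter_upwards [ae_abs_le_supNorm (d := n + 1) (u := fun x : M ↦ ‖grad (d := n + 1) ρ x‖)
      (Eventually.of_forall fun x ↦ hC x (mem_univ x))] with x hx using (le_abs_self _).trans hx
  have hLae : ∀ᵐ x ∂(μHE[n + 1] : Measure M), -divergence (grad (d := n + 1) ρ) x ≤ L := by
    obtain ⟨C, hC⟩ := exists_ae_abs_divergence_le_of_compactSpace hρLip
    have h1 : ∀ᵐ x ∂(μHE[n + 1] : Measure M), |(laplacian (d := n + 1) ρ x)⁻| ≤ C := by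
      filter_upwards [hC] with x hx
      rw [abs_of_nonneg (negPart_nonneg _)]
      exact (sup_le (neg_le_abs _) (abs_nonneg _)).trans hx
    filter_upwards [ae_abs_le_supNorm h1] with x hx
    exact ((neg_le_negPart _).trans (le_abs_self _)).trans hx
  have hu : ContMDiff (𝓡∂ (n + 1)) 𝓘(ℝ, ℝ) 1 fun x ↦ |f x| ^ p :=
    (contDiff_norm_rpow (E := ℝ) hp).contMDiff.comp hf
  have hc1 : Continuous fun x ↦ |f x| ^ (p - 1) * ‖grad (d := n + 1) f x‖ :=
    (hf.continuous.abs.rpow_const fun x ↦ Or.inr (by linarith)).mul (continuous_norm_grad hf)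
  have hc2 : Continuous fun x ↦ |f x| ^ p := hu.continuous
  have hi1 := hc1.integrable_of_hasCompactSupport (μ := (μHE[n + 1] : Measure M))
    (HasCompactSupport.of_compactSpace _)
  have hi2 := hc2.integrable_of_hasCompactSupport (μ := (μHE[n + 1] : Measure M))
    (HasCompactSupport.of_compactSpace _)
  obtain ⟨-, hint, heq⟩ := divergence_theorem hρLip hρN hu
  rw [heq, ← integral_neg, ← integral_const_mul, ← integral_const_mul,
    ← integral_add (hi1.const_mul _) (hi2.const_mul _)]
  refine integral_mono_ae hint.neg ((hi1.const_mul _).add (hi2.const_mul _)) ?_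
  filter_upwards [hGae, hLae] with x hx1 hx2
  have hder := inner_grad_comp (hf.mdifferentiable one_ne_zero x)
    (hasDerivAt_abs_rpow (f x) hp) (grad (d := n + 1) ρ x)
  have h1 : |p * |f x| ^ (p - 2) * f x| = p * |f x| ^ (p - 1) := by
    rw [abs_mul, abs_mul, abs_of_pos (by linarith : 0 < p),
      abs_of_nonneg (Real.rpow_nonneg (abs_nonneg _) _), mul_assoc]
    congr 1
    -- At a zero of f the exponents cannot be added, but both sides vanish since p > 1.
    rcases eq_or_ne (f x) 0 with h | h
    · rw [h, abs_zero, mul_zero, Real.zero_rpow (by linarith)]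
    · rw [← Real.rpow_add_one (abs_ne_zero.2 h)]
      congr 1; ring
  have h2 : -inner ℝ (grad (d := n + 1) (fun x ↦ |f x| ^ p) x) (grad (d := n + 1) ρ x) ≤
      p * G * (|f x| ^ (p - 1) * ‖grad (d := n + 1) f x‖) := by
    rw [hder]
    refine (neg_le_abs _).trans ?_
    rw [abs_mul, h1]
    have h3 := abs_real_inner_le_norm (grad (d := n + 1) f x) (grad (d := n + 1) ρ x)
    calc p * |f x| ^ (p - 1) * |inner ℝ (grad (d := n + 1) f x) (grad (d := n + 1) ρ x)|
        ≤ p * |f x| ^ (p - 1) * (‖grad (d := n + 1) f x‖ * G) := by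
          refine mul_le_mul_of_nonneg_left (h3.trans (by gcongr)) (by positivity)
      _ = _ := by ring
  have h4 : -(|f x| ^ p * divergence (grad (d := n + 1) ρ) x) ≤ L * |f x| ^ p := by
    rw [← mul_neg, mul_comm]
    exact mul_le_mul_of_nonneg_right hx2 (by positivity)
  change -divSMul (fun x ↦ |f x| ^ p) (grad (d := n + 1) ρ) x ≤ _
  rw [divSMul, neg_add]
  exact add_le_add h2 h4

end BoundaryEstimate

/-! ### Combining the estimates -/

section Numeric

/-- Both bounds carry the factor D^(p/2), which the power 2/p turns into D. Subadditivity of t ↦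
t^(2/p), valid for p ≥ 2, separates the two summands. -/
lemma rpow_two_div_le {p r G L A B D I S T : ℝ} (hp : 2 ≤ p) (hr : 0 ≤ r) (hG : 0 ≤ G)
    (hL : 0 ≤ L) (hA : 0 ≤ A) (hB : 0 ≤ B) (hD : 0 ≤ D) (hI : 0 ≤ I)
    (h : I ≤ r * (p * G * S + L * T)) (hS : S ≤ A ^ (p - 1) * D ^ (p / 2))
    (hT : T ≤ B ^ p * D ^ (p / 2)) :
    I ^ (2 / p) ≤ ((r * G * p) ^ (2 / p) * A ^ (2 * (p - 1) / p) + (r * L) ^ (2 / p) * B ^ 2) * D := by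
  have hp0 : 0 < p := by linarith
  have h1 : I ≤ (r * G * p * A ^ (p - 1) + r * L * B ^ p) * D ^ (p / 2) := by
    calc I ≤ r * (p * G * S + L * T) := h
      _ ≤ r * (p * G * (A ^ (p - 1) * D ^ (p / 2)) + L * (B ^ p * D ^ (p / 2))) := by gcongr
      _ = _ := by ring
  calc I ^ (2 / p) ≤ ((r * G * p * A ^ (p - 1) + r * L * B ^ p) * D ^ (p / 2)) ^ (2 / p) := by
        gcongr
    _ = (r * G * p * A ^ (p - 1) + r * L * B ^ p) ^ (2 / p) * D := by
        rw [Real.mul_rpow (by positivity) (by positivity), ← Real.rpow_mul hD]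
        have : p / 2 * (2 / p) = 1 := by field_simp
        rw [this, Real.rpow_one]
    _ ≤ ((r * G * p * A ^ (p - 1)) ^ (2 / p) + (r * L * B ^ p) ^ (2 / p)) * D := by
        gcongr
        exact Real.rpow_add_le_add_rpow (by positivity) (by positivity) (by positivity)
          ((div_le_one hp0).2 hp)
    _ = _ := by
        rw [Real.mul_rpow (x := r * G * p) (by positivity) (by positivity),
          Real.mul_rpow (x := r * L) (by positivity) (by positivity), ← Real.rpow_mul hA, ← Real.rpow_mul hB]
        have e1 : (p - 1) * (2 / p) = 2 * (p - 1) / p := by ring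
        have e2 : p * (2 / p) = 2 := by field_simp
        rw [e1, e2, Real.rpow_two]

end Numeric

end RiemBoundary

end

/-! ### The boundary Sobolev inequality -/

theorem mainTheorem11 {d : ℕ} [NeZero d] (hd : 3 ≤ d)
    {M : Type*} [EMetricSpace M] [ChartedSpace (EuclideanHalfSpace d) M] [IsManifold (𝓡∂ d) ∞ M]
    [RiemannianBundle (fun x : M ↦ TangentSpace (𝓡∂ d) x)]
    [IsContMDiffRiemannianBundle (𝓡∂ d) ∞ (EuclideanSpace ℝ (Fin d))
      (fun x : M ↦ TangentSpace (𝓡∂ d) x)]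
    [IsRiemannianManifold (𝓡∂ d) M] [CompactSpace M] [ConnectedSpace M]
    [MeasurableSpace M] [BorelSpace M]
    (hbdry : IsConnected ((𝓡∂ d).boundary M))
    (ρ : M → ℝ) (hρ : ContMDiff (𝓡∂ d) 𝓘(ℝ, ℝ) 1 ρ)
    (hρN : ∀ x ∈ (𝓡∂ d).boundary M, RiemBoundary.normalDeriv (d := d) ρ x = -1)
    (hρLip : RiemBoundary.IsLipschitzField (RiemBoundary.grad (d := d) ρ))
    (f : M → ℝ) (hf : ContMDiff (𝓡∂ d) 𝓘(ℝ, ℝ) 1 f)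
    (hf0 : ∫ x, f x ∂(RiemBoundary.lamInterior d M) = 0)
    (p : ℝ) (hp : p ∈ Set.Icc (2 : ℝ) ((2 * (d : ℝ) - 2) / ((d : ℝ) - 2)))
    (A B : ℝ) (hA : RiemBoundary.IsSobolevPoincareConst d M (2 * (p - 1)) 2 A)
    (hB : RiemBoundary.IsSobolevPoincareConst d M p 2 B) :
    (∫ x, |f x| ^ p ∂(RiemBoundary.lamBoundary d M)) ^ (2 / p) ≤
      ((RiemBoundary.volumeRatio d M *
            RiemBoundary.supNorm d (fun x : M ↦ ‖RiemBoundary.grad (d := d) ρ x‖) * p) ^ (2 / p) *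
          A ^ (2 * (p - 1) / p) +
        (RiemBoundary.volumeRatio d M *
            RiemBoundary.supNorm d (fun x : M ↦ (RiemBoundary.laplacian (d := d) ρ x)⁻)) ^ (2 / p) *
          B ^ 2) *
      ∫ x, ‖RiemBoundary.grad (d := d) f x‖ ^ 2 ∂(RiemBoundary.lamInterior d M) := by
  -- With d = n + 1 the boundary measure in dimension d - 1 becomes `μHE[n]` by computation.
  obtain ⟨n, rfl⟩ : ∃ n, d = n + 1 := ⟨d - 1, by omega⟩
  have hfin : IsFiniteMeasure (μHE[n + 1] : Measure M) :=
    RiemBoundary.isFiniteMeasure_euclideanHausdorffMeasure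
  have hfinLam : IsFiniteMeasure (RiemBoundary.lamInterior (n + 1) M) :=
    RiemBoundary.isFiniteMeasure_lamInterior
  have hp2 : 2 ≤ p := hp.1
  have hp0 : 0 < p := by linarith
  have hc1 : Continuous fun x ↦ |f x| ^ (p - 1) :=
    hf.continuous.abs.rpow_const fun x ↦ Or.inr (by linarith)
  have hc2 := RiemBoundary.continuous_norm_grad hf
  set lam := RiemBoundary.lamInterior (n + 1) M with hlam
  set D := ∫ x, ‖RiemBoundary.grad (d := n + 1) f x‖ ^ 2 ∂lam with hD
  have hD0 : 0 ≤ D := integral_nonneg fun x ↦ by positivity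
  have hD2 : ∫ x, ‖RiemBoundary.grad (d := n + 1) f x‖ ^ (2 : ℝ) ∂lam = D := by
    simp only [Real.rpow_two, hD]
  have hA' := hA.2 f hf
  have hB' := hB.2 f hf
  -- The mean of f is zero, so the Sobolev–Poincaré inequalities bound the norms of f itself.
  rw [← hlam, hf0, hD2] at hA' hB'
  simp only [sub_zero] at hA' hB'
  have hT : ∫ x, |f x| ^ p ∂lam ≤ B ^ p * D ^ (p / 2) := by
    have h0 : 0 ≤ ∫ x, |f x| ^ p ∂lam := integral_nonneg fun x ↦ by positivity
    calc ∫ x, |f x| ^ p ∂lam = ((∫ x, |f x| ^ p ∂lam) ^ (1 / p)) ^ p := by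
          rw [← Real.rpow_mul h0, one_div_mul_cancel hp0.ne', Real.rpow_one]
      _ ≤ (B * D ^ (1 / 2 : ℝ)) ^ p := by gcongr
      _ = B ^ p * D ^ (p / 2) := by
          rw [Real.mul_rpow hB.1 (by positivity), ← Real.rpow_mul hD0]
          congr 2; ring
  have hS : ∫ x, |f x| ^ (p - 1) * ‖RiemBoundary.grad (d := n + 1) f x‖ ∂lam ≤
      A ^ (p - 1) * D ^ (p / 2) := by
    have h0 : 0 ≤ ∫ x, |f x| ^ (2 * (p - 1)) ∂lam := integral_nonneg fun x ↦ by positivity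
    have hCS := integral_mul_le_Lp_mul_Lq_of_nonneg (μ := lam) Real.HolderConjugate.two_two
      (f := fun x ↦ |f x| ^ (p - 1)) (g := fun x ↦ ‖RiemBoundary.grad (d := n + 1) f x‖)
      (Filter.Eventually.of_forall fun x ↦ by positivity)
      (Filter.Eventually.of_forall fun x ↦ by positivity)
      (hc1.memLp_of_hasCompactSupport (HasCompactSupport.of_compactSpace _))
      (hc2.memLp_of_hasCompactSupport (HasCompactSupport.of_compactSpace _))
    rw [hD2] at hCS
    have h1 : ∀ x, (|f x| ^ (p - 1)) ^ (2 : ℝ) = |f x| ^ (2 * (p - 1)) := fun x ↦ by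
      rw [← Real.rpow_mul (abs_nonneg _), mul_comm]
    simp only [h1] at hCS
    calc _ ≤ (∫ x, |f x| ^ (2 * (p - 1)) ∂lam) ^ (1 / 2 : ℝ) * D ^ (1 / 2 : ℝ) := hCS
      -- The square root of the integral is the (p-1)-th power of the norm with exponent 2(p-1), so
      -- the inequality for `A` applies.
      _ = ((∫ x, |f x| ^ (2 * (p - 1)) ∂lam) ^ (1 / (2 * (p - 1)))) ^ (p - 1) *
          D ^ (1 / 2 : ℝ) := by
          rw [← Real.rpow_mul h0]
          congr 2
          have : p - 1 ≠ 0 := by linarith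
          field_simp
      _ ≤ (A * D ^ (1 / 2 : ℝ)) ^ (p - 1) * D ^ (1 / 2 : ℝ) := by
          gcongr
          linarith
      _ = A ^ (p - 1) * D ^ (p / 2) := by
          rw [Real.mul_rpow hA.1 (by positivity), ← Real.rpow_mul hD0, mul_assoc,
            ← Real.rpow_add_of_nonneg hD0 (by linarith) (by norm_num)]
          congr 2; ring
  have key := RiemBoundary.setIntegral_boundary_rpow_le hρ hρN hρLip hf (by linarith : 1 < p)
  rw [RiemBoundary.integral_euclideanHausdorffMeasure_eq,
    RiemBoundary.integral_euclideanHausdorffMeasure_eq, ← hlam] at key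
  refine RiemBoundary.rpow_two_div_le hp2 (by rw [RiemBoundary.volumeRatio]; positivity)
    ENNReal.toReal_nonneg ENNReal.toReal_nonneg hA.1 hB.1 hD0
    (integral_nonneg fun x ↦ by positivity) ?_ hS hT
  -- The factor |∂Ω|⁻¹ occurs in the boundary average and in the volume ratio, and |Ω| comes from
  -- normalising the interior integrals. Taking out the common factor needs only |∂Ω|⁻¹ ≥ 0, which
  -- holds also for the default values.
  rw [RiemBoundary.lamBoundary, integral_smul_measure, ENNReal.toReal_inv, smul_eq_mul,
    RiemBoundary.volumeRatio, div_eq_inv_mul, mul_assoc]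
  refine mul_le_mul_of_nonneg_left (key.trans_eq ?_) (by positivity)
  ring
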